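/- Let $L\ge 1$, and let $\Lambda$ be the $L\times L$ triangular lattice with periodic boundary conditions: its sites are $(\mathbb Z/L)^2$, and $v$ is adjacent to the sites $v\pm(1,0)$, $v\pm(0,1)$, $v\pm(1,1)$ different from $v$. One site $f$ holds an immobile food particle, and $n\ge 0$ further sites hold compression-state particles, at most one particle per site; particles are indistinguishable. All $n+1$ of these (the food particle included) are called cluster particles. A configuration is the set of sites occupied by cluster particles. It is connected if this set induces a connected subgraph of $\Lambda$, and hole-free if no closed path over occupied sites encircles an empty site. (Encircling is understood for contractible closed paths, in the universal cover, the infinite triangular lattice $\mathbb Z^2$: a closed walk $c$ in $\mathbb Z^2$ encircles a site $v$ if $v$ is not on $c$ and only finitely many sites can be reached from $v$ along lattice paths avoiding $c$.) Valid compression moves. For a site $\ell$ let $N(\ell)$ be the set of its adjacent sites. Let $\ell\neq f$ be occupied, $\ell'\in N(\ell)$ empty, $N(\ell\cup\ell')=(N(\ell)\cup N(\ell'))\setminus\{\ell,\ell'\}$, and let $\mathbb S$ be the set of cluster particles in $N(\ell)\cap N(\ell')$. Moving the particle from $\ell$ to $\ell'$ is a valid compression move if $N(\ell)$ contains fewer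 than $5$ cluster particles and at least one of the following holds: 1. $|\mathbb S|\ge 1$, and every cluster particle in $N(\ell\cup\ell')$ is connected to a cluster particle in $\mathbb S$ by a path of cluster particles within $N(\ell\cup\ell')$; 2. $|\mathbb S|=0$, both $N(\ell)\setminus\{\ell'\}$ and $N(\ell')\setminus\{\ell\}$ contain a cluster particle, all cluster particles in $N(\ell)\setminus\{\ell'\}$ are connected by paths of cluster particles within this set, and likewise for $N(\ell')\setminus\{\ell\}$. Enough room. Suppose that for every site $v$ and every lattice direction $d$ the $n+1$ sites $v,v+d,\dots,v+nd$ are distinct and only consecutive ones among them are adjacent, i.e. all particles can be laid out on a straight line at any position and in any direction without the line meeting itself or closing up to a ring. Then: (a) Any connected configuration of $n$ particles and the food at $f$ can be transformed, by a finite sequence of valid compression moves (the food remaining fixed), into any connected hole-free configuration of $n$ particles and the food at $f$. (b) Consequently, for every $\lambda>0$ the compression Markov chain with food is irreducible. Its state space is the set of connected hole-free configurations of $n$ particles and the food at $f$. In each step one of the $n$ particles and one of the six directions are chosen uniformly at random; if moving the particle in that direction is a valid compression move, it is made with probability $\min\{1,\lambda^{e(\sigma')-e(\sigma)}\}$, where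 $e$ counts the lattice edges between cluster particles and $\sigma,\sigma'$ are the configurations before and after the move; otherwise the configuration stays unchanged. These transition probabilities form a stochastic matrix on the state space (valid moves never leave it), and this matrix is irreducible. -/

import Mathlib

/-- The six unit steps of the triangular lattice in the coordinates in which `(x, y)` is joined to
`(x+1, y)`, `(x+1, y+1)`, `(x, y+1)`, `(x-1, y)`, `(x-1, y-1)`, `(x, y-1)`,
listed in cyclic order. -/
def triDir (R : Type) [Ring R] : Fin 6 → R × R :=
  ![(1, 0), (1, 1), (0, 1), (-1, 0), (-1, -1), (0, -1)]

/-- The triangular lattice with coordinates in `R`: the infinite lattice for `R = ℤ`, and the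
`L × L` piece with periodic boundary conditions for `R = ZMod L`. -/
def triLattice (R : Type) [Ring R] : SimpleGraph (R × R) where
  Adj u v := u ≠ v ∧ ∃ i, v = u + triDir R i
  symm := ⟨by
    rintro u v ⟨hne, i, rfl⟩
    refine ⟨hne.symm, i + 3, ?_⟩
    have h : triDir R i + triDir R (i + 3) = 0 := by
      fin_cases i <;> simp [triDir]
    rw [add_assoc, h, add_zero]⟩
  loopless := ⟨fun _ h => h.1 rfl⟩

/-- The sites of the `L × L` triangular lattice with periodic boundary conditions. -/
abbrev Site (L : ℕ) : Type := ZMod L × ZMod L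

/-- `u` and `v` lie in `A` and are joined by a path of `G` all of whose vertices are in `A`. -/
def ConnectedThrough {V : Type} (G : SimpleGraph V) (A : Set V) (u v : V) : Prop :=
  ∃ (hu : u ∈ A) (hv : v ∈ A), (G.induce A).Reachable ⟨u, hu⟩ ⟨v, hv⟩

/-- The `m` sites `v, v + d, …, v + (m-1) d` of a straight line are, for every position `v` and
every lattice direction `d`, distinct, and only consecutive ones are adjacent: the line neither
crosses itself nor closes up to a ring. -/
def LineFits (L m : ℕ) : Prop :=
  ∀ (v : Site L) (i : Fin 6) (j k : ℕ), j < k → k < m →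
    v + j • triDir (ZMod L) i ≠ v + k • triDir (ZMod L) i ∧
    ((triLattice (ZMod L)).Adj (v + j • triDir (ZMod L) i) (v + k • triDir (ZMod L) i) →
      k = j + 1)

/-- A connected configuration of `n` particles together with the food particle: `s` is the set of
sites occupied by cluster particles (the food particle included; particles are anonymous). -/
structure IsConnectedConfig {L : ℕ} (food : Site L) (n : ℕ) (s : Finset (Site L)) : Prop where
  food_mem : food ∈ s
  card_eq : s.card = n + 1
  connected : ((triLattice (ZMod L)).induce (s : Set (Site L))).Connected

/-- A closed path `c` of the infinite triangular lattice encircles `v`: the site `v` is not on `c`,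
and only finitely many sites can be reached from `v` without meeting `c`. -/
def Encircles {a : ℤ × ℤ} (c : (triLattice ℤ).Walk a a) (v : ℤ × ℤ) : Prop :=
  v ∉ c.support ∧ {u | ConnectedThrough (triLattice ℤ) {w | w ∉ c.support} v u}.Finite

/-- The covering of the periodic lattice by the infinite one. -/
def toSite (L : ℕ) (v : ℤ × ℤ) : Site L := ((v.1 : ZMod L), (v.2 : ZMod L))

/-- No closed path over the particles encircles an empty site. Encircling is read off in the
universal cover: the closed paths there are the lifts of the contractible closed paths of the
torus. -/
def HoleFree {L : ℕ} (s : Finset (Site L)) : Prop :=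
  ∀ (a : ℤ × ℤ) (c : (triLattice ℤ).Walk a a), (∀ u ∈ c.support, toSite L u ∈ s) →
    ∀ v : ℤ × ℤ, toSite L v ∉ s → ¬ Encircles c v

/-- `N(l)`, the sites adjacent to `l`. -/
def nbrs {L : ℕ} (l : Site L) : Set (Site L) := {v | (triLattice (ZMod L)).Adj l v}

/-- `N(l ∪ l')`, the sites other than `l`, `l'` adjacent to `l` or `l'`. -/
def pairNbrs {L : ℕ} (l l' : Site L) : Set (Site L) := (nbrs l ∪ nbrs l') \ {l, l'}

/-- `𝕊`, the cluster particles adjacent to both `l` and `l'`. -/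
def commonNbrs {L : ℕ} (s : Finset (Site L)) (l l' : Site L) : Set (Site L) :=
  nbrs l ∩ nbrs l' ∩ s

/-- Property 1: `|𝕊| ≥ 1`, and every cluster particle in `N(l ∪ l')` is connected to one in `𝕊`
by a path of cluster particles in `N(l ∪ l')`. -/
def Property1 {L : ℕ} (s : Finset (Site L)) (l l' : Site L) : Prop :=
  (commonNbrs s l l').Nonempty ∧
  ∀ u ∈ pairNbrs l l' ∩ s, ∃ w ∈ commonNbrs s l l',
    ConnectedThrough (triLattice (ZMod L)) (pairNbrs l l' ∩ s) u w

/-- Property 2: `|𝕊| = 0`, each of `l`, `l'` has a neighboring cluster particle (other than the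
moving one), and the cluster particles in `N(l) \ {l'}`, respectively `N(l') \ {l}`, are connected
by paths of cluster particles within this set. -/
def Property2 {L : ℕ} (s : Finset (Site L)) (l l' : Site L) : Prop :=
  commonNbrs s l l' = ∅ ∧
  ((nbrs l \ {l'}) ∩ s).Nonempty ∧ ((nbrs l' \ {l}) ∩ s).Nonempty ∧
  (∀ u ∈ (nbrs l \ {l'}) ∩ s, ∀ w ∈ (nbrs l \ {l'}) ∩ s,
    ConnectedThrough (triLattice (ZMod L)) ((nbrs l \ {l'}) ∩ s) u w) ∧
  (∀ u ∈ (nbrs l' \ {l}) ∩ s, ∀ w ∈ (nbrs l' \ {l}) ∩ s,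
    ConnectedThrough (triLattice (ZMod L)) ((nbrs l' \ {l}) ∩ s) u w)

/-- In the configuration `s`, moving the particle at `l` (not the food particle) to the empty
adjacent site `l'` is a valid compression move. -/
def IsValidMove {L : ℕ} (food : Site L) (s : Finset (Site L)) (l l' : Site L) : Prop :=
  l ∈ s ∧ l ≠ food ∧ l' ∉ s ∧ (triLattice (ZMod L)).Adj l l' ∧
  (Property1 s l l' ∨ Property2 s l l') ∧ (nbrs l ∩ s).ncard < 5

/-- The configuration after the particle at `l` has moved to `l'`. -/
def moveParticle {L : ℕ} (s : Finset (Site L)) (l l' : Site L) : Finset (Site L) :=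
  insert l' (s.erase l)

/-- `t` arises from `s` by one valid compression move. -/
def CompressionStep {L : ℕ} (food : Site L) (s t : Finset (Site L)) : Prop :=
  ∃ l l', IsValidMove food s l l' ∧ t = moveParticle s l l'

/-- `e(s)`, the number of lattice edges between cluster particles. -/
noncomputable def edgeCount {L : ℕ} (s : Finset (Site L)) : ℕ :=
  ((triLattice (ZMod L)).induce (s : Set (Site L))).edgeSet.ncard

open Classical in
/-- The probability that one step leads from `s` to `t ≠ s`: a uniformly random particle (not the
food) and a uniformly random direction are chosen; a valid move is made with probability
`min {1, lam ^ (e(t) - e(s))}`. -/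
noncomputable def moveProb {L : ℕ} (food : Site L) (lam : ℝ) (s t : Finset (Site L)) : ℝ :=
  ∑ l ∈ s.erase food, ∑ i : Fin 6,
    if IsValidMove food s l (l + triDir (ZMod L) i) ∧
        t = moveParticle s l (l + triDir (ZMod L) i) then
      1 / ((s.erase food).card * 6) * min 1 (lam ^ ((edgeCount t : ℤ) - (edgeCount s : ℤ)))
    else 0

/-- Transition probabilities of the compression chain: with the remaining probability the
configuration stays as it is. -/
noncomputable def transitionProb {L : ℕ} [NeZero L] (food : Site L) (lam : ℝ)
    (s t : Finset (Site L)) : ℝ :=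
  if t = s then 1 - ∑ u ∈ Finset.univ.erase s, moveProb food lam s u else moveProb food lam s t

/-- The state space: connected hole-free configurations of `n` particles and the food particle. -/
abbrev ChainState {L : ℕ} (food : Site L) (n : ℕ) : Type :=
  {s : Finset (Site L) // IsConnectedConfig food n s ∧ HoleFree s}

noncomputable instance {L : ℕ} [NeZero L] (food : Site L) (n : ℕ) :
    Fintype (ChainState food n) :=
  Fintype.ofFinite _

/-- The transition matrix of the compression chain with food on its state space. -/
noncomputable def compressionMatrix {L : ℕ} [NeZero L] (food : Site L) (n : ℕ) (lam : ℝ) :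
    Matrix (ChainState food n) (ChainState food n) ℝ :=
  Matrix.of fun s t => transitionProb food lam s.1 t.1

/-! Configurations are unrolled into the infinite lattice and straightened there into one canonical
line. A path from `s` to `t` straightens `s` and then runs the straightening of `t` backwards, which
is possible because `t` has no holes.

Unrolling. For `n ≥ 2` the room condition gives `n + 2 ≤ L`. A connected configuration lifts to a
connected planar set of `n + 1` sites (`IsConnectedConfig.exists_planeConf`), too small to notice
the periodicity, so planar moves project to valid moves (`PlaneStep.compressionStep`). The cases `n
≤ 1` are done by hand.

Straightening (`PlaneConf.reach_planeLine`). Among the reachable planar configurations, consider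
those in a strip `X ≤ x ≤ X'` of least width; their border columns are never empty. An end particle
of an extreme run in a border column can be removed, either along its diagonal into the interior or
by a walk around the run to its other end (`PlaneConf.exists_raised`). Chains of corners on a
diagonal may block this. They dissolve from their far end (`PlaneConf.exists_diagShift`), unless the
immobile food is one of the corners. If the left column is minimal in a suitable order, no removal
can improve it; hence it is a single run starting on the diagonal of the food, and the food has no
neighbour in the three directions left, down-left and down (`TightFamily.left_column`). So the food
has a neighbour on the opposite side and cannot block the right column. If `X' > 0`, the right
column could therefore be reduced, except that this may push particles into the left column. The
exceptional configurations are so special that they let the left column be improved after all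
(`TightFamily.right_eq_zero`). Hence `X' = 0`, by symmetry `X = 0`, and everything lies in the
column of the food.

Reversal and holes. The validity of a move depends only on the eight sites around the moving pair
(`RingOK`). This condition is symmetric under reversing the move, except for the degree bound; the
bound fails for the reversed move only if the target was an empty site surrounded by particles, that
is, a hole (`RingOK.reverse`). It is also self-dual under exchanging particles and empty sites
(`RingOK.compl`), so empty sites stay linked and moves create no holes (`IsValidMove.holeFree`).
This argument uses the description of holes as finite components of the empty sites, which rests on
a mod 2 separation argument (`exists_encircles`).

Irreducibility of the chain follows, since every valid move has positive probability. -/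

/-! ### Connectivity through a set of vertices -/

namespace ConnectedThrough

variable {V : Type} {G : SimpleGraph V} {A B : Set V} {u v w : V}

theorem refl (hu : u ∈ A) : ConnectedThrough G A u u := ⟨hu, hu, .rfl⟩

theorem symm (h : ConnectedThrough G A u v) : ConnectedThrough G A v u :=
  ⟨h.2.1, h.1, h.2.2.symm⟩

theorem trans (h : ConnectedThrough G A u v) (h' : ConnectedThrough G A v w) :
    ConnectedThrough G A u w :=
  ⟨h.1, h'.2.1, h.2.2.trans h'.2.2⟩

theorem of_adj (hu : u ∈ A) (hv : v ∈ A) (h : G.Adj u v) : ConnectedThrough G A u v :=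
  ⟨hu, hv, SimpleGraph.Adj.reachable (by simpa using h)⟩

theorem mem_left (h : ConnectedThrough G A u v) : u ∈ A := h.1

theorem mem_right (h : ConnectedThrough G A u v) : v ∈ A := h.2.1

/-- Induction along a path towards its end point. -/
theorem induction_head {P : V → Prop} (h : ConnectedThrough G A u v) (hv : P v)
    (step : ∀ a b, a ∈ A → G.Adj a b → ConnectedThrough G A b v → P b → P a) : P u := by
  obtain ⟨hu, hv', h⟩ := h
  rw [SimpleGraph.reachable_iff_reflTransGen] at h
  suffices H : ∀ a : A, Relation.ReflTransGen (G.induce A).Adj a ⟨v, hv'⟩ → P a from H _ h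
  intro a ha
  induction ha using Relation.ReflTransGen.head_induction_on with
  | refl => exact hv
  | head h1 h2 ih =>
    refine step _ _ (Subtype.mem _) (by simpa using h1) ⟨Subtype.mem _, hv', ?_⟩ ih
    rwa [SimpleGraph.reachable_iff_reflTransGen]

/-- Induction along a path away from its starting point. -/
theorem induction_tail {P : V → Prop} (h : ConnectedThrough G A u v) (hu : P u)
    (step : ∀ a b, b ∈ A → G.Adj a b → ConnectedThrough G A u a → P a → P b) : P v :=
  h.symm.induction_head hu fun a b ha hab hb hP => step b a ha hab.symm hb.symm hP

theorem mono (hAB : A ⊆ B) (h : ConnectedThrough G A u v) : ConnectedThrough G B u v := by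
  refine h.induction_head (P := fun u => ConnectedThrough G B u v) (refl (hAB h.mem_right))
    fun a b ha hab hb hP => ?_
  exact (of_adj (hAB ha) hP.mem_left hab).trans hP

theorem map {V' : Type} {G' : SimpleGraph V'} {A' : Set V'} (f : V → V')
    (hf : ∀ a ∈ A, f a ∈ A') (hadj : ∀ a ∈ A, ∀ b ∈ A, G.Adj a b → G'.Adj (f a) (f b))
    (h : ConnectedThrough G A u v) : ConnectedThrough G' A' (f u) (f v) := by
  refine h.induction_head (P := fun u => ConnectedThrough G' A' (f u) (f v))
    (refl (hf _ h.mem_right)) fun a b ha hab hb hP => ?_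
  exact (of_adj (hf _ ha) hP.mem_left (hadj _ ha _ hb.mem_left hab)).trans hP

end ConnectedThrough

section
variable {V : Type} {G : SimpleGraph V}

theorem induce_connected_iff {A : Set V} :
    (G.induce A).Connected ↔ A.Nonempty ∧ ∀ u ∈ A, ∀ v ∈ A, ConnectedThrough G A u v := by
  constructor
  · intro h
    obtain ⟨a⟩ := h.nonempty
    exact ⟨⟨a, a.2⟩, fun u hu v hv => ⟨hu, hv, h.preconnected _ _⟩⟩
  · rintro ⟨⟨a, ha⟩, h⟩
    have : Nonempty A := ⟨⟨a, ha⟩⟩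
    exact ⟨fun u v => (h u u.2 v v.2).2.2⟩

theorem induce_connected_of_base {A : Set V} {a : V} (ha : a ∈ A)
    (h : ∀ u ∈ A, ConnectedThrough G A u a) : (G.induce A).Connected :=
  induce_connected_iff.2 ⟨⟨a, ha⟩, fun u hu v hv => (h u hu).trans (h v hv).symm⟩

/-- In a connected set, every vertex other than `l` reaches a neighbour of `l` without
meeting `l`. -/
theorem exists_connectedThrough_adj {A : Set V} {l u : V}
    (h : ConnectedThrough G A u l) (hne : u ≠ l) :
    ∃ w ∈ A, G.Adj l w ∧ ConnectedThrough G (A \ {l}) u w := by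
  refine h.induction_head (P := fun u => u ≠ l → ∃ w ∈ A, G.Adj l w ∧
    ConnectedThrough G (A \ {l}) u w) (fun h => (h rfl).elim) (fun a b ha hab hb ih hal => ?_) hne
  by_cases hbl : b = l
  · subst hbl
    exact ⟨a, ha, hab.symm, .refl ⟨ha, hal⟩⟩
  · obtain ⟨w, hw, hlw, hbw⟩ := ih hbl
    have hab' : ConnectedThrough G (A \ {l}) a b :=
      .of_adj ⟨ha, hal⟩ ⟨hb.mem_left, hbl⟩ hab
    exact ⟨w, hw, hlw, hab'.trans hbw⟩

/-- The local condition under which a particle may be moved from `l` to `l'` in the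
configuration `A`. -/
def LocallyConnectedMove (G : SimpleGraph V) (A : Set V) (l l' : V) : Prop :=
  ((G.neighborSet l ∩ G.neighborSet l' ∩ A).Nonempty ∧
    ∀ u ∈ ((G.neighborSet l ∪ G.neighborSet l') \ {l, l'}) ∩ A,
      ∃ w ∈ G.neighborSet l ∩ G.neighborSet l' ∩ A,
        ConnectedThrough G (((G.neighborSet l ∪ G.neighborSet l') \ {l, l'}) ∩ A) u w) ∨
  (G.neighborSet l ∩ G.neighborSet l' ∩ A = ∅ ∧
    ((G.neighborSet l \ {l'}) ∩ A).Nonempty ∧ ((G.neighborSet l' \ {l}) ∩ A).Nonempty ∧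
    (∀ u ∈ (G.neighborSet l \ {l'}) ∩ A, ∀ w ∈ (G.neighborSet l \ {l'}) ∩ A,
      ConnectedThrough G ((G.neighborSet l \ {l'}) ∩ A) u w) ∧
    (∀ u ∈ (G.neighborSet l' \ {l}) ∩ A, ∀ w ∈ (G.neighborSet l' \ {l}) ∩ A,
      ConnectedThrough G ((G.neighborSet l' \ {l}) ∩ A) u w))

/-- Without `l`, every particle still reaches an old neighbour of `l`. In the first alternative this
neighbour is linked near the pair to a common neighbour, hence to `l'`. In the second, the
neighbours of `l` hang together, and a particle next to `l'` reaches one of them. -/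
theorem LocallyConnectedMove.connected {A : Set V} {l l' : V} (h : LocallyConnectedMove G A l l')
    (hl : l ∈ A) (hl' : l' ∉ A) (hA : (G.induce A).Connected) :
    (G.induce (insert l' (A \ {l}))).Connected := by
  rw [induce_connected_iff] at hA
  have hne : ∀ u ∈ A, u ≠ l' := fun u hu h => hl' (h ▸ hu)
  have hsub : A \ {l} ⊆ insert l' (A \ {l}) := Set.subset_insert _ _
  have key : ∀ u ∈ A \ {l}, ∃ w ∈ (G.neighborSet l \ {l'}) ∩ A,
      ConnectedThrough G (A \ {l}) u w := by
    intro u hu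
    obtain ⟨w, hw, hlw, h⟩ := exists_connectedThrough_adj (hA.2 u hu.1 l hl) hu.2
    exact ⟨w, ⟨⟨hlw, hne w hw⟩, hw⟩, h⟩
  refine induce_connected_of_base (Set.mem_insert l' _) ?_
  have base : ConnectedThrough G (insert l' (A \ {l})) l' l' := .refl (Set.mem_insert _ _)
  have nbr : ∀ w ∈ A, w ≠ l → G.Adj l' w → ConnectedThrough G (insert l' (A \ {l})) w l' :=
    fun w hw hwl h => .of_adj (hsub ⟨hw, hwl⟩) (Set.mem_insert _ _) h.symm
  rintro u (rfl | hu)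
  · exact base
  obtain ⟨w, ⟨⟨hlw, hwl'⟩, hw⟩, huw⟩ := key u hu
  refine (huw.mono hsub).trans ?_
  have hlw' : w ≠ l := fun h => G.loopless.irrefl l (by subst h; exact hlw)
  rcases h with ⟨-, h⟩ | ⟨-, -, ⟨v, ⟨hv, hvl⟩, hvA⟩, h, -⟩
  · obtain ⟨x, ⟨⟨hlx, hl'x⟩, hx⟩, hwx⟩ := h w ⟨⟨Or.inl hlw, by simp [hlw', hwl']⟩, hw⟩
    refine (hwx.mono ?_).trans (nbr x hx (fun h => G.loopless.irrefl l (h ▸ hlx)) hl'x)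
    rintro y ⟨⟨-, hy⟩, hyA⟩
    exact hsub ⟨hyA, fun h => hy (Or.inl h)⟩
  · obtain ⟨x, hx, hvx⟩ := key v ⟨hvA, hvl⟩
    refine ((h w ⟨⟨hlw, hwl'⟩, hw⟩ x hx).mono ?_).trans
      ((hvx.symm.mono hsub).trans (nbr v hvA hvl hv))
    rintro y ⟨⟨hy, -⟩, hyA⟩
    exact hsub ⟨hyA, fun h => G.loopless.irrefl l (h ▸ hy)⟩

end

theorem isValidMove_iff {L : ℕ} {food : Site L} {s : Finset (Site L)} {l l' : Site L} :
    IsValidMove food s l l' ↔ l ∈ s ∧ l ≠ food ∧ l' ∉ s ∧ (triLattice (ZMod L)).Adj l l' ∧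
      LocallyConnectedMove (triLattice (ZMod L)) s l l' ∧ (nbrs l ∩ s).ncard < 5 :=
  Iff.rfl

/-! ### The eight sites around a pair of adjacent sites -/

/-- The triangular lattice steps of `R` are distinguishable up to length three. -/
def NoShortLoops (R : Type) [Ring R] : Prop := ∀ z : ℤ, |z| ≤ 3 → (z : R) = 0 → z = 0

theorem noShortLoops_int : NoShortLoops ℤ := fun z _ h => by simpa using h

section
variable {R : Type} [Ring R]

theorem triDir_cast (i : Fin 6) :
    triDir R i = (((triDir ℤ i).1 : R), ((triDir ℤ i).2 : R)) := by
  fin_cases i <;> simp [triDir]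

theorem NoShortLoops.eq_zero (hR : NoShortLoops R) {z : ℤ × ℤ} (h1 : |z.1| ≤ 3) (h2 : |z.2| ≤ 3)
    (h : ((z.1 : R), (z.2 : R)) = 0) : z = 0 := by
  rw [Prod.ext_iff] at h
  exact Prod.ext (hR _ h1 h.1) (hR _ h2 h.2)

theorem triDir_add_succ (i : Fin 6) : triDir R i + triDir R (i + 2) = triDir R (i + 1) := by
  fin_cases i <;> simp [triDir]

theorem triDir_add_opp (i : Fin 6) : triDir R i + triDir R (i + 3) = 0 := by
  fin_cases i <;> simp [triDir]

theorem NoShortLoops.triDir_ne_zero (hR : NoShortLoops R) (i : Fin 6) : triDir R i ≠ 0 := by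
  intro h
  rw [triDir_cast] at h
  have := hR.eq_zero (z := triDir ℤ i) (by fin_cases i <;> decide) (by fin_cases i <;> decide) h
  revert this
  fin_cases i <;> decide

theorem NoShortLoops.eq_opp (hR : NoShortLoops R) {i k : Fin 6}
    (h : triDir R i + triDir R k = 0) : k = i + 3 := by
  simp only [triDir_cast (R := R)] at h
  have := hR.eq_zero (z := triDir ℤ i + triDir ℤ k) (by clear h; revert i k; decide)
    (by clear h; revert i k; decide) (by simpa using h)
  clear h
  revert i k
  decide

/-- The relation involves three unit steps, so its coordinates are at most three in absolute value;
this explains the bound in `NoShortLoops`. -/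
theorem NoShortLoops.eq_common (hR : NoShortLoops R) {i j k : Fin 6}
    (h : triDir R j = triDir R i + triDir R k) : j = i + 1 ∨ j = i + 5 := by
  simp only [triDir_cast (R := R)] at h
  have := hR.eq_zero (z := triDir ℤ j - (triDir ℤ i + triDir ℤ k))
    (by clear h; revert i j k; decide)
    (by clear h; revert i j k; decide) (by
      rw [← sub_eq_zero] at h
      simpa using h)
  clear h
  revert i j k
  decide

theorem NoShortLoops.adj_iff (hR : NoShortLoops R) {u v : R × R} :
    (triLattice R).Adj u v ↔ ∃ i, v = u + triDir R i := by
  refine ⟨fun h => h.2, fun ⟨i, hi⟩ => ⟨fun h => ?_, i, hi⟩⟩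
  rw [← h, left_eq_add] at hi
  exact hR.triDir_ne_zero i hi

theorem NoShortLoops.adj_ring (hR : NoShortLoops R) (v : R × R) (j : Fin 6) :
    (triLattice R).Adj (v + triDir R j) (v + triDir R (j + 1)) := by
  rw [hR.adj_iff]
  exact ⟨j + 2, by rw [add_assoc, triDir_add_succ]⟩

end

/-- The local condition of a valid move in terms of the occupation of the eight sites around
the pair: `c₁, b₁, b₂, b₃, c₂, a₃, a₂, a₁` in cyclic order, the `aᵢ` being adjacent to the old and
the `bᵢ` adjacent to the new position only. -/
def RingOK (c₁ c₂ a₁ a₂ a₃ b₁ b₂ b₃ : Prop) : Prop :=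
  ((c₁ ∨ c₂) ∧
      (a₁ → c₁ ∨ a₂ ∧ a₃ ∧ c₂) ∧ (a₂ → a₁ ∧ c₁ ∨ a₃ ∧ c₂) ∧ (a₃ → c₂ ∨ a₂ ∧ a₁ ∧ c₁) ∧
      (b₁ → c₁ ∨ b₂ ∧ b₃ ∧ c₂) ∧ (b₂ → b₁ ∧ c₁ ∨ b₃ ∧ c₂) ∧ (b₃ → c₂ ∨ b₂ ∧ b₁ ∧ c₁) ∨
    ¬ c₁ ∧ ¬ c₂ ∧ (a₁ ∨ a₂ ∨ a₃) ∧ (b₁ ∨ b₂ ∨ b₃) ∧ (a₁ ∧ a₃ → a₂) ∧ (b₁ ∧ b₃ → b₂)) ∧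
  ¬ (c₁ ∧ c₂ ∧ a₁ ∧ a₂ ∧ a₃)

/-- The move from `l` in direction `i` satisfies the local condition. -/
def MoveOK {R : Type} [Ring R] (A : Set (R × R)) (l : R × R) (i : Fin 6) : Prop :=
  RingOK (l + triDir R (i + 1) ∈ A) (l + triDir R (i + 5) ∈ A)
    (l + triDir R (i + 2) ∈ A) (l + triDir R (i + 3) ∈ A) (l + triDir R (i + 4) ∈ A)
    (l + triDir R i + triDir R (i + 1) ∈ A) (l + triDir R i + triDir R i ∈ A)
    (l + triDir R i + triDir R (i + 5) ∈ A)

section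
variable {R : Type} [Ring R]

/-- Numbering the neighbours `n k` of `l` and `m k` of `l'` from direction `i` gives `n 0 = l'`, `m
3 = l` and the common neighbours `n 1 = m 2`, `n 5 = m 4`. Consecutive sites of the ring are
adjacent, so each clause of `RingOK` is a path along an arc to a common neighbour. -/
theorem MoveOK.locallyConnectedMove (hR : NoShortLoops R) {A : Set (R × R)} {l : R × R} {i : Fin 6}
    (h : MoveOK A l i) (hl' : l + triDir R i ∉ A) :
    LocallyConnectedMove (triLattice R) A l (l + triDir R i) := by
  set G := triLattice R with hG
  set l' := l + triDir R i with hl'def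
  set n : Fin 6 → R × R := fun k => l + triDir R (i + k) with hn
  set m : Fin 6 → R × R := fun k => l' + triDir R (i + k) with hm
  have hnm1 : n 1 = m 2 := by
    simp only [hn, hm, hl'def, add_assoc]
    rw [triDir_add_succ]
  have hnm5 : n 5 = m 4 := by
    simp only [hn, hm, hl'def, add_assoc]
    congr 1
    fin_cases i <;> simp [triDir]
  have an : ∀ k, G.Adj (n k) (n (k + 1)) := fun k => by
    simp only [hn, ← add_assoc i k 1]
    exact hR.adj_ring l (i + k)
  have am : ∀ k, G.Adj (m k) (m (k + 1)) := fun k => by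
    simp only [hm, ← add_assoc i k 1]
    exact hR.adj_ring l' (i + k)
  have hN : ∀ u, u ∈ G.neighborSet l ↔ ∃ k, u = n k := fun u => by
    rw [SimpleGraph.mem_neighborSet, hR.adj_iff]
    exact ⟨fun ⟨j, hj⟩ => ⟨j - i, by simp [hn, hj]⟩, fun ⟨k, hk⟩ => ⟨i + k, hk⟩⟩
  have hM : ∀ u, u ∈ G.neighborSet l' ↔ ∃ k, u = m k := fun u => by
    rw [SimpleGraph.mem_neighborSet, hR.adj_iff]
    exact ⟨fun ⟨j, hj⟩ => ⟨j - i, by simp [hm, hj]⟩, fun ⟨k, hk⟩ => ⟨i + k, hk⟩⟩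
  have hn0 : n 0 = l' := by simp [hn, hl'def]
  have hm3 : m 3 = l := by
    simp only [hm, hl'def, add_assoc, triDir_add_opp, add_zero]
  have hnl : ∀ k, n k ≠ l := fun k hk => hR.triDir_ne_zero (i + k) (by simpa [hn] using hk)
  have hml' : ∀ k, m k ≠ l' := fun k hk => hR.triDir_ne_zero (i + k) (by simpa [hm] using hk)
  have hml : ∀ k, k ≠ 3 → m k ≠ l := fun k hk3 hk => by
    have : triDir R i + triDir R (i + k) = 0 := by
      simpa [hm, hl'def, add_assoc] using hk
    exact hk3 (by simpa using hR.eq_opp this)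
  have hcommon : ∀ u, u ∈ G.neighborSet l → u ∈ G.neighborSet l' → u = n 1 ∨ u = n 5 := by
    intro u hu hu'
    obtain ⟨j, rfl⟩ := (hN u).1 hu
    obtain ⟨k, hk⟩ := (hM _).1 hu'
    have : triDir R (i + j) = triDir R i + triDir R (i + k) := by
      simpa [hn, hm, hl'def, add_assoc] using hk
    rcases hR.eq_common this with h | h
    · exact Or.inl (by rw [add_left_cancel h])
    · exact Or.inr (by rw [add_left_cancel h])
  have hc1 : n 1 ∈ G.neighborSet l ∩ G.neighborSet l' :=
    ⟨(hN _).2 ⟨_, rfl⟩, (hM _).2 ⟨2, hnm1⟩⟩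
  have hc5 : n 5 ∈ G.neighborSet l ∩ G.neighborSet l' :=
    ⟨(hN _).2 ⟨_, rfl⟩, (hM _).2 ⟨4, hnm5⟩⟩
  have hm0 : m 0 = l' + triDir R i := by simp [hm]
  unfold MoveOK at h
  change RingOK (n 1 ∈ A) (n 5 ∈ A) (n 2 ∈ A) (n 3 ∈ A) (n 4 ∈ A) (m 1 ∈ A)
    (l' + triDir R i ∈ A) (m 5 ∈ A) at h
  rw [← hm0] at h
  obtain ⟨h | h, -⟩ := h
  · obtain ⟨hc, h1, h2, h3, h4, h5, h6⟩ := h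
    refine Or.inl ⟨?_, ?_⟩
    · rcases hc with hc | hc
      · exact ⟨n 1, hc1, hc⟩
      · exact ⟨n 5, hc5, hc⟩
    set P := ((G.neighborSet l ∪ G.neighborSet l') \ {l, l'}) ∩ A with hP
    have pn : ∀ k, n k ∈ A → n k ∈ P := fun k hk =>
      ⟨⟨Or.inl ((hN _).2 ⟨k, rfl⟩), by
        simpa using ⟨hnl k, fun h => hl' (h ▸ hk)⟩⟩, hk⟩
    have pm : ∀ k, k ≠ 3 → m k ∈ A → m k ∈ P := fun k hk3 hk =>
      ⟨⟨Or.inr ((hM _).2 ⟨k, rfl⟩), by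
        simpa using ⟨hml k hk3, hml' k⟩⟩, hk⟩
    have en : ∀ k, n k ∈ A → n (k + 1) ∈ A → ConnectedThrough G P (n k) (n (k + 1)) :=
      fun k h h' => .of_adj (pn _ h) (pn _ h') (an k)
    have em : ∀ k, k ≠ 3 → k + 1 ≠ 3 → m k ∈ A → m (k + 1) ∈ A →
        ConnectedThrough G P (m k) (m (k + 1)) :=
      fun k h3 h3' h h' => .of_adj (pm _ h3 h) (pm _ h3' h') (am k)
    have g1 : n 1 ∈ A → ∃ w ∈ G.neighborSet l ∩ G.neighborSet l' ∩ A,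
        ConnectedThrough G P (n 1) w := fun h => ⟨n 1, ⟨hc1, h⟩, .refl (pn _ h)⟩
    have g5 : n 5 ∈ A → ∃ w ∈ G.neighborSet l ∩ G.neighborSet l' ∩ A,
        ConnectedThrough G P (n 5) w := fun h => ⟨n 5, ⟨hc5, h⟩, .refl (pn _ h)⟩
    have ext : ∀ u v, ConnectedThrough G P u v →
        (∃ w ∈ G.neighborSet l ∩ G.neighborSet l' ∩ A, ConnectedThrough G P v w) →
        ∃ w ∈ G.neighborSet l ∩ G.neighborSet l' ∩ A, ConnectedThrough G P u w :=
      fun u v huv ⟨w, hw, h⟩ => ⟨w, hw, huv.trans h⟩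
    have e12 := en 1
    have e23 := en 2
    have e34 := en 3
    have e45 := en 4
    have f01 := em 0 (by decide) (by decide)
    have f12 := em 1 (by decide) (by decide)
    have f45 := em 4 (by decide) (by decide)
    have f50 := em 5 (by decide) (by decide)
    simp only [show (1 : Fin 6) + 1 = 2 from rfl, show (2 : Fin 6) + 1 = 3 from rfl,
      show (3 : Fin 6) + 1 = 4 from rfl, show (4 : Fin 6) + 1 = 5 from rfl,
      show (5 : Fin 6) + 1 = 0 from rfl, show (0 : Fin 6) + 1 = 1 from rfl] at *
    rw [← hnm1] at f12
    rw [← hnm5] at f45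
    rintro u ⟨⟨hu, hul⟩, huA⟩
    simp only [Set.mem_insert_iff, Set.mem_singleton_iff, not_or] at hul
    rcases hu with hu | hu
    · obtain ⟨k, rfl⟩ := (hN u).1 hu
      obtain rfl | rfl | rfl | rfl | rfl | rfl :
        k = 0 ∨ k = 1 ∨ k = 2 ∨ k = 3 ∨ k = 4 ∨ k = 5 := by fin_cases k <;> simp
      · exact (hul.2 hn0).elim
      · exact g1 huA
      · rcases h1 huA with h | ⟨h, h', h''⟩
        · exact ext _ _ (e12 h huA).symm (g1 h)
        · exact ext _ _ ((e23 huA h).trans ((e34 h h').trans (e45 h' h''))) (g5 h'')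
      · rcases h2 huA with ⟨h, h'⟩ | ⟨h, h'⟩
        · exact ext _ _ ((e23 h huA).symm.trans (e12 h' h).symm) (g1 h')
        · exact ext _ _ ((e34 huA h).trans (e45 h h')) (g5 h')
      · rcases h3 huA with h | ⟨h, h', h''⟩
        · exact ext _ _ (e45 huA h) (g5 h)
        · exact ext _ _ ((e34 h huA).symm.trans ((e23 h' h).symm.trans (e12 h'' h').symm)) (g1 h'')
      · exact g5 huA
    · obtain ⟨k, rfl⟩ := (hM u).1 hu
      obtain rfl | rfl | rfl | rfl | rfl | rfl :
        k = 0 ∨ k = 1 ∨ k = 2 ∨ k = 3 ∨ k = 4 ∨ k = 5 := by fin_cases k <;> simp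
      · rcases h5 huA with ⟨h, h'⟩ | ⟨h, h'⟩
        · exact ext _ _ ((f01 huA h).trans (f12 h h')) (g1 h')
        · exact ext _ _ ((f50 h huA).symm.trans (f45 h' h).symm) (g5 h')
      · rcases h4 huA with h | ⟨h, h', h''⟩
        · exact ext _ _ (f12 huA h) (g1 h)
        · exact ext _ _ ((f01 h huA).symm.trans ((f50 h' h).symm.trans (f45 h'' h').symm)) (g5 h'')
      · rw [← hnm1] at huA ⊢
        exact g1 huA
      · exact (hul.1 hm3).elim
      · rw [← hnm5] at huA ⊢
        exact g5 huA
      · rcases h6 huA with h | ⟨h, h', h''⟩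
        · exact ext _ _ (f45 h huA).symm (g5 h)
        · exact ext _ _ ((f50 huA h).trans ((f01 h h').trans (f12 h' h''))) (g1 h'')
  · obtain ⟨h1, h5, ha, hb, ha', hb'⟩ := h
    have hnA : ∀ u, u ∈ (G.neighborSet l \ {l'}) ∩ A → (u = n 2 ∨ u = n 3 ∨ u = n 4) := by
      rintro u ⟨⟨hu, hul⟩, huA⟩
      obtain ⟨k, rfl⟩ := (hN u).1 hu
      obtain rfl | rfl | rfl | rfl | rfl | rfl :
        k = 0 ∨ k = 1 ∨ k = 2 ∨ k = 3 ∨ k = 4 ∨ k = 5 := by fin_cases k <;> simp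
      · exact (hul hn0).elim
      · exact (h1 huA).elim
      · simp
      · simp
      · simp
      · exact (h5 huA).elim
    have hmA : ∀ u, u ∈ (G.neighborSet l' \ {l}) ∩ A → (u = m 5 ∨ u = m 0 ∨ u = m 1) := by
      rintro u ⟨⟨hu, hul⟩, huA⟩
      obtain ⟨k, rfl⟩ := (hM u).1 hu
      obtain rfl | rfl | rfl | rfl | rfl | rfl :
        k = 0 ∨ k = 1 ∨ k = 2 ∨ k = 3 ∨ k = 4 ∨ k = 5 := by fin_cases k <;> simp
      · simp
      · simp
      · exact (h1 (hnm1 ▸ huA)).elim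
      · exact (hul hm3).elim
      · exact (h5 (hnm5 ▸ huA)).elim
      · simp
    -- Three sites in a row, some of them occupied, form a connected set unless the two ends are
    -- present without the middle.
    have arc : ∀ (B : Set (R × R)) (x y z : R × R), (∀ u ∈ B, u = x ∨ u = y ∨ u = z) →
        G.Adj x y → G.Adj y z → (x ∈ B ∧ z ∈ B → y ∈ B) →
        ∀ u ∈ B, ∀ w ∈ B, ConnectedThrough G B u w := by
      intro B x y z hB hxy hyz hy
      have exy : x ∈ B → y ∈ B → ConnectedThrough G B x y := fun h h' => .of_adj h h' hxy
      have eyz : y ∈ B → z ∈ B → ConnectedThrough G B y z := fun h h' => .of_adj h h' hyz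
      have exz : x ∈ B → z ∈ B → ConnectedThrough G B x z := fun h h' =>
        (exy h (hy ⟨h, h'⟩)).trans (eyz (hy ⟨h, h'⟩) h')
      intro u hu w hw
      rcases hB u hu with rfl | rfl | rfl <;> rcases hB w hw with rfl | rfl | rfl
      · exact .refl hu
      · exact exy hu hw
      · exact exz hu hw
      · exact (exy hw hu).symm
      · exact .refl hu
      · exact eyz hu hw
      · exact (exz hw hu).symm
      · exact (eyz hw hu).symm
      · exact .refl hu
    have pn : ∀ k, n k ∈ A ↔ n k ∈ (G.neighborSet l \ {l'}) ∩ A := fun k =>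
      ⟨fun hk => ⟨⟨(hN _).2 ⟨k, rfl⟩, fun h => hl' (h ▸ hk)⟩, hk⟩, fun h => h.2⟩
    have pm : ∀ k, k ≠ 3 → (m k ∈ A ↔ m k ∈ (G.neighborSet l' \ {l}) ∩ A) := fun k hk3 =>
      ⟨fun hk => ⟨⟨(hM _).2 ⟨k, rfl⟩, hml k hk3⟩, hk⟩, fun h => h.2⟩
    refine Or.inr ⟨?_, ?_, ?_, ?_, ?_⟩
    · ext u
      simp only [Set.mem_inter_iff, Set.mem_empty_iff_false, iff_false]
      rintro ⟨⟨hu, hu'⟩, huA⟩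
      rcases hcommon u hu hu' with rfl | rfl
      · exact h1 huA
      · exact h5 huA
    · rcases ha with h | h | h
      exacts [⟨_, (pn _).1 h⟩, ⟨_, (pn _).1 h⟩, ⟨_, (pn _).1 h⟩]
    · rcases hb with h | h | h
      exacts [⟨_, (pm _ (by decide)).1 h⟩, ⟨_, (pm _ (by decide)).1 h⟩,
        ⟨_, (pm _ (by decide)).1 h⟩]
    · refine arc _ _ _ _ hnA (an 2) (an 3) ?_
      rwa [← pn, ← pn, ← pn]
    · refine arc _ _ _ _ hmA (am 5) (am 0) ?_
      rw [← pm _ (by decide), ← pm _ (by decide), ← pm _ (by decide)]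
      exact fun h => hb' ⟨h.2, h.1⟩

/-- A move that satisfies the local condition has a moving particle of degree less than five. -/
theorem MoveOK.ncard_lt (hR : NoShortLoops R) {A : Set (R × R)} {l : R × R}
    {i : Fin 6} (h : MoveOK A l i) (hl' : l + triDir R i ∉ A) :
    ((triLattice R).neighborSet l ∩ A).ncard < 5 := by
  obtain ⟨-, h⟩ := h
  have hsub : (triLattice R).neighborSet l ∩ A ⊆
      (fun k : Fin 6 => l + triDir R (i + k)) ''
        {k | k ≠ 0 ∧ l + triDir R (i + k) ∈ A} := by
    rintro u ⟨hu, huA⟩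
    obtain ⟨j, rfl⟩ := hR.adj_iff.1 hu
    refine ⟨j - i, ⟨fun h0 => hl' ?_, ?_⟩, ?_⟩
    · rw [← sub_eq_zero.1 h0]
      exact huA
    · simpa using huA
    · simp
  refine (Set.ncard_le_ncard hsub (Set.toFinite _)).trans_lt
    ((Set.ncard_image_le (Set.toFinite _)).trans_lt ?_)
  -- The target is one empty neighbour of `l`; a second one is needed.
  obtain ⟨k, hk0, hk⟩ : ∃ k : Fin 6, k ≠ 0 ∧ l + triDir R (i + k) ∉ A := by
    by_contra! hcon
    exact h ⟨hcon 1 (by decide), hcon 5 (by decide), hcon 2 (by decide), hcon 3 (by decide),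
      hcon 4 (by decide)⟩
  have : {k : Fin 6 | k ≠ 0 ∧ l + triDir R (i + k) ∈ A} ⊆
      (((Finset.univ.erase 0).erase k : Finset (Fin 6)) : Set (Fin 6)) := by
    rintro j ⟨hj0, hj⟩
    simp only [Finset.coe_erase, Finset.coe_univ, Set.mem_sdiff, Set.mem_univ, true_and,
      Set.mem_singleton_iff]
    exact ⟨hj0, fun h => hk (h ▸ hj)⟩
  refine (Set.ncard_le_ncard this (Set.toFinite _)).trans_lt ?_
  rw [Set.ncard_coe_finset, Finset.card_erase_of_mem (by simpa using hk0),
    Finset.card_erase_of_mem (by simp)]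
  simp

end

/-! ### Moves in the infinite lattice -/

/-- A valid move in the infinite lattice, the food particle sitting at the origin. -/
def PlaneStep (S S' : Finset (ℤ × ℤ)) : Prop :=
  ∃ l i, l ∈ S ∧ l ≠ 0 ∧ l + triDir ℤ i ∉ S ∧ MoveOK (S : Set (ℤ × ℤ)) l i ∧
    S' = insert (l + triDir ℤ i) (S.erase l)

/-- Reachability by valid moves in the infinite lattice. -/
abbrev PlaneReach : Finset (ℤ × ℤ) → Finset (ℤ × ℤ) → Prop := Relation.ReflTransGen PlaneStep

/-- A connected configuration of `N` particles in the infinite lattice, one of which is the food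
particle at the origin. -/
structure PlaneConf (N : ℕ) (S : Finset (ℤ × ℤ)) : Prop where
  zero_mem : 0 ∈ S
  card_eq : S.card = N
  connected : ((triLattice ℤ).induce (S : Set (ℤ × ℤ))).Connected

theorem PlaneConf.step {N : ℕ} {S S' : Finset (ℤ × ℤ)} (hS : PlaneConf N S) (h : PlaneStep S S') :
    PlaneConf N S' := by
  obtain ⟨l, i, hl, hl0, hl', hok, rfl⟩ := h
  refine ⟨?_, ?_, ?_⟩
  · exact Finset.mem_insert_of_mem (Finset.mem_erase.2 ⟨hl0.symm, hS.zero_mem⟩)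
  · rw [Finset.card_insert_of_notMem (fun h => hl' (Finset.mem_of_mem_erase h)),
      Finset.card_erase_add_one hl, hS.card_eq]
  · have := (hok.locallyConnectedMove noShortLoops_int hl').connected hl hl' hS.connected
    rwa [Finset.coe_insert, Finset.coe_erase]

theorem PlaneConf.reach {N : ℕ} {S S' : Finset (ℤ × ℤ)} (hS : PlaneConf N S)
    (h : PlaneReach S S') : PlaneConf N S' := by
  induction h with
  | refl => exact hS
  | tail _ h ih => exact ih.step h

theorem PlaneConf.exists_nbr {N : ℕ} {S : Finset (ℤ × ℤ)} (hS : PlaneConf N S) (hN : 2 ≤ N)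
    {c : ℤ × ℤ} (hc : c ∈ S) : ∃ i, c + triDir ℤ i ∈ S := by
  obtain ⟨d, hd, hdc⟩ : ∃ d ∈ S, d ≠ c :=
    Finset.exists_mem_ne (by rw [hS.card_eq]; omega) c
  obtain ⟨w, hw, hcw, -⟩ := exists_connectedThrough_adj
    ((induce_connected_iff.1 hS.connected).2 d hd c hc) hdc
  obtain ⟨i, rfl⟩ := hcw.2
  exact ⟨i, hw⟩

theorem PlaneConf.nbr_cases {N : ℕ} {S : Finset (ℤ × ℤ)} (hS : PlaneConf N S) (hN : 2 ≤ N)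
    {x y : ℤ} (hc : (x, y) ∈ S) : (x + 1, y) ∈ S ∨ (x + 1, y + 1) ∈ S ∨ (x, y + 1) ∈ S ∨
      (x - 1, y) ∈ S ∨ (x - 1, y - 1) ∈ S ∨ (x, y - 1) ∈ S := by
  obtain ⟨i, hi⟩ := hS.exists_nbr hN hc
  fin_cases i <;> simp [triDir, ← sub_eq_add_neg] at hi <;> tauto

section
variable {S : Finset (ℤ × ℤ)} {x y : ℤ}

/-- The four moves needed for straightening, with the ring in explicit coordinates. The remaining
directions come from lattice symmetries. -/
theorem planeStep_ru (h : (x, y) ∈ S) (h0 : (x, y) ≠ 0) (h' : (x + 1, y + 1) ∉ S)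
    (hok : RingOK ((x, y + 1) ∈ S) ((x + 1, y) ∈ S) ((x - 1, y) ∈ S) ((x - 1, y - 1) ∈ S)
      ((x, y - 1) ∈ S) ((x + 1, y + 2) ∈ S) ((x + 2, y + 2) ∈ S) ((x + 2, y + 1) ∈ S)) :
    PlaneStep S (insert (x + 1, y + 1) (S.erase (x, y))) := by
  refine ⟨(x, y), 1, h, h0, by simpa [triDir] using h', ?_, by simp [triDir]⟩
  unfold MoveOK
  simpa [triDir, ← sub_eq_add_neg, add_assoc, one_add_one_eq_two,
    show (1 : Fin 6) + 1 = 2 from rfl, show (1 : Fin 6) + 2 = 3 from rfl,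
    show (1 : Fin 6) + 3 = 4 from rfl, show (1 : Fin 6) + 4 = 5 from rfl,
    show (1 : Fin 6) + 5 = 0 from rfl] using hok

theorem planeStep_up (h : (x, y) ∈ S) (h0 : (x, y) ≠ 0) (h' : (x, y + 1) ∉ S)
    (hok : RingOK ((x - 1, y) ∈ S) ((x + 1, y + 1) ∈ S) ((x - 1, y - 1) ∈ S) ((x, y - 1) ∈ S)
      ((x + 1, y) ∈ S) ((x - 1, y + 1) ∈ S) ((x, y + 2) ∈ S) ((x + 1, y + 2) ∈ S)) :
    PlaneStep S (insert (x, y + 1) (S.erase (x, y))) := by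
  refine ⟨(x, y), 2, h, h0, by simpa [triDir] using h', ?_, by simp [triDir]⟩
  unfold MoveOK
  simpa [triDir, ← sub_eq_add_neg, add_assoc, one_add_one_eq_two,
    show (2 : Fin 6) + 1 = 3 from rfl, show (2 : Fin 6) + 2 = 4 from rfl,
    show (2 : Fin 6) + 3 = 5 from rfl, show (2 : Fin 6) + 4 = 0 from rfl,
    show (2 : Fin 6) + 5 = 1 from rfl] using hok

theorem planeStep_left (h : (x, y) ∈ S) (h0 : (x, y) ≠ 0) (h' : (x - 1, y) ∉ S)
    (hok : RingOK ((x - 1, y - 1) ∈ S) ((x, y + 1) ∈ S) ((x, y - 1) ∈ S) ((x + 1, y) ∈ S)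
      ((x + 1, y + 1) ∈ S) ((x - 2, y - 1) ∈ S) ((x - 2, y) ∈ S) ((x - 1, y + 1) ∈ S)) :
    PlaneStep S (insert (x - 1, y) (S.erase (x, y))) := by
  refine ⟨(x, y), 3, h, h0, by simpa [triDir, ← sub_eq_add_neg] using h', ?_,
    by simp [triDir, ← sub_eq_add_neg]⟩
  unfold MoveOK
  have e : x + -1 + -1 = x - 2 := by ring
  simpa [triDir, ← sub_eq_add_neg, sub_sub, one_add_one_eq_two,
    show (3 : Fin 6) + 1 = 4 from rfl, show (3 : Fin 6) + 2 = 5 from rfl,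
    show (3 : Fin 6) + 3 = 0 from rfl, show (3 : Fin 6) + 4 = 1 from rfl,
    show (3 : Fin 6) + 5 = 2 from rfl] using hok

theorem planeStep_ld (h : (x, y) ∈ S) (h0 : (x, y) ≠ 0) (h' : (x - 1, y - 1) ∉ S)
    (hok : RingOK ((x, y - 1) ∈ S) ((x - 1, y) ∈ S) ((x + 1, y) ∈ S) ((x + 1, y + 1) ∈ S)
      ((x, y + 1) ∈ S) ((x - 1, y - 2) ∈ S) ((x - 2, y - 2) ∈ S) ((x - 2, y - 1) ∈ S)) :
    PlaneStep S (insert (x - 1, y - 1) (S.erase (x, y))) := by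
  refine ⟨(x, y), 4, h, h0, by simpa [triDir, ← sub_eq_add_neg] using h', ?_,
    by simp [triDir, ← sub_eq_add_neg]⟩
  unfold MoveOK
  simpa [triDir, ← sub_eq_add_neg, sub_sub, one_add_one_eq_two,
    show (4 : Fin 6) + 1 = 5 from rfl, show (4 : Fin 6) + 2 = 0 from rfl,
    show (4 : Fin 6) + 3 = 1 from rfl, show (4 : Fin 6) + 4 = 2 from rfl,
    show (4 : Fin 6) + 5 = 3 from rfl] using hok

theorem mem_move {a b c d : ℤ} : (c, d) ∈ insert (a, b) (S.erase (x, y)) ↔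
    (c = a ∧ d = b) ∨ (c, d) ∈ S ∧ ¬ (c = x ∧ d = y) := by
  simp only [Finset.mem_insert, Finset.mem_erase, Prod.mk.injEq, ne_eq]
  tauto

theorem mem_of_eq {a b c d : ℤ} (h : (a, b) ∈ S) (h1 : c = a) (h2 : d = b) : (c, d) ∈ S := by
  rwa [h1, h2]

end

/-! ### Chains of corners -/

/-- Normal forms for small translations of a coordinate. -/
theorem coord_simps : (∀ z : ℤ, z + 1 + 1 = z + 2) ∧ (∀ z : ℤ, z + 1 + 2 = z + 3) ∧
    (∀ z : ℤ, z + 2 + 1 = z + 3) ∧ (∀ z : ℤ, z + 2 + 2 = z + 4) ∧ (∀ z : ℤ, z + 1 - 1 = z) ∧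
    (∀ z : ℤ, z + 2 - 1 = z + 1) ∧ (∀ z : ℤ, z + 1 - 2 = z - 1) ∧ (∀ z : ℤ, z + 2 - 2 = z) ∧
    (∀ z : ℤ, z - 1 + 1 = z) ∧ (∀ z : ℤ, z - 1 + 2 = z + 1) ∧ (∀ z : ℤ, z - 1 - 1 = z - 2) ∧
    (∀ z : ℤ, z - 1 - 2 = z - 3) ∧ (∀ z : ℤ, z - 2 + 1 = z - 1) := by
  refine ⟨?_, ?_, ?_, ?_, ?_, ?_, ?_, ?_, ?_, ?_, ?_, ?_, ?_⟩ <;> intro z <;> ring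

/-- `T` arises from `S` by shifting particles on the diagonal through `(x, y)`, beyond `(x, y)`,
one step up the diagonal, each from a corner between an upper and a right neighbour; particles
may also disappear from the diagonal. -/
structure DiagShift (S T : Finset (ℤ × ℤ)) (x y : ℤ) : Prop where
  -- The occupation facts record the corner in `S` below the new site; if that site is in the last
  -- column, they say that `S` is `Jammed`.
  added : ∀ u v, (u, v) ∈ T → (u, v) ∉ S → u - v = x - y ∧ x < u ∧ (u - 1, v - 1) ∈ S ∧
    (u, v - 1) ∈ S ∧ (u - 1, v - 2) ∉ S
  removed : ∀ u v, (u, v) ∈ S → (u, v) ∉ T → u - v = x - y ∧ x ≤ u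

theorem DiagShift.refl (S : Finset (ℤ × ℤ)) (x y : ℤ) : DiagShift S S x y :=
  ⟨fun _ _ h h' => (h' h).elim, fun _ _ h h' => (h' h).elim⟩

theorem DiagShift.off {S T : Finset (ℤ × ℤ)} {x y : ℤ} (h : DiagShift S T x y) {u v : ℤ}
    (huv : u - v ≠ x - y) : (u, v) ∈ T ↔ (u, v) ∈ S :=
  ⟨fun h' => by_contra fun h'' => huv (h.added u v h' h'').1,
    fun h' => by_contra fun h'' => huv (h.removed u v h' h'').1⟩

theorem DiagShift.lt {S T : Finset (ℤ × ℤ)} {x y : ℤ} (h : DiagShift S T x y) {u v : ℤ}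
    (hu : u < x) : (u, v) ∈ T ↔ (u, v) ∈ S :=
  ⟨fun h' => by_contra fun h'' => by have := (h.added u v h' h'').2.1; omega,
    fun h' => by_contra fun h'' => by have := (h.removed u v h' h'').2; omega⟩

theorem DiagShift.mem_of_le {S T : Finset (ℤ × ℤ)} {x y : ℤ} (h : DiagShift S T x y) {u v : ℤ}
    (hu : u ≤ x) (h' : (u, v) ∈ T) : (u, v) ∈ S :=
  by_contra fun h'' => by have := (h.added u v h' h'').2.1; omega

section
variable {N : ℕ} {S T : Finset (ℤ × ℤ)} {x y : ℤ}

/-- A corner moves one step up the diagonal. -/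
theorem DiagShift.flip (hT : DiagShift S T (x + 2) (y + 2)) (h : (x, y) ∈ S) (h0 : (x, y) ≠ 0)
    (hur : (x, y + 1) ∈ S ∨ (x + 1, y + 2) ∉ S) (hr : (x + 1, y) ∈ S) (hl : (x - 1, y) ∉ S)
    (hld : (x - 1, y - 1) ∉ S)
    (hd : (x, y - 1) ∉ S) (hru : (x + 1, y + 1) ∉ S)
    (hy : (x + 2, y + 2) ∉ T ∨ (x + 1, y + 2) ∈ S ∨ (x + 2, y + 1) ∈ S) :
    PlaneStep T (insert (x + 1, y + 1) (T.erase (x, y))) ∧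
      DiagShift S (insert (x + 1, y + 1) (T.erase (x, y))) x y := by
  have hoff : ∀ {u v : ℤ}, u - v ≠ x - y → ((u, v) ∈ T ↔ (u, v) ∈ S) := fun h =>
    hT.off (by omega)
  have hlt : ∀ {u v : ℤ}, u < x + 2 → ((u, v) ∈ T ↔ (u, v) ∈ S) := fun h => hT.lt h
  refine ⟨planeStep_ru ((hlt (by omega)).2 h) h0 (mt (hlt (by omega)).1 hru) ?_, ⟨?_, ?_⟩⟩
  · rw [hlt (by omega), hlt (by omega), hlt (by omega), hlt (by omega), hlt (by omega),
      hlt (by omega), hoff (u := x + 2) (v := y + 1) (by omega)]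
    simp only [RingOK, hr, hl, hld, hd, or_true, true_and, and_true, false_and, and_false,
      false_imp_iff, not_true_eq_false, not_false_eq_true, or_false, true_or, imp_true_iff]
    clear * - hur hy
    tauto
  · intro u v h1 h2
    rcases mem_move.1 h1 with ⟨rfl, rfl⟩ | ⟨h1, -⟩
    · simp only [coord_simps]
      exact ⟨by omega, by omega, h, hr, hd⟩
    · obtain ⟨h3, h4, h5⟩ := hT.added u v h1 h2
      exact ⟨by omega, by omega, h5⟩
  · intro u v h1 h2
    by_cases h3 : (u, v) ∈ T
    · have : u = x ∧ v = y := by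
        by_contra h4
        exact h2 (mem_move.2 (Or.inr ⟨h3, h4⟩))
      omega
    · have := hT.removed u v h1 h3
      omega

/-- A particle that has contact upwards only hops across an empty site towards a corner. -/
theorem DiagShift.hop (hT : DiagShift S T (x + 2) (y + 2)) (h : (x, y) ∈ S)
    (h0 : (x + 2, y + 2) ≠ (0 : ℤ × ℤ)) (hr : (x + 1, y) ∈ S)
    (hd : (x, y - 1) ∉ S) (hru : (x + 1, y + 1) ∉ S)
    (hy : (x + 2, y + 2) ∈ T) (hx : (x + 1, y + 2) ∉ S) (hz : (x + 2, y + 1) ∉ S)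
    (hc : (x + 2, y + 3) ∈ T ∨ (x + 3, y + 3) ∈ T ∨ (x + 3, y + 2) ∈ T)
    (hc' : (x + 2, y + 3) ∈ T ∧ (x + 3, y + 2) ∈ T → (x + 3, y + 3) ∈ T) :
    PlaneStep T (insert (x + 1, y + 1) (T.erase (x + 2, y + 2))) ∧
      DiagShift S (insert (x + 1, y + 1) (T.erase (x + 2, y + 2))) x y := by
  have hoff : ∀ {u v : ℤ}, u - v ≠ x - y → ((u, v) ∈ T ↔ (u, v) ∈ S) := fun h =>
    hT.off (by omega)
  have hlt : ∀ {u v : ℤ}, u < x + 2 → ((u, v) ∈ T ↔ (u, v) ∈ S) := fun h => hT.lt h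
  refine ⟨?_, ⟨?_, ?_⟩⟩
  · have := planeStep_ld (S := T) (x := x + 2) (y := y + 2) hy h0
    simp only [coord_simps] at this
    refine this (mt (hlt (by omega)).1 hru) ?_
    rw [hoff (u := x + 2) (v := y + 1) (by omega), hlt (u := x + 1) (v := y + 2) (by omega),
      hlt (u := x + 1) (v := y) (by omega), hlt (u := x) (v := y) (by omega),
      hlt (u := x) (v := y + 1) (by omega)]
    simp only [RingOK, hr, hx, hz, h, true_and, and_true, false_and, and_false,
      true_imp_iff, not_false_eq_true, true_or, imp_true_iff, or_self, false_or]
    clear * - hc hc'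
    tauto
  · intro u v h1 h2
    rcases mem_move.1 h1 with ⟨rfl, rfl⟩ | ⟨h1, -⟩
    · simp only [coord_simps]
      exact ⟨by omega, by omega, h, hr, hd⟩
    · obtain ⟨h3, h4, h5⟩ := hT.added u v h1 h2
      exact ⟨by omega, by omega, h5⟩
  · intro u v h1 h2
    by_cases h3 : (u, v) ∈ T
    · have : u = x + 2 ∧ v = y + 2 := by
        by_contra h4
        exact h2 (mem_move.2 (Or.inr ⟨h3, h4⟩))
      omega
    · have := hT.removed u v h1 h3
      omega

/-- The chain of corners above `(x, y)` can be straightened so that either the particle at `(x, y)`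
moves up the diagonal or the site above it on the diagonal becomes occupied. The only obstacle
is the food particle sitting in a corner on the same diagonal. -/
theorem PlaneConf.exists_diagShift (hS : PlaneConf N S) (hN : 2 ≤ N) (m : ℕ) :
    ∀ x y : ℤ, (∀ u v, (u, v) ∈ S → u < x + m) → (x, y) ∈ S → (x, y) ≠ 0 →
      ((x, y + 1) ∈ S ∨ (x + 1, y + 2) ∉ S) → (x + 1, y) ∈ S → (x - 1, y) ∉ S →
      (x - 1, y - 1) ∉ S → (x, y - 1) ∉ S →
      (x + 1, y + 1) ∉ S → ¬ (x = y ∧ (-1, 0) ∉ S ∧ (-1, -1) ∉ S ∧ (0, -1) ∉ S) →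
      ∃ T, PlaneReach S T ∧ DiagShift S T x y ∧
        ((x, y) ∉ T ∨ (x, y) ∈ T ∧ (x + 1, y + 1) ∈ T) := by
  induction m using Nat.strong_induction_on with
  | _ m ih =>
  intro x y hm h h0 hu hr hl hld hd hru hf
  -- The corner can step up unless the site two steps up the diagonal is occupied while both sites
  -- joining it to the rest of the ring are empty.
  have key : ∀ T, PlaneReach S T → DiagShift S T (x + 2) (y + 2) →
      ((x + 2, y + 2) ∉ T ∨ (x + 1, y + 2) ∈ S ∨ (x + 2, y + 1) ∈ S) →
      ∃ T, PlaneReach S T ∧ DiagShift S T x y ∧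
        ((x, y) ∉ T ∨ (x, y) ∈ T ∧ (x + 1, y + 1) ∈ T) := by
    intro T hST hT hy
    obtain ⟨h1, h2⟩ := hT.flip h h0 hu hr hl hld hd hru hy
    exact ⟨_, hST.tail h1, h2, Or.inl fun h3 => by
      rcases mem_move.1 h3 with h3 | h3 <;> omega⟩
  -- Otherwise the blocking particle may hop down to the site above the corner, provided its own
  -- neighbours form one arc.
  have key' : ∀ T, PlaneReach S T → DiagShift S T (x + 2) (y + 2) → (x + 2, y + 2) ∈ T →
      (x + 2, y + 2) ≠ (0 : ℤ × ℤ) → (x + 1, y + 2) ∉ S → (x + 2, y + 1) ∉ S →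
      ((x + 2, y + 3) ∈ T ∨ (x + 3, y + 3) ∈ T ∨ (x + 3, y + 2) ∈ T) →
      ((x + 2, y + 3) ∈ T ∧ (x + 3, y + 2) ∈ T → (x + 3, y + 3) ∈ T) →
      ∃ T, PlaneReach S T ∧ DiagShift S T x y ∧
        ((x, y) ∉ T ∨ (x, y) ∈ T ∧ (x + 1, y + 1) ∈ T) := by
    intro T hST hT hy hy0 hx hz hc hc'
    obtain ⟨h1, h2⟩ := hT.hop h hy0 hr hd hru hy hx hz hc hc'
    refine ⟨_, hST.tail h1, h2, Or.inr ⟨mem_move.2 (Or.inr ⟨(hT.lt (by omega)).2 h, by omega⟩),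
      mem_move.2 (Or.inl ⟨rfl, rfl⟩)⟩⟩
  by_cases hy : (x + 2, y + 2) ∉ S ∨ (x + 1, y + 2) ∈ S ∨ (x + 2, y + 1) ∈ S
  · exact key S .refl (.refl S _ _) hy
  push Not at hy
  obtain ⟨hy, hx, hz⟩ := hy
  -- If the blocking particle were the food, its three lower neighbours would be empty, which is the
  -- excluded case.
  have hy0 : (x + 2, y + 2) ≠ (0 : ℤ × ℤ) := by
    intro h3
    simp only [Prod.mk_eq_zero] at h3
    obtain ⟨rfl, rfl⟩ : x = -2 ∧ y = -2 := by omega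
    norm_num at *
    tauto
  have hnb := hS.nbr_cases hN hy
  simp only [coord_simps] at hnb
  -- The hop fails only if the blocking particle is again a corner. The chain is then dissolved from
  -- two steps further up; `m` bounds the distance to the right end of the configuration.
  by_cases hc : (x + 2, y + 3) ∈ S ∧ (x + 3, y + 2) ∈ S ∧ (x + 3, y + 3) ∉ S
  · obtain ⟨hc1, hc2, hc3⟩ := hc
    have hm2 := hm _ _ hc2
    obtain ⟨T, hST, hT, hT'⟩ := ih (m - 2) (by omega) (x + 2) (y + 2)
      (fun u v huv => by have := hm u v huv; omega) hy hy0
      (Or.inl (by simpa only [coord_simps] using hc1)) (by simpa only [coord_simps] using hc2)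
      (by simpa only [coord_simps] using hx) (by simpa only [coord_simps] using hru)
      (by simpa only [coord_simps] using hz) (by simpa only [coord_simps] using hc3)
      (fun h4 => hf ⟨by omega, h4.2⟩)
    simp only [coord_simps] at hT'
    rcases hT' with hT' | ⟨hT1, hT2⟩
    · exact key T hST hT (Or.inl hT')
    · exact key' T hST hT hT1 hy0 hx hz (Or.inr (Or.inl hT2)) (fun _ => hT2)
  · exact key' S .refl (.refl S _ _) hy hy0 hx hz (by tauto) (by tauto)

end

/-! ### Removing the extreme particle of the leftmost column -/

/-- All particles have abscissa between `X` and `X'`. -/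
def InStrip (X X' : ℤ) (S : Finset (ℤ × ℤ)) : Prop := ∀ u v, (u, v) ∈ S → X ≤ u ∧ u ≤ X'

/-- The column with abscissa `x` of `T` is contained in that of `S`. -/
def ColumnLE (x : ℤ) (T S : Finset (ℤ × ℤ)) : Prop := ∀ y, (x, y) ∈ T → (x, y) ∈ S

/-- On the diagonal of height `s`, the last column `X'` is empty, and below it there is a corner
with a particle in the last column. -/
def Jammed (X' s : ℤ) (S : Finset (ℤ × ℤ)) : Prop :=
  (X' - 1, s + X' - 1) ∈ S ∧ (X', s + X' - 1) ∈ S ∧ (X', s + X') ∉ S ∧ (X' - 1, s + X' - 2) ∉ S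

/-- The last column does not grow from `S` to `T`, unless some intermediate configuration
is jammed on a diagonal whose height satisfies `P`. -/
def Tame (P : ℤ → Prop) (X X' : ℤ) (S T : Finset (ℤ × ℤ)) : Prop :=
  (X < X' → ColumnLE X' T S) ∨
    ∃ U s, PlaneReach S U ∧ InStrip X X' U ∧ ColumnLE X' U S ∧ P s ∧ Jammed X' s U

/-- `T` is reachable from `S`, stays in the strip, and has lost the particle at `(X, a)`; the
first column has gained at most particles above height `b`. -/
structure Raised (P : ℤ → Prop) (X X' a b : ℤ) (S T : Finset (ℤ × ℤ)) : Prop where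
  reach : PlaneReach S T
  strip : InStrip X X' T
  notMem : (X, a) ∉ T
  column : ∀ y, (X, y) ∈ T → (X, y) ∈ S ∨ b < y
  tame : Tame P X X' S T

section
variable {N : ℕ} {S T U : Finset (ℤ × ℤ)} {X X' a b x y : ℤ} {P Q : ℤ → Prop}

theorem Tame.trans (h : Tame P X X' S T) (h' : Tame P X X' T U) (hST : PlaneReach S T) :
    Tame P X X' S U := by
  rcases h with h | h
  · rcases h' with h' | ⟨V, s, h1, h2, h3, h4, h5⟩
    · exact Or.inl fun hX y hy => h hX y (h' hX y hy)
    · refine Or.inr ⟨V, s, hST.trans h1, h2, fun y hy => h ?_ y (h3 y hy), h4, h5⟩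
      -- A jam contains a particle in column `X' - 1`, so `X < X'` follows from the strip.
      have := (h2 _ _ h5.1).1
      omega
  · exact Or.inr h

theorem Tame.mono (hPQ : ∀ s, P s → Q s) (h : Tame P X X' S T) : Tame Q X X' S T := by
  rcases h with h | ⟨V, s, h1, h2, h3, h4, h5⟩
  · exact Or.inl h
  · exact Or.inr ⟨V, s, h1, h2, h3, hPQ s h4, h5⟩

theorem DiagShift.strip (h : DiagShift S T x y) (hS : InStrip X X' S) : InStrip X X' T := by
  intro u v huv
  by_cases huv' : (u, v) ∈ S
  · exact hS u v huv'
  · obtain ⟨-, h1, -, h2, -⟩ := h.added u v huv huv'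
    have := hS _ _ h2
    omega

/-- A new particle in the last column came from a corner of `S`, so `S` itself is the jammed
configuration. -/
theorem DiagShift.tame (h : DiagShift S T x y) (hS : InStrip X X' S) :
    Tame (fun s => s = y - x) X X' S T := by
  by_cases hc : ColumnLE X' T S
  · exact Or.inl fun _ => hc
  · unfold ColumnLE at hc
    push Not at hc
    obtain ⟨v, hv, hv'⟩ := hc
    obtain ⟨h1, h2, h3, h4, h5⟩ := h.added _ v hv hv'
    have e : y - x + X' = v := by omega
    exact Or.inr ⟨S, y - x, .refl, hS, fun _ h => h, rfl, by
      rw [Jammed, e]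
      exact ⟨h3, h4, hv', h5⟩⟩

/-- The lowest particle of the topmost run of the leftmost column walks to the top of the run. -/
theorem planeReach_walk (h0 : 0 ∈ S) (hS : ∀ u v, (u, v) ∈ S → X ≤ u) (hab : a < b)
    (hrun : ∀ y, a ≤ y → y ≤ b → (X, y) ∈ S) (ha : (X, a - 1) ∉ S) (hb : ∀ y, b < y → (X, y) ∉ S)
    (hp : (X, a) ≠ 0) (hc : (X + 1, a + 1) ∈ S ∨ (X + 1, a) ∉ S)
    (hu : (X + 1, b + 2) ∈ S → (X + 1, b + 1) ∈ S) :
    PlaneReach S (insert (X, b + 1) (S.erase (X, a))) := by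
  have hlt : ∀ {u v : ℤ}, u < X → (u, v) ∉ S := fun hu h => by have := hS _ _ h; omega
  have hX0 : X ≤ 0 := hS 0 0 h0
  have hne : ∀ y, (X - 1, y) ≠ (0 : ℤ × ℤ) := fun y h => by
    simp only [Prod.mk_eq_zero] at h
    omega
  -- The particle first steps out of the strip, staying attached to the second particle of the run.
  have start : PlaneReach S (insert (X - 1, a) (S.erase (X, a))) := by
    refine .single (planeStep_left (hrun a le_rfl hab.le) hp (hlt (by omega)) ?_)
    simp only [RingOK, hlt (show X - 1 < X by omega), hlt (show X - 2 < X by omega), ha,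
      hrun (a + 1) (by omega) (by omega), or_true, true_and, and_true, false_and, and_false,
      false_imp_iff, not_true_eq_false, not_false_eq_true, or_false,
      imp_true_iff, or_self, false_or]
    tauto
  have climb : ∀ k : ℕ, a + k ≤ b →
      PlaneReach S (insert (X - 1, a + k) (S.erase (X, a))) := by
    intro k
    induction k with
    | zero => simpa using fun _ => start
    | succ k ih =>
      intro hk
      push_cast at hk
      refine (ih (by omega)).tail ?_
      have h1 : ∀ {u v : ℤ}, u < X → ¬ (u = X - 1 ∧ v = a + k) →
          (u, v) ∉ insert (X - 1, a + (k : ℤ)) (S.erase (X, a)) := fun hu huv h => by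
        rcases mem_move.1 h with h | h
        exacts [huv h, hlt hu h.1]
      have h2 : (X - 1 + 1, a + k + 1) ∈ insert (X - 1, a + (k : ℤ)) (S.erase (X, a)) := by
        rw [mem_move, sub_add_cancel]
        exact Or.inr ⟨hrun _ (by omega) (by omega), by omega⟩
      have e : insert (X - 1, a + ((k + 1 : ℕ) : ℤ)) (S.erase (X, a)) =
          insert (X - 1, a + k + 1) ((insert (X - 1, a + (k : ℤ)) (S.erase (X, a))).erase
            (X - 1, a + k)) := by
        rw [Finset.erase_insert (fun h => hlt (by omega) (Finset.mem_of_mem_erase h))]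
        push_cast
        rw [add_assoc]
      rw [e]
      refine planeStep_up (mem_move.2 (Or.inl ⟨rfl, rfl⟩)) (hne _) (h1 (by omega) (by omega)) ?_
      simp only [RingOK, h2, h1 (show X - 1 - 1 < X by omega) (v := a + k) (by omega),
        h1 (show X - 1 - 1 < X by omega) (v := a + k - 1) (by omega),
        h1 (show X - 1 < X by omega) (v := a + k - 1) (by omega),
        h1 (show X - 1 - 1 < X by omega) (v := a + k + 1) (by omega),
        h1 (show X - 1 < X by omega) (v := a + k + 2) (by omega), or_true, and_true,
        false_and, and_false, false_imp_iff, not_true_eq_false, not_false_eq_true,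
        or_false, imp_true_iff, or_self, false_or]
  have top := climb (b - a).toNat (by omega)
  rw [show a + ((b - a).toNat : ℤ) = b by omega] at top
  refine top.tail ?_
  have e : insert (X, b + 1) (S.erase (X, a)) =
      insert (X - 1 + 1, b + 1) ((insert (X - 1, b) (S.erase (X, a))).erase (X - 1, b)) := by
    rw [Finset.erase_insert (fun h => hlt (by omega) (Finset.mem_of_mem_erase h)), sub_add_cancel]
  rw [e]
  have h1 : ∀ {u v : ℤ}, u < X → ¬ (u = X - 1 ∧ v = b) →
      (u, v) ∉ insert (X - 1, b) (S.erase (X, a)) := fun hu huv h => by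
    rcases mem_move.1 h with h | h
    exacts [huv h, hlt hu h.1]
  -- At the top, `(X, b)` is the only common neighbour; the assumption `hu` attaches a possible
  -- particle at `(X + 1, b + 2)` to it.
  refine planeStep_ru (mem_move.2 (Or.inl ⟨rfl, rfl⟩)) (hne _) ?_ ?_
  · rw [mem_move, sub_add_cancel]
    rintro (h | h)
    · omega
    · exact hb _ (by omega) h.1
  · have h2 : (X - 1 + 1, b) ∈ insert (X - 1, b) (S.erase (X, a)) := by
      rw [mem_move, sub_add_cancel]
      exact Or.inr ⟨hrun _ (by omega) (by omega), by omega⟩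
    have h3 : (X - 1 + 1, b + 2) ∉ insert (X - 1, b) (S.erase (X, a)) := by
      rw [mem_move, sub_add_cancel]
      rintro (h | h)
      · omega
      · exact hb _ (by omega) h.1
    have h4 : (X - 1 + 2, b + 2) ∈ insert (X - 1, b) (S.erase (X, a)) →
        (X - 1 + 2, b + 1) ∈ insert (X - 1, b) (S.erase (X, a)) := by
      rw [mem_move, mem_move, show X - 1 + 2 = X + 1 by ring]
      rintro (h | h)
      · omega
      · exact Or.inr ⟨hu h.1, by omega⟩
    simp only [RingOK, h2, h3, h1 (show X - 1 < X by omega) (v := b + 1) (by omega),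
      h1 (show X - 1 - 1 < X by omega) (v := b - 1) (by omega),
      h1 (show X - 1 < X by omega) (v := b - 1) (by omega),
      h1 (show X - 1 - 1 < X by omega) (v := b) (by omega), or_true, true_and, and_true,
      false_and, and_false, false_imp_iff, not_true_eq_false, not_false_eq_true,
      or_false, imp_true_iff, or_self, false_or]
    tauto

end

section
variable {N : ℕ} {X X' a b : ℤ}

/-- Removing the lowest particle of the topmost run of the leftmost column, if it can be detached
upwards: it walks to the top of the run, after particles sealing the top have been taken in. -/
theorem exists_raised_of_walk (hN : 2 ≤ N) (m : ℕ) : ∀ (S : Finset (ℤ × ℤ)) (b : ℤ),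
    PlaneConf N S → (N : ℤ) ≤ m + (b - a) → InStrip X X' S → a < b →
    (∀ y, a ≤ y → y ≤ b → (X, y) ∈ S) → (X, a - 1) ∉ S → (∀ y, b < y → (X, y) ∉ S) →
    (X, a) ≠ 0 → ((X + 1, a + 1) ∈ S ∨ (X + 1, a) ∉ S) → X ≤ b →
    ∃ T, Raised (fun s => b + 1 - X ≤ s) X X' a b S T := by
  -- The number `m` bounds how many particles the run can still take in; for `m = 0` the run would
  -- have more than `N` particles.
  induction m with
  | zero =>
    intro S b hS hm hstrip hab hrun
    exfalso
    have hsub : (Finset.Icc a b).map ⟨fun y => (X, y), fun y z h => by simpa using h⟩ ⊆ S := by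
      intro c hc
      obtain ⟨y, hy, rfl⟩ := Finset.mem_map.1 hc
      rw [Finset.mem_Icc] at hy
      exact hrun y hy.1 hy.2
    have := Finset.card_le_card hsub
    rw [Finset.card_map, Int.card_Icc, hS.card_eq] at this
    omega
  | succ m ih =>
  intro S b hS hm hstrip hab hrun ha hb hp hc hXb
  have walk : ∀ T, PlaneReach S T → DiagShift S T (X + 1) (b + 2) →
      ((X + 1, b + 2) ∈ T → (X + 1, b + 1) ∈ T) →
      ∃ T, Raised (fun s => b + 1 - X ≤ s) X X' a b S T := by
    intro T hST hT hseal
    have hcol : ∀ y, (X, y) ∈ T ↔ (X, y) ∈ S := fun y => hT.lt (by omega)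
    have hTs : InStrip X X' T := hT.strip hstrip
    have hwalk := planeReach_walk (hS.reach hST).zero_mem (fun u v h => (hTs u v h).1) hab
      (fun y h1 h2 => (hcol y).2 (hrun y h1 h2)) (mt (hcol _).1 ha)
      (fun y hy => mt (hcol y).1 (hb y hy)) hp
      (by rwa [hT.off (by omega), hT.off (by omega)]) hseal
    refine ⟨_, hST.trans hwalk, ?_, ?_, ?_, ?_⟩
    · intro u v huv
      rcases mem_move.1 huv with ⟨rfl, rfl⟩ | ⟨h, -⟩
      · exact ⟨le_rfl, (hstrip _ _ (hrun a le_rfl hab.le)).2⟩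
      · exact hTs u v h
    · rw [mem_move]
      omega
    · intro y hy
      rcases mem_move.1 hy with ⟨-, rfl⟩ | ⟨h, -⟩
      · exact Or.inr (by omega)
      · exact Or.inl ((hcol y).1 h)
    · refine (Tame.mono (fun s hs => ?_) (hT.tame hstrip)).trans (Or.inl fun hX y hy => ?_) hST
      · omega
      · rcases mem_move.1 hy with h | h
        · omega
        · exact h.1
  -- A particle at `(X + 1, b + 2)` with nothing below it seals the top. It is pulled onto `(X, b +
  -- 1)`, where it lengthens the run.
  have hop : ∀ T, PlaneReach S T → DiagShift S T (X + 1) (b + 2) →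
      (X + 1, b + 2) ∈ S → (X + 1, b + 1) ∉ S → (X + 1, b + 2) ∈ T →
      ((X + 1, b + 3) ∈ T ∨ (X + 2, b + 3) ∈ T ∨ (X + 2, b + 2) ∈ T) →
      ((X + 1, b + 3) ∈ T ∧ (X + 2, b + 2) ∈ T → (X + 2, b + 3) ∈ T) →
      ∃ T, Raised (fun s => b + 1 - X ≤ s) X X' a b S T := by
    intro T hST hT hg hgd hgT hn hn'
    have hcol : ∀ y, (X, y) ∈ T ↔ (X, y) ∈ S := fun y => hT.lt (by omega)
    have hTs : InStrip X X' T := hT.strip hstrip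
    have hXX' := hstrip _ _ hg
    have hstep : PlaneStep T (insert (X, b + 1) (T.erase (X + 1, b + 2))) := by
      have := planeStep_ld (S := T) (x := X + 1) (y := b + 2) hgT (by
        simp only [ne_eq, Prod.mk_eq_zero]
        omega)
      simp only [coord_simps] at this
      refine this (mt (hcol _).1 (hb _ (by omega))) ?_
      have h1 : (X + 1, b + 1) ∉ T := by rwa [hT.off (by omega)]
      have h2 : (X, b + 2) ∉ T := mt (hcol _).1 (hb _ (by omega))
      have h3 : (X, b) ∈ T := (hcol _).2 (hrun b hab.le le_rfl)
      have h4 : (X - 1, b) ∉ T := fun h => by have := hTs _ _ h; omega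
      have h5 : (X - 1, b + 1) ∉ T := fun h => by have := hTs _ _ h; omega
      simp only [RingOK, h1, h2, h3, h4, h5, true_and, and_true,
        false_and, and_false, false_imp_iff, true_imp_iff, not_false_eq_true,
        or_false, or_self, false_or]
      clear * - hn hn'
      tauto
    set U := insert (X, b + 1) (T.erase (X + 1, b + 2)) with hU
    have hSU : PlaneReach S U := hST.tail hstep
    have hcolU : ∀ y, (X, y) ∈ U ↔ y = b + 1 ∨ (X, y) ∈ S := fun y => by
      rw [hU, mem_move, hcol]
      constructor
      · rintro (h | h)
        exacts [Or.inl h.2, Or.inr h.1]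
      · rintro (h | h)
        exacts [Or.inl ⟨rfl, h⟩, Or.inr ⟨h, by omega⟩]
    have hUs : InStrip X X' U := by
      intro u v huv
      rcases mem_move.1 huv with ⟨rfl, rfl⟩ | ⟨h, -⟩
      · omega
      · exact hTs u v h
    obtain ⟨V, h1, h2, h3, h4, h5⟩ := ih U (b + 1) (hS.reach hSU) (by push_cast at hm; omega) hUs
      (by omega)
      (fun y h1 h2 => (hcolU y).2 (by
        rcases h2.eq_or_lt with h2 | h2
        exacts [Or.inl h2, Or.inr (hrun y h1 (by omega))]))
      (by rw [hcolU]; rintro (h | h); exacts [by omega, ha h])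
      (fun y hy => by rw [hcolU]; rintro (h | h); exacts [by omega, hb y (by omega) h])
      hp (by
        rw [hU, mem_move, mem_move, hT.off (by omega), hT.off (by omega)]
        rcases hc with hc | hc
        · exact Or.inl (Or.inr ⟨hc, by omega⟩)
        · exact Or.inr (by rintro (h | h); exacts [by omega, hc h.1])) (by omega)
    refine ⟨V, hSU.trans h1, h2, h3, fun y hy => ?_, ?_⟩
    · rcases h4 y hy with h | h
      · rcases (hcolU y).1 h with h | h
        exacts [Or.inr (by omega), Or.inl h]
      · exact Or.inr (by omega)
    · have hTU : Tame (fun s => b + 1 - X ≤ s) X X' T U := Or.inl fun hX y hy => by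
        rcases mem_move.1 hy with h | h
        · omega
        · exact h.1
      refine (((hT.tame hstrip).mono fun s hs => ?_).trans hTU hST).trans
        (h5.mono fun s hs => ?_) hSU <;> omega
  by_cases hg : (X + 1, b + 2) ∈ S ∧ (X + 1, b + 1) ∉ S
  · obtain ⟨hg, hgd⟩ := hg
    have hgl : (X, b + 2) ∉ S := hb _ (by omega)
    have hgld : (X, b + 1) ∉ S := hb _ (by omega)
    have hnb := hS.nbr_cases hN hg
    simp only [coord_simps] at hnb
    by_cases hc3 : (X + 1, b + 3) ∈ S ∧ (X + 2, b + 2) ∈ S ∧ (X + 2, b + 3) ∉ S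
    -- The sealing particle is a corner. Because of `X ≤ b`, the food is not on its diagonal and
    -- cannot block.
    · obtain ⟨T, hST, hT, hT'⟩ := hS.exists_diagShift hN (X' + 1 - (X + 1)).toNat (X + 1) (b + 2)
        (fun u v huv => by have := hstrip u v huv; have := hstrip _ _ hg; omega) hg
        (by simp only [ne_eq, Prod.mk_eq_zero]; omega)
        (Or.inl (by simpa only [coord_simps] using hc3.1))
        (by simpa only [coord_simps] using hc3.2.1)
        (by simpa only [coord_simps] using hgl) (by simpa only [coord_simps] using hgld)
        (by simpa only [coord_simps] using hgd) (by simpa only [coord_simps] using hc3.2.2)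
        (fun h => by omega)
      simp only [coord_simps] at hT'
      rcases hT' with hT' | ⟨hT1, hT2⟩
      · exact walk T hST hT fun h => (hT' h).elim
      · exact hop T hST hT hg hgd hT1 (Or.inr (Or.inl hT2)) fun _ => hT2
    · exact hop S .refl (.refl S _ _) hg hgd hg (by tauto) (by tauto)
  · exact walk S .refl (.refl S _ _) (by tauto)

/-- The lowest particle of the topmost run `a, …, b` of the leftmost column can be removed,
unless the food particle is a corner at which a chain of corners on its diagonal gets stuck. -/
theorem PlaneConf.exists_raised {S : Finset (ℤ × ℤ)} (hS : PlaneConf N S) (hN : 2 ≤ N)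
    (hstrip : InStrip X X' S) (hab : a ≤ b)
    (hrun : ∀ y, a ≤ y → y ≤ b → (X, y) ∈ S) (ha : (X, a - 1) ∉ S) (hb : ∀ y, b < y → (X, y) ∉ S)
    (hp : (X, a) ≠ 0) (hXb : X ≤ b)
    (hf : ¬ (a = X ∧ (-1, 0) ∉ S ∧ (-1, -1) ∉ S ∧ (0, -1) ∉ S)) :
    ∃ T, Raised (fun s => s = a - X ∨ b + 1 - X ≤ s) X X' a b S T := by
  have hpS : (X, a) ∈ S := hrun a le_rfl hab
  have hXX' := hstrip _ _ hpS
  have hlt : ∀ {u v : ℤ}, u < X → (u, v) ∉ S := fun hu h => by have := hstrip _ _ h; omega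
  have corner : (X + 1, a) ∈ S → (X + 1, a + 1) ∉ S → ((X, a + 1) ∈ S ∨ (X + 1, a + 2) ∉ S) →
      ∃ T, PlaneReach S T ∧ DiagShift S T X a ∧ ((X, a) ∉ T ∨ (X, a) ∈ T ∧ (X + 1, a + 1) ∈ T) :=
    fun h1 h2 h3 => hS.exists_diagShift hN (X' + 1 - X).toNat X a
      (fun u v huv => by have := hstrip u v huv; omega) hpS hp h3 h1 (hlt (by omega))
      (hlt (by omega)) ha h2 (fun h => hf ⟨h.1.symm, h.2⟩)
  have hcol : ∀ {T}, DiagShift S T X a → ∀ y, (X, y) ∈ T → (X, y) ∈ S := fun hT y h =>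
    hT.mem_of_le le_rfl h
  have gone : ∀ T, PlaneReach S T → DiagShift S T X a → (X, a) ∉ T →
      ∃ T, Raised (fun s => s = a - X ∨ b + 1 - X ≤ s) X X' a b S T := fun T hST hT hT' =>
    ⟨T, hST, hT.strip hstrip, hT', fun y hy => Or.inl (hcol hT y hy),
      (hT.tame hstrip).mono fun s hs => Or.inl hs⟩
  rcases hab.eq_or_lt with rfl | hab
  · -- the run consists of a single particle
    have hu : (X, a + 1) ∉ S := hb _ (by omega)
    have single : ∀ T, PlaneReach S T → DiagShift S T X a →
        PlaneStep T (insert (X, a + 1) (T.erase (X, a))) →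
        ∃ T, Raised (fun s => s = a - X ∨ a + 1 - X ≤ s) X X' a a S T := by
      intro T hST hT hstep
      have hTs : InStrip X X' T := hT.strip hstrip
      refine ⟨_, hST.tail hstep, ?_, ?_, ?_, ?_⟩
      · intro u v huv
        rcases mem_move.1 huv with ⟨rfl, rfl⟩ | ⟨h, -⟩
        · omega
        · exact hTs u v h
      · rw [mem_move]
        omega
      · intro y hy
        rcases mem_move.1 hy with ⟨-, rfl⟩ | ⟨h, -⟩
        · exact Or.inr (by omega)
        · exact Or.inl (hcol hT y h)
      · refine ((hT.tame hstrip).mono fun s hs => Or.inl hs).trans (Or.inl fun hX y hy => ?_) hST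
        rcases mem_move.1 hy with h | h
        · omega
        · exact h.1
    have up : ∀ T, PlaneReach S T → DiagShift S T X a → (X, a) ∈ T → (X + 1, a + 1) ∈ T →
        ∃ T, Raised (fun s => s = a - X ∨ a + 1 - X ≤ s) X X' a a S T := by
      intro T hST hT hpT hru
      refine single T hST hT (planeStep_up hpT hp (fun h => hu (hcol hT _ h)) ?_)
      have hltT : ∀ {u v : ℤ}, u < X → (u, v) ∉ T := fun h => by
        rw [hT.lt h]; exact hlt h
      have h1 : (X, a - 1) ∉ T := fun h => ha (hcol hT _ h)
      have h2 : (X, a + 2) ∉ T := fun h => hb _ (by omega) (hcol hT _ h)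
      simp only [RingOK, hru, h1, h2, hltT (show X - 1 < X by omega), and_true,
        false_and, and_false, false_imp_iff, not_true_eq_false, not_false_eq_true,
        or_false, imp_true_iff, or_self, or_true]
    by_cases hru : (X + 1, a + 1) ∈ S
    · exact up S .refl (.refl S _ _) hpS hru
    have hr : (X + 1, a) ∈ S := by
      have h1 : (X - 1, a) ∉ S := hlt (by omega)
      have h2 : (X - 1, a - 1) ∉ S := hlt (by omega)
      have := hS.nbr_cases hN hpS
      tauto
    -- With both `(X + 1, a)` and `(X + 1, a + 2)` occupied, the particle moves up by the second
    -- alternative; otherwise it is a corner that may leave along the diagonal.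
    by_cases huu : (X + 1, a + 2) ∈ S
    · refine single S .refl (.refl S _ _) (planeStep_up hpS hp hu ?_)
      simp only [RingOK, hru, hr, huu, ha, hb (a + 2) (by omega), hlt (show X - 1 < X by omega),
        and_true,
        and_false, false_imp_iff, true_imp_iff, not_false_eq_true,
        or_self, or_true]
    · obtain ⟨T, hST, hT, hT' | hT'⟩ := corner hr hru (Or.inr huu)
      · exact gone T hST hT hT'
      · exact up T hST hT hT'.1 hT'.2
  · have hu := hrun (a + 1) (by omega) (by omega)
    have walk : ∀ T, PlaneReach S T → DiagShift S T X a → (X, a) ∈ T →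
        ((X + 1, a + 1) ∈ T ∨ (X + 1, a) ∉ T) →
        ∃ T, Raised (fun s => s = a - X ∨ b + 1 - X ≤ s) X X' a b S T := by
      intro T hST hT hpT hc
      have hcol' : ∀ y, (X, y) ∈ T ↔ (X, y) ∈ S := fun y =>
        ⟨hcol hT y, fun h => by_contra fun h' => by
          have := hT.removed _ _ h h'
          exact h' ((show y = a by omega) ▸ hpT)⟩
      obtain ⟨V, h1, h2, h3, h4, h5⟩ := exists_raised_of_walk (X := X) (X' := X') (a := a) hN N T b
        (hS.reach hST) (by omega) (hT.strip hstrip) hab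
        (fun y h1 h2 => (hcol' y).2 (hrun y h1 h2)) (mt (hcol' _).1 ha)
        (fun y hy => mt (hcol' y).1 (hb y hy)) hp hc hXb
      exact ⟨V, hST.trans h1, h2, h3, fun y hy => (h4 y hy).imp_left (hcol' y).1,
        ((hT.tame hstrip).mono fun s hs => Or.inl hs).trans (h5.mono fun s hs => Or.inr hs) hST⟩
    by_cases hc : (X + 1, a + 1) ∈ S ∨ (X + 1, a) ∉ S
    · exact walk S .refl (.refl S _ _) hpS hc
    · push Not at hc
      obtain ⟨T, hST, hT, hT' | hT'⟩ := corner hc.2 hc.1 (Or.inl hu)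
      · exact gone T hST hT hT'
      · exact walk T hST hT hT'.1 (Or.inl hT'.2)

end

/-! ### Symmetries of the lattice -/

/-- Reflection in the axis of the move exchanges the common neighbours and reverses both arcs. -/
theorem RingOK.swap {c₁ c₂ a₁ a₂ a₃ b₁ b₂ b₃ : Prop} (h : RingOK c₁ c₂ a₁ a₂ a₃ b₁ b₂ b₃) :
    RingOK c₂ c₁ a₃ a₂ a₁ b₃ b₂ b₁ := by
  obtain ⟨h | h, h'⟩ := h
  · obtain ⟨h0, h1, h2, h3, h4, h5, h6⟩ := h
    exact ⟨Or.inl ⟨h0.symm, h3, fun h => (h2 h).symm, h1, h6, fun h => (h5 h).symm, h4⟩,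
      fun ⟨x1, x2, x3, x4, x5⟩ => h' ⟨x2, x1, x5, x4, x3⟩⟩
  · obtain ⟨h1, h2, h3, h4, h5, h6⟩ := h
    exact ⟨Or.inr ⟨h2, h1, by tauto, by tauto, fun h => h5 h.symm, fun h => h6 h.symm⟩,
      fun ⟨x1, x2, x3, x4, x5⟩ => h' ⟨x2, x1, x5, x4, x3⟩⟩

/-- An involutive symmetry of the triangular lattice that fixes the origin. -/
structure LatticeInvolution (f : ℤ × ℤ → ℤ × ℤ) : Prop where
  map_add : ∀ u v, f (u + v) = f u + f v
  invol : ∀ u, f (f u) = u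
  map_dir : ∃ c, (∀ i, f (triDir ℤ i) = triDir ℤ (i + c)) ∨
    (∀ i, f (triDir ℤ i) = triDir ℤ (c - i))

namespace LatticeInvolution

variable {f : ℤ × ℤ → ℤ × ℤ} {S T : Finset (ℤ × ℤ)}

theorem mem_image (hf : LatticeInvolution f) {c : ℤ × ℤ} : c ∈ S.image f ↔ f c ∈ S := by
  rw [Finset.mem_image]
  exact ⟨fun ⟨a, ha, h⟩ => by rwa [← h, hf.invol], fun h => ⟨_, h, hf.invol c⟩⟩

theorem injective (hf : LatticeInvolution f) : Function.Injective f :=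
  (Function.LeftInverse.injective hf.invol)

theorem map_zero (hf : LatticeInvolution f) : f 0 = 0 := by
  have := hf.map_add 0 0
  simpa using this

theorem image_image (hf : LatticeInvolution f) : (S.image f).image f = S := by
  ext c
  rw [hf.mem_image, hf.mem_image, hf.invol]

/-- A rotation shifts the direction index. A reflection reverses the cyclic order, so the ring is
read backwards, whence `RingOK.swap`. -/
theorem planeStep (hf : LatticeInvolution f) (h : PlaneStep S T) :
    PlaneStep (S.image f) (T.image f) := by
  obtain ⟨l, i, hl, hl0, hl', hok, rfl⟩ := h
  have hmem : ∀ u, f u ∈ S.image f ↔ u ∈ S := fun u => by rw [hf.mem_image, hf.invol]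
  have hfl0 : f l ≠ 0 := fun h => hl0 (hf.injective (by rw [h, hf.map_zero]))
  obtain ⟨c, hc | hc⟩ := hf.map_dir
  · have hd : ∀ k, triDir ℤ (i + c + k) = f (triDir ℤ (i + k)) := fun k => by
      rw [hc, add_right_comm]
    have hd0 : triDir ℤ (i + c) = f (triDir ℤ i) := (hc i).symm
    refine ⟨f l, i + c, (hmem l).2 hl, hfl0, ?_, ?_, ?_⟩
    · rwa [hd0, ← hf.map_add, hmem]
    · unfold MoveOK at hok ⊢
      simp only [Finset.mem_coe, hd, hd0, ← hf.map_add, hmem] at hok ⊢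
      exact hok
    · rw [hd0, ← hf.map_add, Finset.image_insert, Finset.image_erase hf.injective]
  · have hd : ∀ k, triDir ℤ (c - i + k) = f (triDir ℤ (i - k)) := fun k => by
      rw [hc, sub_add]
    have hd0 : triDir ℤ (c - i) = f (triDir ℤ i) := (hc i).symm
    refine ⟨f l, c - i, (hmem l).2 hl, hfl0, ?_, ?_, ?_⟩
    · rwa [hd0, ← hf.map_add, hmem]
    · unfold MoveOK at hok ⊢
      simp only [Finset.mem_coe, hd, hd0, ← hf.map_add, hmem] at hok ⊢
      have e : ∀ k, i - k = i + -k := fun k => sub_eq_add_neg i k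
      simp only [e, show -(1 : Fin 6) = 5 from rfl, show -(5 : Fin 6) = 1 from rfl,
        show -(2 : Fin 6) = 4 from rfl, show -(3 : Fin 6) = 3 from rfl,
        show -(4 : Fin 6) = 2 from rfl]
      exact hok.swap
    · rw [hd0, ← hf.map_add, Finset.image_insert, Finset.image_erase hf.injective]

theorem planeReach (hf : LatticeInvolution f) (h : PlaneReach S T) :
    PlaneReach (S.image f) (T.image f) := by
  induction h with
  | refl => exact .refl
  | tail _ h ih => exact ih.tail (hf.planeStep h)

theorem planeReach_left (hf : LatticeInvolution f) (h : PlaneReach (S.image f) T) :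
    PlaneReach S (T.image f) := by
  have := hf.planeReach h
  rwa [hf.image_image] at this

theorem adj (hf : LatticeInvolution f) {u v : ℤ × ℤ} (h : (triLattice ℤ).Adj u v) :
    (triLattice ℤ).Adj (f u) (f v) := by
  obtain ⟨i, rfl⟩ := h.2
  refine ⟨fun h' => h.1 (hf.injective h'), ?_⟩
  obtain ⟨c, hc | hc⟩ := hf.map_dir
  exacts [⟨_, by rw [hf.map_add, hc]⟩, ⟨_, by rw [hf.map_add, hc]⟩]

theorem planeConf (hf : LatticeInvolution f) {N : ℕ} (h : PlaneConf N S) :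
    PlaneConf N (S.image f) := by
  refine ⟨?_, ?_, ?_⟩
  · rw [hf.mem_image, hf.map_zero]
    exact h.zero_mem
  · rw [Finset.card_image_of_injective _ hf.injective, h.card_eq]
  · have hc := induce_connected_iff.1 h.connected
    refine induce_connected_iff.2 ⟨?_, ?_⟩
    · exact ⟨0, Finset.mem_coe.2 (by rw [hf.mem_image, hf.map_zero]; exact h.zero_mem)⟩
    · intro u hu v hv
      rw [Finset.mem_coe, hf.mem_image] at hu hv
      have := (hc.2 _ hu _ hv).map (G' := triLattice ℤ) (A' := (S.image f : Finset (ℤ × ℤ))) f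
        (fun a ha => by rw [Finset.mem_coe, hf.mem_image, hf.invol]; exact ha)
        (fun a _ b _ h => hf.adj h)
      rwa [hf.invol, hf.invol] at this

end LatticeInvolution

/-- The reflection that preserves the columns and exchanges the upper and lower ends. -/
def flipColumn (c : ℤ × ℤ) : ℤ × ℤ := (c.1, c.1 - c.2)

/-- The reflection that reverses the order of the columns. -/
def reverseColumns (c : ℤ × ℤ) : ℤ × ℤ := (-c.1, c.2 - c.1)

theorem latticeInvolution_flipColumn : LatticeInvolution flipColumn := by
  refine ⟨fun u v => ?_, fun u => ?_, 1, Or.inr (by decide)⟩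
  · simp only [flipColumn, Prod.fst_add, Prod.snd_add, Prod.mk_add_mk]
    exact Prod.ext rfl (by ring)
  · simp [flipColumn]

theorem latticeInvolution_neg : LatticeInvolution (fun c => -c) := by
  refine ⟨fun u v => neg_add u v, fun u => neg_neg u, 3, Or.inl (by decide)⟩

theorem latticeInvolution_reverseColumns : LatticeInvolution reverseColumns := by
  refine ⟨fun u v => ?_, fun u => ?_, 4, Or.inr (by decide)⟩
  · simp only [reverseColumns, Prod.fst_add, Prod.snd_add, Prod.mk_add_mk]
    exact Prod.ext (by ring) (by ring)
  · simp [reverseColumns]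

section
variable {S : Finset (ℤ × ℤ)} {x y X X' : ℤ}

theorem mem_image_flipColumn : (x, y) ∈ S.image flipColumn ↔ (x, x - y) ∈ S :=
  latticeInvolution_flipColumn.mem_image

theorem mem_image_neg : (x, y) ∈ S.image (fun c => -c) ↔ (-x, -y) ∈ S :=
  latticeInvolution_neg.mem_image

theorem mem_image_reverseColumns : (x, y) ∈ S.image reverseColumns ↔ (-x, y - x) ∈ S :=
  latticeInvolution_reverseColumns.mem_image

theorem InStrip.flipColumn (h : InStrip X X' S) : InStrip X X' (S.image flipColumn) :=
  fun u _ huv => h u _ (mem_image_flipColumn.1 huv)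

theorem InStrip.neg (h : InStrip X X' S) : InStrip (-X') (-X) (S.image (fun c => -c)) :=
  fun u v huv => by
    have := h _ _ (mem_image_neg.1 huv)
    omega

theorem InStrip.reverseColumns (h : InStrip X X' S) :
    InStrip (-X') (-X) (S.image reverseColumns) := fun u v huv => by
  have := h _ _ (mem_image_reverseColumns.1 huv)
  omega

end

/-! ### Removal of particles at the other ends of the border columns. -/

section
variable {N : ℕ} {S : Finset (ℤ × ℤ)} {X X' a b : ℤ}

/-- Removing the highest particle of the lowest run of the leftmost column. -/
theorem PlaneConf.exists_remove_left_top (hS : PlaneConf N S) (hN : 2 ≤ N)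
    (hstrip : InStrip X X' S) (hab : a ≤ b) (hrun : ∀ y, a ≤ y → y ≤ b → (X, y) ∈ S)
    (hb : (X, b + 1) ∉ S) (ha : ∀ y, y < a → (X, y) ∉ S) (hp : b ≠ 0) (ha0 : a ≤ 0) :
    ∃ T, PlaneReach S T ∧ InStrip X X' T ∧ (X, b) ∉ T ∧
      (∀ y, (X, y) ∈ T → (X, y) ∈ S ∨ y < a) := by
  obtain ⟨T, h1, h2, h3, h4, -⟩ :=
    (latticeInvolution_flipColumn.planeConf hS).exists_raised hN (X := X) (X' := X')
      (a := X - b) (b := X - a) hstrip.flipColumn (by omega)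
      (fun y h1 h2 => mem_image_flipColumn.2 (hrun _ (by omega) (by omega)))
      (by rw [mem_image_flipColumn, show X - (X - b - 1) = b + 1 by ring]; exact hb)
      (fun y hy => by rw [mem_image_flipColumn]; exact ha _ (by omega))
      -- The food could block only if `b = 0`, which `hp` excludes.
      (by simp only [ne_eq, Prod.mk_eq_zero]; omega) (by omega) (fun h => by omega)
  refine ⟨T.image flipColumn, latticeInvolution_flipColumn.planeReach_left h1, h2.flipColumn,
    by rwa [mem_image_flipColumn], fun y hy => ?_⟩
  rw [mem_image_flipColumn] at hy
  rcases h4 _ hy with h | h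
  · rw [mem_image_flipColumn, sub_sub_cancel] at h
    exact Or.inl h
  · exact Or.inr (by omega)

/-- Removing the highest particle of the lowest run of the rightmost column. -/
theorem PlaneConf.exists_remove_right_top (hS : PlaneConf N S) (hN : 2 ≤ N)
    (hstrip : InStrip X X' S) (hXX' : X < X') (hab : a ≤ b)
    (hrun : ∀ y, a ≤ y → y ≤ b → (X', y) ∈ S)
    (hb : (X', b + 1) ∉ S) (ha : ∀ y, y < a → (X', y) ∉ S) (hp : X' ≠ 0) (ha0 : a ≤ X')
    (hf : ¬ (b = X' ∧ (1, 0) ∉ S ∧ (1, 1) ∉ S ∧ (0, 1) ∉ S)) :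
    ∃ T, PlaneReach S T ∧ InStrip X X' T ∧ (X', b) ∉ T ∧
      (∀ y, (X', y) ∈ T → (X', y) ∈ S ∨ y < a) ∧
      (ColumnLE X T S ∨ ∃ U y, PlaneReach S U ∧ InStrip X X' U ∧ ColumnLE X U S ∧
        (y = X + 1 - X' + b ∨ y ≤ X - X' + a) ∧ (X, y) ∈ U ∧ (X, y - 1) ∉ U) := by
  obtain ⟨T, h1, h2, h3, h4, h5⟩ :=
    (latticeInvolution_neg.planeConf hS).exists_raised hN (X := -X') (X' := -X)
      (a := -b) (b := -a) hstrip.neg (by omega)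
      (fun y h1 h2 => mem_image_neg.2 (by rw [neg_neg]; exact hrun _ (by omega) (by omega)))
      (by rw [mem_image_neg, show -(-b - 1) = b + 1 by ring, neg_neg]; exact hb)
      (fun y hy => by rw [mem_image_neg, neg_neg]; exact ha _ (by omega))
      (by simp only [ne_eq, Prod.mk_eq_zero]; omega) (by omega) (fun h => hf ⟨by omega, by
        simpa only [mem_image_neg, neg_neg, neg_zero] using h.2⟩)
  have hcol : ∀ {V : Finset (ℤ × ℤ)}, ColumnLE (-X) V (S.image fun c => -c) →
      ColumnLE X (V.image fun c => -c) S := fun hV y hy => by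
    have := hV _ (mem_image_neg.1 hy)
    rwa [mem_image_neg, neg_neg, neg_neg] at this
  have hst : ∀ {V : Finset (ℤ × ℤ)}, InStrip (-X') (-X) V →
      InStrip X X' (V.image fun c => -c) := fun hV => by
    simpa only [neg_neg] using hV.neg
  refine ⟨T.image (fun c => -c), latticeInvolution_neg.planeReach_left h1, hst h2,
    by rwa [mem_image_neg], fun y hy => ?_, ?_⟩
  · rw [mem_image_neg] at hy
    rcases h4 _ hy with h | h
    · rw [mem_image_neg, neg_neg, neg_neg] at h
      exact Or.inl h
    · exact Or.inr (by omega)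
  · rcases h5 with h5 | ⟨U, s, g1, g2, g3, g4, g5, g6, g7, g8⟩
    · exact Or.inl (hcol (h5 (by omega)))
    -- Negation turns the jam into the lower end of a run in the left column: the particle `(-X, s -
    -- X - 1)` goes to `(X, X + 1 - s)`, and the empty site above it goes below.
    · refine Or.inr ⟨_, X + 1 - s, latticeInvolution_neg.planeReach_left g1, hst g2, hcol g3,
        by omega, ?_, ?_⟩
      · rw [mem_image_neg]
        exact mem_of_eq g6 rfl (by ring)
      · rw [mem_image_neg]
        exact fun h => g7 (mem_of_eq h rfl (by ring))

/-- Removing the lowest particle of the topmost run of the rightmost column. -/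
theorem PlaneConf.exists_remove_right_bottom (hS : PlaneConf N S) (hN : 2 ≤ N)
    (hstrip : InStrip X X' S) (hXX' : X < X') (hab : a ≤ b)
    (hrun : ∀ y, a ≤ y → y ≤ b → (X', y) ∈ S)
    (ha : (X', a - 1) ∉ S) (hb : ∀ y, b < y → (X', y) ∉ S) (hp : a ≠ 0) (hb0 : 0 ≤ b) :
    ∃ T, PlaneReach S T ∧ InStrip X X' T ∧ (X', a) ∉ T ∧
      (∀ y, (X', y) ∈ T → (X', y) ∈ S ∨ b < y) ∧
      (ColumnLE X T S ∨ ∃ U y, PlaneReach S U ∧ InStrip X X' U ∧ ColumnLE X U S ∧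
        (y = a ∨ b + 1 ≤ y) ∧ (X + 1, y) ∈ U ∧ (X, y - 1) ∈ U ∧ (X, y) ∉ U ∧
        (X + 1, y - 1) ∉ U) := by
  obtain ⟨T, h1, h2, h3, h4, h5⟩ :=
    (latticeInvolution_reverseColumns.planeConf hS).exists_raised hN (X := -X') (X' := -X)
      (a := a - X') (b := b - X') hstrip.reverseColumns (by omega)
      (fun y h1 h2 => mem_image_reverseColumns.2 (by
        rw [neg_neg]; exact hrun _ (by omega) (by omega)))
      (by rw [mem_image_reverseColumns, show a - X' - 1 - -X' = a - 1 by ring, neg_neg]; exact ha)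
      (fun y hy => by rw [mem_image_reverseColumns, neg_neg]; exact hb _ (by omega))
      (by simp only [ne_eq, Prod.mk_eq_zero]; omega) (by omega) (fun h => by omega)
  have hcol : ∀ {V : Finset (ℤ × ℤ)}, ColumnLE (-X) V (S.image reverseColumns) →
      ColumnLE X (V.image reverseColumns) S := fun hV y hy => by
    have := hV _ (mem_image_reverseColumns.1 hy)
    rw [mem_image_reverseColumns, neg_neg] at this
    exact mem_of_eq this rfl (by ring)
  have hst : ∀ {V : Finset (ℤ × ℤ)}, InStrip (-X') (-X) V →
      InStrip X X' (V.image reverseColumns) := fun hV => by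
    simpa only [neg_neg] using hV.reverseColumns
  refine ⟨T.image reverseColumns, latticeInvolution_reverseColumns.planeReach_left h1, hst h2,
    by rwa [mem_image_reverseColumns], fun y hy => ?_, ?_⟩
  · rw [mem_image_reverseColumns] at hy
    rcases h4 _ hy with h | h
    · rw [mem_image_reverseColumns, neg_neg] at h
      exact Or.inl (mem_of_eq h rfl (by ring))
    · exact Or.inr (by omega)
  · rcases h5 with h5 | ⟨U, s, g1, g2, g3, g4, g5, g6, g7, g8⟩
    · exact Or.inl (hcol (h5 (by omega)))
    -- This reflection turns diagonals into rows, so the height of the jammed diagonal becomes an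
    -- ordinate.
    · refine Or.inr ⟨_, s, latticeInvolution_reverseColumns.planeReach_left g1, hst g2, hcol g3,
        by omega, ?_, ?_, ?_, ?_⟩
      · rw [mem_image_reverseColumns]
        exact mem_of_eq g5 (by ring) (by ring)
      · rw [mem_image_reverseColumns]
        exact mem_of_eq g6 (by ring) (by ring)
      · rw [mem_image_reverseColumns]
        exact fun h => g7 (mem_of_eq h (by ring) (by ring))
      · rw [mem_image_reverseColumns]
        exact fun h => g8 (mem_of_eq h (by ring) (by ring))

end

/-! ### Every connected configuration can be straightened -/

/-- A discrete intermediate value argument: `g` drops by at most one per edge, so it takes on `S`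
every value between `g d` and `g c`. -/
theorem lt_add_card_of_connected {S : Finset (ℤ × ℤ)}
    (hS : ((triLattice ℤ).induce (S : Set (ℤ × ℤ))).Connected) (g : ℤ × ℤ → ℤ)
    (hg : ∀ u v, (triLattice ℤ).Adj u v → g u ≤ g v + 1) {c d : ℤ × ℤ} (hc : c ∈ S) (hd : d ∈ S) :
    g c < g d + S.card := by
  have hsub : Finset.Icc (g d) (g c) ⊆ S.image g := by
    intro k hk
    rw [Finset.mem_Icc] at hk
    by_contra hk'
    have hne : ∀ a ∈ S, g a ≠ k := fun a ha h => hk' (Finset.mem_image.2 ⟨a, ha, h⟩)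
    have : g c < k := by
      refine ((induce_connected_iff.1 hS).2 c hc d hd).induction_head (P := fun a => g a < k)
        (lt_of_le_of_ne hk.1 (hne d hd)) fun a b ha hab _ hb => ?_
      have h1 := hne a ha
      have h2 := hg a b hab
      omega
    omega
  have h1 := (Finset.card_le_card hsub).trans Finset.card_image_le
  rw [Int.card_Icc] at h1
  have : 0 < S.card := Finset.card_pos.2 ⟨c, hc⟩
  omega

theorem triLattice_adj_fst {u v : ℤ × ℤ} (h : (triLattice ℤ).Adj u v) : u.1 ≤ v.1 + 1 := by
  obtain ⟨-, i, rfl⟩ := h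
  fin_cases i <;> simp [triDir] <;> omega

theorem triLattice_adj_snd {u v : ℤ × ℤ} (h : (triLattice ℤ).Adj u v) : u.2 ≤ v.2 + 1 := by
  obtain ⟨-, i, rfl⟩ := h
  fin_cases i <;> simp [triDir] <;> omega

theorem finite_planeConf (N : ℕ) : {S | PlaneConf N S}.Finite := by
  refine (((Finset.Icc (-N : ℤ) N) ×ˢ (Finset.Icc (-N : ℤ) N)).powerset.finite_toSet).subset ?_
  intro S hS
  rw [Finset.mem_coe, Finset.mem_powerset]
  intro c hc
  have h1 := lt_add_card_of_connected hS.connected _ (fun _ _ => triLattice_adj_fst) hc hS.zero_mem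
  have h2 := lt_add_card_of_connected hS.connected _ (fun _ _ => triLattice_adj_fst) hS.zero_mem hc
  have h3 := lt_add_card_of_connected hS.connected _ (fun _ _ => triLattice_adj_snd) hc hS.zero_mem
  have h4 := lt_add_card_of_connected hS.connected _ (fun _ _ => triLattice_adj_snd) hS.zero_mem hc
  rw [hS.card_eq] at h1 h2 h3 h4
  simp only [Prod.fst_zero, Prod.snd_zero, Finset.mem_product, Finset.mem_Icc] at *
  omega

/-! ### Runs in a column and a well-chosen order on columns. -/

section Columns

variable {S T : Finset (ℤ × ℤ)} {x : ℤ}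

theorem exists_column_max {y : ℤ} (h : (x, y) ∈ S) : ∃ b, (x, b) ∈ S ∧ ∀ y, b < y → (x, y) ∉ S := by
  obtain ⟨c, hc, hmax⟩ := (S.filter fun c => c.1 = x).exists_max_image (fun c => c.2)
    ⟨(x, y), by simpa using h⟩
  simp only [Finset.mem_filter] at hc hmax
  refine ⟨c.2, hc.2 ▸ hc.1, fun z hz hxz => ?_⟩
  have := hmax (x, z) ⟨hxz, rfl⟩
  omega

theorem exists_column_min {y : ℤ} (h : (x, y) ∈ S) : ∃ a, (x, a) ∈ S ∧ ∀ y, y < a → (x, y) ∉ S := by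
  obtain ⟨b, hb, hmax⟩ := exists_column_max (S := S.image fun c => -c) (x := -x) (y := -y)
    (by rw [mem_image_neg, neg_neg, neg_neg]; exact h)
  refine ⟨-b, by rwa [mem_image_neg, neg_neg] at hb, fun z hz hxz => hmax (-z) (by omega) ?_⟩
  rwa [mem_image_neg, neg_neg, neg_neg]

theorem exists_run_down {b : ℤ} (h : (x, b) ∈ S) :
    ∃ a ≤ b, (∀ y, a ≤ y → y ≤ b → (x, y) ∈ S) ∧ (x, a - 1) ∉ S := by
  obtain ⟨m, -, hm⟩ := exists_column_min h
  have hex : ∃ k : ℕ, (x, b - k) ∉ S := ⟨(b - m + 1).toNat, hm _ (by omega)⟩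
  classical
  have hk := Nat.find_spec hex
  have hk0 : Nat.find hex ≠ 0 := fun h0 => by
    rw [h0] at hk
    exact hk (by simpa using h)
  refine ⟨b - Nat.find hex + 1, by omega, fun y h1 h2 => ?_, by rwa [add_sub_cancel_right]⟩
  have := Nat.find_min hex (m := (b - y).toNat) (by omega)
  rw [not_not] at this
  exact mem_of_eq this rfl (by omega)

theorem exists_run_up {a : ℤ} (h : (x, a) ∈ S) :
    ∃ b, a ≤ b ∧ (∀ y, a ≤ y → y ≤ b → (x, y) ∈ S) ∧ (x, b + 1) ∉ S := by
  obtain ⟨b, hb, hrun, hb'⟩ := exists_run_down (S := S.image fun c => -c) (x := -x) (b := -a)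
    (by rw [mem_image_neg, neg_neg, neg_neg]; exact h)
  refine ⟨-b, by omega, fun y h1 h2 => ?_, fun h => hb' ?_⟩
  · have := hrun (-y) (by omega) (by omega)
    rwa [mem_image_neg, neg_neg, neg_neg] at this
  · rw [mem_image_neg, neg_neg]
    exact mem_of_eq h rfl (by ring)

open Finset in
/-- The set of heights of the particles in the column `x`, ordered colexicographically with
respect to the ranking `r` of heights. -/
def columnKey (r : ℤ → ℤ ×ₗ ℤ) (x : ℤ) (S : Finset (ℤ × ℤ)) : Colex (Finset (ℤ ×ₗ ℤ)) :=
  toColex ((S.filter fun c => c.1 = x).image fun c => r c.2)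

/-- In the colexicographic order the highest-ranked difference decides; every gained height is
ranked below the lost height `a`. -/
theorem columnKey_lt {r : ℤ → ℤ ×ₗ ℤ} (hr : Function.Injective r) {a : ℤ} (ha : (x, a) ∈ S)
    (ha' : (x, a) ∉ T) (h : ∀ y, (x, y) ∈ T → (x, y) ∈ S ∨ r y < r a) :
    columnKey r x T < columnKey r x S := by
  have mem : ∀ (U : Finset (ℤ × ℤ)) (y : ℤ),
      r y ∈ (U.filter fun c => c.1 = x).image (fun c => r c.2) ↔ (x, y) ∈ U := by
    intro U y
    simp only [Finset.mem_image, Finset.mem_filter, Prod.exists]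
    constructor
    · rintro ⟨u, v, ⟨h1, rfl⟩, h2⟩
      rwa [← hr h2]
    · exact fun h => ⟨x, y, ⟨h, rfl⟩, rfl⟩
  unfold columnKey
  rw [Finset.Colex.toColex_lt_toColex]
  refine ⟨fun he => ha' ?_, fun k hk hk' => ?_⟩
  · rw [← mem, he, mem]
    exact ha
  · obtain ⟨c, hc, rfl⟩ := Finset.mem_image.1 hk
    rw [Finset.mem_filter] at hc
    rw [mem] at hk'
    have hcT : (x, c.2) ∈ T := hc.2 ▸ hc.1
    refine ⟨r a, (mem _ _).2 ha, fun h => ha' ((mem _ _).1 h), ?_⟩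
    rcases h c.2 hcT with h | h
    exacts [(hk' h).elim, h.le]

/-- Low heights are ranked above high heights. -/
def rankLow (y : ℤ) : ℤ ×ₗ ℤ := toLex (0, -y)

/-- Heights up to `c` are ranked above those beyond `c`; on either side heights closer to `c` are
ranked higher. -/
def rankNear (c y : ℤ) : ℤ ×ₗ ℤ := if y ≤ c then toLex (1, y) else toLex (0, -y)

theorem rankLow_injective : Function.Injective rankLow := fun a b h => by
  simpa [rankLow] using h

theorem rankLow_lt {a b : ℤ} : rankLow a < rankLow b ↔ b < a := by
  simp [rankLow, Prod.Lex.toLex_lt_toLex]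

theorem rankNear_injective (c : ℤ) : Function.Injective (rankNear c) := fun a b h => by
  unfold rankNear at h
  split_ifs at h <;> simp at h <;> omega

theorem rankNear_lt {c a b : ℤ} : rankNear c a < rankNear c b ↔
    (b ≤ c ∧ (a < b ∨ c < a)) ∨ (c < b ∧ b < a) := by
  unfold rankNear
  split_ifs <;> simp [Prod.Lex.toLex_lt_toLex] <;> omega

end Columns

/-! ### Configurations in a strip of least width. -/

/-- A family of configurations in the strip `X ≤ x ≤ X'`, closed under moves within the strip,
none of whose members fits into a narrower strip. -/
structure TightFamily (N : ℕ) (X X' : ℤ) (𝓦 : Set (Finset (ℤ × ℤ))) : Prop where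
  conf : ∀ S ∈ 𝓦, PlaneConf N S
  strip : ∀ S ∈ 𝓦, InStrip X X' S
  -- Only the final configuration has to lie in the strip: the walk around a run leaves it on the
  -- way.
  closed : ∀ S ∈ 𝓦, ∀ T, PlaneReach S T → InStrip X X' T → T ∈ 𝓦
  left_nonempty : ∀ S ∈ 𝓦, ∃ y, (X, y) ∈ S
  right_nonempty : ∀ S ∈ 𝓦, ∃ y, (X', y) ∈ S
  nonempty : 𝓦.Nonempty

namespace TightFamily

variable {N : ℕ} {X X' : ℤ} {𝓦 : Set (Finset (ℤ × ℤ))} {S T : Finset (ℤ × ℤ)}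

theorem finite (h : TightFamily N X X' 𝓦) : 𝓦.Finite := (finite_planeConf N).subset h.conf

theorem zero_mem_Icc (h : TightFamily N X X' 𝓦) : X ≤ 0 ∧ 0 ≤ X' := by
  obtain ⟨S, hS⟩ := h.nonempty
  exact h.strip S hS 0 0 (h.conf S hS).zero_mem

theorem preimage {f : ℤ × ℤ → ℤ × ℤ} (hf : LatticeInvolution f) {Y Y' : ℤ}
    (h : TightFamily N X X' 𝓦)
    (h1 : ∀ {S : Finset (ℤ × ℤ)}, InStrip X X' S → InStrip Y Y' (S.image f))
    (h2 : ∀ {S : Finset (ℤ × ℤ)}, InStrip Y Y' S → InStrip X X' (S.image f))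
    (h3 : ∀ S ∈ 𝓦, ∃ y, (Y, y) ∈ S.image f) (h4 : ∀ S ∈ 𝓦, ∃ y, (Y', y) ∈ S.image f) :
    TightFamily N Y Y' {S | S.image f ∈ 𝓦} where
  conf S hS := by
    have := hf.planeConf (h.conf _ hS)
    rwa [hf.image_image] at this
  strip S hS := by
    have := h1 (h.strip _ hS)
    rwa [hf.image_image] at this
  closed S hS T hST hT := h.closed _ hS _ (hf.planeReach hST) (h2 hT)
  left_nonempty S hS := by
    have := h3 _ hS
    rwa [hf.image_image] at this
  right_nonempty S hS := by
    have := h4 _ hS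
    rwa [hf.image_image] at this
  nonempty := by
    obtain ⟨S, hS⟩ := h.nonempty
    exact ⟨S.image f, by rwa [Set.mem_ofPred_eq, hf.image_image]⟩

theorem flipColumn (h : TightFamily N X X' 𝓦) :
    TightFamily N X X' {S | S.image flipColumn ∈ 𝓦} :=
  h.preimage latticeInvolution_flipColumn InStrip.flipColumn InStrip.flipColumn
    (fun S hS => by
      obtain ⟨y, hy⟩ := h.left_nonempty S hS
      exact ⟨X - y, by rwa [mem_image_flipColumn, sub_sub_cancel]⟩)
    (fun S hS => by
      obtain ⟨y, hy⟩ := h.right_nonempty S hS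
      exact ⟨X' - y, by rwa [mem_image_flipColumn, sub_sub_cancel]⟩)

theorem neg (h : TightFamily N X X' 𝓦) :
    TightFamily N (-X') (-X) {S | S.image (fun c => -c) ∈ 𝓦} :=
  h.preimage latticeInvolution_neg InStrip.neg (fun h => by simpa only [neg_neg] using h.neg)
    (fun S hS => by
      obtain ⟨y, hy⟩ := h.right_nonempty S hS
      exact ⟨-y, by rwa [mem_image_neg, neg_neg, neg_neg]⟩)
    (fun S hS => by
      obtain ⟨y, hy⟩ := h.left_nonempty S hS
      exact ⟨-y, by rwa [mem_image_neg, neg_neg, neg_neg]⟩)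

/-- Otherwise minimise the column among members lying above height `X` there. The food can block the
removal of the lowest particle of the topmost run only at height `X`, so this particle can be traded
for higher ones. -/
theorem exists_left_low (h : TightFamily N X X' 𝓦) (hN : 2 ≤ N) (hS : S ∈ 𝓦) :
    ∃ y ≤ X, (X, y) ∈ S := by
  rcases h.zero_mem_Icc.1.eq_or_lt with h0 | h0
  · exact ⟨0, h0.ge, mem_of_eq (h.conf S hS).zero_mem h0 rfl⟩
  by_contra! hlow
  obtain ⟨T, ⟨hT, hTlow⟩, hmin⟩ := Set.exists_min_image {T ∈ 𝓦 | ∀ y ≤ X, (X, y) ∉ T}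
    (columnKey rankLow X) (h.finite.subset fun T hT => hT.1) ⟨S, hS, hlow⟩
  obtain ⟨y, hy⟩ := h.left_nonempty T hT
  obtain ⟨b, hb, hbmax⟩ := exists_column_max hy
  obtain ⟨a, hab, hrun, ha⟩ := exists_run_down hb
  have haX : X < a := by
    by_contra hle
    exact hTlow a (not_lt.1 hle) (hrun a le_rfl hab)
  obtain ⟨U, hU⟩ := (h.conf T hT).exists_raised hN (h.strip T hT) hab hrun ha hbmax
    (by simp only [ne_eq, Prod.mk_eq_zero]; omega) (by omega) (fun h => by omega)
  have hUW := h.closed T hT U hU.reach hU.strip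
  refine (hmin U ⟨hUW, fun y hy hyU => ?_⟩).not_gt ?_
  · rcases hU.column y hyU with h | h
    exacts [hTlow y hy h, by omega]
  · refine columnKey_lt rankLow_injective (hrun a le_rfl hab) hU.notMem fun y hy => ?_
    refine (hU.column y hy).imp_right fun h => rankLow_lt.2 (by omega)

theorem exists_left_high (h : TightFamily N X X' 𝓦) (hN : 2 ≤ N) (hS : S ∈ 𝓦) :
    ∃ y, 0 ≤ y ∧ (X, y) ∈ S := by
  obtain ⟨y, hy, hyS⟩ := h.flipColumn.exists_left_low (S := S.image _root_.flipColumn) hN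
    (by rwa [Set.mem_ofPred_eq, latticeInvolution_flipColumn.image_image])
  exact ⟨X - y, by omega, mem_image_flipColumn.1 hyS⟩

theorem exists_right_high (h : TightFamily N X X' 𝓦) (hN : 2 ≤ N) (hS : S ∈ 𝓦) :
    ∃ y, X' ≤ y ∧ (X', y) ∈ S := by
  obtain ⟨y, hy, hyS⟩ := h.neg.exists_left_low (S := S.image fun c => -c) hN
    (by rwa [Set.mem_ofPred_eq, latticeInvolution_neg.image_image])
  exact ⟨-y, by omega, by rwa [mem_image_neg, neg_neg] at hyS⟩

theorem exists_right_low (h : TightFamily N X X' 𝓦) (hN : 2 ≤ N) (hS : S ∈ 𝓦) :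
    ∃ y ≤ 0, (X', y) ∈ S := by
  obtain ⟨y, hy, hyS⟩ := h.neg.exists_left_high (S := S.image fun c => -c) hN
    (by rwa [Set.mem_ofPred_eq, latticeInvolution_neg.image_image])
  exact ⟨-y, by omega, by rwa [mem_image_neg, neg_neg] at hyS⟩

/-- The configurations whose leftmost column is minimal. -/
def IsLeftMin (X : ℤ) (𝓦 : Set (Finset (ℤ × ℤ))) (S : Finset (ℤ × ℤ)) : Prop :=
  S ∈ 𝓦 ∧ ∀ T ∈ 𝓦, columnKey (rankNear X) X S ≤ columnKey (rankNear X) X T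

/-- The disjunction spells out when `rankNear X` ranks a gained height below the lost one. -/
theorem IsLeftMin.not_improvable (hS : IsLeftMin X 𝓦 S) (hT : T ∈ 𝓦) {a : ℤ} (ha : (X, a) ∈ S)
    (ha' : (X, a) ∉ T) (h : ∀ y, (X, y) ∈ T → (X, y) ∈ S ∨ (a ≤ X ∧ (y < a ∨ X < y)) ∨
      (X < a ∧ a < y)) : False :=
  (hS.2 T hT).not_gt (columnKey_lt (rankNear_injective X) ha ha' fun y hy =>
    (h y hy).imp_right rankNear_lt.2)

theorem IsLeftMin.mem_iff (hS : IsLeftMin X 𝓦 S) (hT : T ∈ 𝓦) (h : ColumnLE X T S) (y : ℤ) :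
    (X, y) ∈ T ↔ (X, y) ∈ S :=
  ⟨h y, fun hy => by_contra fun hy' => hS.not_improvable hT hy hy' fun z hz => Or.inl (h z hz)⟩

theorem IsLeftMin.of_columnLE (hS : IsLeftMin X 𝓦 S) (hT : T ∈ 𝓦) (h : ColumnLE X T S) :
    IsLeftMin X 𝓦 T := by
  have : columnKey (rankNear X) X T = columnKey (rankNear X) X S := by
    unfold columnKey
    congr 2
    ext c
    simp only [Finset.mem_filter]
    refine and_congr_left fun hc => ?_
    have := hS.mem_iff hT h c.2
    rwa [← hc] at this
  exact ⟨hT, fun U hU => this ▸ hS.2 U hU⟩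

theorem exists_isLeftMin (h : TightFamily N X X' 𝓦) : ∃ S, IsLeftMin X 𝓦 S := by
  obtain ⟨S, hS, hmin⟩ := Set.exists_min_image 𝓦 (columnKey (rankNear X) X) h.finite h.nonempty
  exact ⟨S, hS, hmin⟩

/-- By minimality, removing the lowest particle of the topmost run must fail. Only the food can
cause this, so the run starts at height `X`. The lowest run must reach up to `X`, since otherwise
its top could be removed, so the two runs are one. -/
theorem left_column (h : TightFamily N X X' 𝓦) (hN : 2 ≤ N) (hS : IsLeftMin X 𝓦 S) :
    ∃ b, 0 ≤ b ∧ (∀ y, (X, y) ∈ S ↔ X ≤ y ∧ y ≤ b) ∧ (-1, 0) ∉ S ∧ (-1, -1) ∉ S ∧ (0, -1) ∉ S := by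
  have hX := h.zero_mem_Icc.1
  have hlt : ∀ {u v : ℤ}, u < X → (u, v) ∉ S := fun hu hc => by
    have := h.strip S hS.1 _ _ hc
    omega
  obtain ⟨y₁, hy₁, hy₁S⟩ := h.exists_left_high hN hS.1
  obtain ⟨y₂, hy₂, hy₂S⟩ := h.exists_left_low hN hS.1
  obtain ⟨b, hb, hbmax⟩ := exists_column_max hy₁S
  obtain ⟨a, hab, hrun, ha⟩ := exists_run_down hb
  obtain ⟨a', ha', hamin⟩ := exists_column_min hy₂S
  obtain ⟨t, hat, hrun', ht⟩ := exists_run_up ha'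
  have hb0 : 0 ≤ b := by
    by_contra hlt
    exact hbmax y₁ (by omega) hy₁S
  have ha'X : a' ≤ X := by
    by_contra hlt
    exact hamin y₂ (by omega) hy₂S
  have hblock : a = X ∧ (-1, 0) ∉ S ∧ (-1, -1) ∉ S ∧ (0, -1) ∉ S := by
    by_contra hf
    obtain ⟨U, hU⟩ := (h.conf S hS.1).exists_raised hN (h.strip S hS.1) hab hrun ha hbmax
      -- If the particle is the food itself, then `X = 0`, and the three sites are empty because
      -- they lie outside the strip or just below the run.
      (fun h0 => by
        rw [Prod.mk_eq_zero] at h0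
        refine hf ⟨by omega, hlt (by omega), hlt (by omega), fun h => ha ?_⟩
        exact mem_of_eq h (by omega) (by omega)) (by omega) hf
    refine hS.not_improvable (h.closed S hS.1 U hU.reach hU.strip) (hrun a le_rfl hab) hU.notMem
      fun y hy => (hU.column y hy).imp_right fun h => ?_
    omega
  obtain ⟨rfl, hf⟩ := hblock
  have htX : a ≤ t := by
    by_contra htX
    obtain ⟨U, h1, h2, h3, h4⟩ := (h.conf S hS.1).exists_remove_left_top hN (h.strip S hS.1)
      hat hrun' ht hamin (by omega) (by omega)
    exact hS.not_improvable (h.closed S hS.1 U h1 h2) (hrun' t hat le_rfl) h3 fun y hy =>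
      (h4 y hy).imp_right fun h => by omega
  have haa' : a' = a := by
    by_contra hne
    exact ha (hrun' _ (by omega) (by omega))
  subst haa'
  refine ⟨b, hb0, fun y => ⟨fun hy => ⟨?_, ?_⟩, fun hy => hrun y hy.1 hy.2⟩, hf⟩
  · by_contra hlt
    exact hamin y (by omega) hy
  · by_contra hlt
    exact hbmax y (by omega) hy

/-- The shoulder of the leftmost column can be pushed up. -/
theorem IsLeftMin.not_shoulder (hS : IsLeftMin X 𝓦 S) (h : TightFamily N X X' 𝓦) (hN : 2 ≤ N)
    {b : ℤ} (hb : 0 < b) (hcol : ∀ y, (X, y) ∈ S ↔ X ≤ y ∧ y ≤ b) (h1 : (X + 1, b + 1) ∈ S)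
    (h2 : (X + 1, b) ∉ S) : False := by
  have hX := h.zero_mem_Icc.1
  have hlt : ∀ {S}, S ∈ 𝓦 → ∀ {u v : ℤ}, u < X → (u, v) ∉ S := fun hS u v hu hc => by
    have := h.strip _ hS _ _ hc
    omega
  -- Upside down, the top of the column is a corner with right neighbour `(X + 1, b + 1)`; `0 < b`
  -- keeps it off the diagonal of the food. By minimality it cannot leave the column, so `(X + 1,
  -- b)` gets filled.
  have hSs := (h.strip S hS.1).flipColumn
  obtain ⟨T, hT1, hT2, hT3⟩ :=
    (latticeInvolution_flipColumn.planeConf (h.conf S hS.1)).exists_diagShift hN (X' + 1 - X).toNat X (X - b) (fun u v huv => by have := hSs u v huv; omega)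
    (by rw [mem_image_flipColumn, sub_sub_cancel, hcol]; omega)
    (by simp only [ne_eq, Prod.mk_eq_zero]; omega)
    (Or.inl (by rw [mem_image_flipColumn, hcol]; omega))
    (by rw [mem_image_flipColumn]; exact mem_of_eq h1 rfl (by ring))
    (fun h' => by have := hSs _ _ h'; omega) (fun h' => by have := hSs _ _ h'; omega)
    (by rw [mem_image_flipColumn, hcol]; omega)
    (by rw [mem_image_flipColumn]; exact fun h' => h2 (mem_of_eq h' rfl (by ring)))
    (fun h' => by omega)
  have hTstrip : InStrip X X' T := fun u v huv => by
    by_cases hc : (u, v) ∈ S.image _root_.flipColumn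
    · exact hSs u v hc
    · exact hSs u _ (hT2.added u v huv hc).2.2.2.1
  set W := T.image _root_.flipColumn with hW
  have hSW : PlaneReach S W := latticeInvolution_flipColumn.planeReach_left hT1
  have hWW : W ∈ 𝓦 := h.closed S hS.1 W hSW hTstrip.flipColumn
  have hle : ColumnLE X W S := fun y hy => by
    rw [hW, mem_image_flipColumn] at hy
    by_contra hc
    have := hT2.added X _ hy (by rwa [mem_image_flipColumn, sub_sub_cancel])
    omega
  have hcolW : ∀ y, (X, y) ∈ W ↔ X ≤ y ∧ y ≤ b := fun y => (hS.mem_iff hWW hle y).trans (hcol y)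
  have hlW : ∀ v, (X - 1, v) ∉ W := fun v => hlt hWW (by omega)
  have hru : (X + 1, b + 1) ∈ W := by
    rw [hW, mem_image_flipColumn, hT2.off (by omega), mem_image_flipColumn]
    exact mem_of_eq h1 rfl (by ring)
  have hr : (X + 1, b) ∈ W := by
    rcases hT3 with hT3 | hT3
    · exact absurd ((hcolW b).2 ⟨by omega, le_rfl⟩) (by rwa [hW, mem_image_flipColumn])
    · rw [hW, mem_image_flipColumn]
      exact mem_of_eq hT3.2 rfl (by ring)
  -- Now the top particle can move up. Beyond `X`, greater heights rank lower, so this improves the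
  -- column.
  have hstep : PlaneStep W (insert (X, b + 1) (W.erase (X, b))) := by
    refine planeStep_up ((hcolW b).2 ⟨by omega, le_rfl⟩)
      (by simp only [ne_eq, Prod.mk_eq_zero]; omega)
      (by rw [hcolW]; omega) ?_
    have e1 : (X, b - 1) ∈ W := (hcolW _).2 (by omega)
    have e2 : (X, b + 2) ∉ W := fun h => by rw [hcolW] at h; omega
    simp only [RingOK, hlW, hru, hr, e1, e2]
    tauto
  have hst : InStrip X X' (insert (X, b + 1) (W.erase (X, b))) := fun u v huv => by
    rw [Finset.mem_insert, Finset.mem_erase] at huv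
    rcases huv with huv | huv
    · rw [Prod.mk.injEq] at huv
      have := h.zero_mem_Icc
      omega
    · exact h.strip W hWW u v huv.2
  refine hS.not_improvable (h.closed W hWW _ (.single hstep) hst)
    ((hcol b).2 ⟨by omega, le_rfl⟩) (by simp) fun y hy => ?_
  simp only [Finset.mem_insert, Finset.mem_erase, Prod.mk.injEq, true_and] at hy
  rcases hy with rfl | hy
  · exact Or.inr (by omega)
  · exact Or.inl ((hcol y).2 ((hcolW y).1 hy.2))

/-- The left column is minimised first, the right column second. The removals at the right must then
disturb the left column: the first of them forces a gap at height `X'` in the right column, and the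
second produces a shoulder at the top of the left one. -/
theorem right_eq_zero (h : TightFamily N X X' 𝓦) (hN : 2 ≤ N) : X' = 0 := by
  have hX := h.zero_mem_Icc
  by_contra hX'
  obtain ⟨S₀, hS₀⟩ := h.exists_isLeftMin
  obtain ⟨S, hS, hmin⟩ := Set.exists_min_image {S | IsLeftMin X 𝓦 S}
    (columnKey (fun y => rankNear (-X') (-y)) X') (h.finite.subset fun S hS => hS.1) ⟨S₀, hS₀⟩
  obtain ⟨b, hb0, hcol, hl, hld, hd⟩ := h.left_column hN hS
  have hinj : Function.Injective fun y => rankNear (-X') (-y) :=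
    (rankNear_injective _).comp neg_injective
  have himp : ∀ {T a}, PlaneReach S T → InStrip X X' T → ColumnLE X T S → (X', a) ∈ S →
      (X', a) ∉ T → (∀ y, (X', y) ∈ T → (X', y) ∈ S ∨
        (X' ≤ a ∧ (a < y ∨ y < X')) ∨ (a < X' ∧ y < a)) → False := by
    intro T a h1 h2 h3 h4 h5 h6
    have hT := hS.of_columnLE (h.closed S hS.1 T h1 h2) h3
    refine (hmin T hT).not_gt (columnKey_lt hinj h4 h5 fun y hy => (h6 y hy).imp_right fun h => ?_)
    rw [rankNear_lt]
    omega
  obtain ⟨y₁, hy₁, hy₁S⟩ := h.exists_right_low hN hS.1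
  obtain ⟨y₂, hy₂, hy₂S⟩ := h.exists_right_high hN hS.1
  obtain ⟨u, hu, humin⟩ := exists_column_min hy₁S
  obtain ⟨t, hut, hrun, ht⟩ := exists_run_up hu
  obtain ⟨b₂, hb₂, hb₂max⟩ := exists_column_max hy₂S
  obtain ⟨a₂, hab₂, hrun₂, ha₂⟩ := exists_run_down hb₂
  have hu0 : u ≤ 0 := by
    by_contra hlt
    exact humin y₁ (by omega) hy₁S
  have hb₂X : X' ≤ b₂ := by
    by_contra hlt
    exact hb₂max y₂ (by omega) hy₂S
  -- The food cannot block here: its three lower neighbours are empty, so with the three upper ones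
  -- empty it would be isolated.
  have htX : t + 1 = X' := by
    obtain ⟨T, h1, h2, h3, h4, h5⟩ := (h.conf S hS.1).exists_remove_right_top hN (h.strip S hS.1)
      (by omega) hut hrun ht humin hX' (by omega) (fun hf => by
        have := (h.conf S hS.1).nbr_cases hN (x := 0) (y := 0) (h.conf S hS.1).zero_mem
        simp only [zero_add, zero_sub] at this
        tauto)
    rcases h5 with h5 | ⟨U, y, g1, g2, g3, g4, g5, g6⟩
    · exact (himp h1 h2 h5 (hrun t hut le_rfl) h3 fun y hy =>
        (h4 y hy).imp_right fun h => by omega).elim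
    · have hc := hS.mem_iff (h.closed S hS.1 U g1 g2) g3
      -- The jam sits at the lower end of the left column, so `y = X`; together with `u ≤ 0 < X'`
      -- this leaves only `t + 1 = X'`.
      rw [hc, hcol] at g5 g6
      omega
  have ha₂X : X' < a₂ := by
    by_contra hle
    exact ht (htX ▸ hrun₂ X' (by omega) hb₂X)
  obtain ⟨T, h1, h2, h3, h4, h5⟩ := (h.conf S hS.1).exists_remove_right_bottom hN (h.strip S hS.1)
    (by omega) hab₂ hrun₂ ha₂ hb₂max (by omega) (by omega)
  rcases h5 with h5 | ⟨U, y, g1, g2, g3, g4, g5, g6, g7, g8⟩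
  · exact himp h1 h2 h5 (hrun₂ a₂ le_rfl hab₂) h3 fun y hy =>
      (h4 y hy).imp_right fun h => by omega
  · have hU := h.closed S hS.1 U g1 g2
    have hc := fun y => (hS.mem_iff hU g3 y).trans (hcol y)
    -- This time the jam sits at the upper end of the left column.
    have hy : y = b + 1 := by
      rw [hc] at g6 g7
      omega
    subst hy
    refine (hS.of_columnLE hU g3).not_shoulder h hN (by omega) hc g5 ?_
    rwa [add_sub_cancel_right] at g8

end TightFamily

/-- A strip of least width over all reachable configurations; an empty border column would allow a
narrower one. -/
theorem PlaneConf.exists_tightFamily {N : ℕ} {S : Finset (ℤ × ℤ)} (hS : PlaneConf N S) :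
    ∃ X X' 𝓦, TightFamily N X X' 𝓦 ∧ ∀ T ∈ 𝓦, PlaneReach S T := by
  classical
  have hex : ∃ w : ℕ, ∃ T X X', PlaneReach S T ∧ InStrip X X' T ∧ (X' - X).toNat = w := by
    obtain ⟨c, hc, hmax⟩ := S.exists_max_image (fun c => c.1) ⟨0, hS.zero_mem⟩
    obtain ⟨d, hd, hmin⟩ := S.exists_min_image (fun c => c.1) ⟨0, hS.zero_mem⟩
    exact ⟨_, S, d.1, c.1, .refl, fun u v h => ⟨hmin _ h, hmax _ h⟩, rfl⟩
  obtain ⟨T, X, X', hST, hT, hw⟩ := Nat.find_spec hex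
  have hno : ∀ {U Y Y'}, PlaneReach S U → InStrip Y Y' U → ¬ (Y' - Y).toNat < (X' - X).toNat :=
    fun h1 h2 h3 => Nat.find_min hex (hw ▸ h3) ⟨_, _, _, h1, h2, rfl⟩
  refine ⟨X, X', {U | PlaneReach S U ∧ InStrip X X' U}, ⟨fun U hU => hS.reach hU.1,
    fun U hU => hU.2, fun U hU V hUV hV => ⟨hU.1.trans hUV, hV⟩, fun U hU => ?_, fun U hU => ?_,
    ⟨T, hST, hT⟩⟩, fun U hU => hU.1⟩
  · by_contra! hne
    have h' : InStrip (X + 1) X' U := fun u v huv => by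
      have := hU.2 u v huv
      have : u ≠ X := fun h => hne v (h ▸ huv)
      omega
    -- The origin lies in the narrower strip, so the truncation in `toNat` is harmless and the width
    -- really drops.
    have := h' 0 0 (hS.reach hU.1).zero_mem
    exact hno hU.1 h' (by omega)
  · by_contra! hne
    have h' : InStrip X (X' - 1) U := fun u v huv => by
      have := hU.2 u v huv
      have : u ≠ X' := fun h => hne v (h ▸ huv)
      omega
    have := h' 0 0 (hS.reach hU.1).zero_mem
    exact hno hU.1 h' (by omega)

/-- The straight line of `N` particles in the column of the food particle. -/
def planeLine (N : ℕ) : Finset (ℤ × ℤ) := (Finset.range N).image fun k : ℕ => (0, (k : ℤ))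

theorem PlaneConf.reach_planeLine {N : ℕ} {S : Finset (ℤ × ℤ)} (hS : PlaneConf N S) (hN : 2 ≤ N) :
    PlaneReach S (planeLine N) := by
  obtain ⟨X, X', 𝓦, h, hreach⟩ := hS.exists_tightFamily
  have hX' := h.right_eq_zero hN
  have hX := h.neg.right_eq_zero hN
  rw [neg_eq_zero] at hX
  subst hX hX'
  obtain ⟨T, hT⟩ := h.exists_isLeftMin
  obtain ⟨b, hb, hcol, -⟩ := h.left_column hN hT
  have hTe : T = planeLine (b + 1).toNat := by
    ext ⟨u, v⟩
    simp only [planeLine, Finset.mem_image, Finset.mem_range, Prod.mk.injEq]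
    constructor
    · intro huv
      have hu := h.strip T hT.1 u v huv
      obtain rfl : u = 0 := by omega
      have := (hcol v).1 huv
      exact ⟨v.toNat, by omega, rfl, by omega⟩
    · rintro ⟨k, hk, rfl, rfl⟩
      exact (hcol _).2 (by omega)
  have hcard := (h.conf T hT.1).card_eq
  have : (planeLine (b + 1).toNat).card = (b + 1).toNat := by
    rw [planeLine, Finset.card_image_of_injective _ fun i j h => by simpa using h,
      Finset.card_range]
  rw [hTe, this] at hcard
  rw [← hcard, ← hTe]
  exact hreach T hT.1

/-! ### From the infinite to the periodic lattice -/

section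
variable {L : ℕ}

theorem toSite_add (u v : ℤ × ℤ) : toSite L (u + v) = toSite L u + toSite L v := by
  simp [toSite]

theorem toSite_triDir (i : Fin 6) : toSite L (triDir ℤ i) = triDir (ZMod L) i :=
  (triDir_cast i).symm

theorem toSite_surjective : Function.Surjective (toSite L) := fun u => by
  obtain ⟨x, hx⟩ := ZMod.intCast_surjective u.1
  obtain ⟨y, hy⟩ := ZMod.intCast_surjective u.2
  exact ⟨(x, y), Prod.ext hx hy⟩

theorem intCast_eq_of_abs_lt {a b : ℤ} (h : (a : ZMod L) = b) (hab : |a - b| < L) : a = b := by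
  rw [ZMod.intCast_eq_intCast_iff_dvd_sub] at h
  have := Int.eq_zero_of_abs_lt_dvd h (by rwa [abs_sub_comm])
  omega

theorem toSite_eq_of_abs_lt {u v : ℤ × ℤ} (h : toSite L u = toSite L v) (h1 : |u.1 - v.1| < L)
    (h2 : |u.2 - v.2| < L) : u = v := by
  rw [Prod.ext_iff] at h
  exact Prod.ext (intCast_eq_of_abs_lt h.1 h1) (intCast_eq_of_abs_lt h.2 h2)

theorem noShortLoops_zmod (hL : 4 ≤ L) : NoShortLoops (ZMod L) := fun z hz h =>
  intCast_eq_of_abs_lt (L := L) (by simpa using h) (by rw [sub_zero]; omega)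

/-- The projection of the infinite lattice that takes the origin to the food particle. -/
def siteAt (food : Site L) (v : ℤ × ℤ) : Site L := food + toSite L v

variable {food : Site L}

theorem siteAt_zero : siteAt food 0 = food := by simp [siteAt, toSite]

theorem siteAt_add_triDir (v : ℤ × ℤ) (i : Fin 6) :
    siteAt food (v + triDir ℤ i) = siteAt food v + triDir (ZMod L) i := by
  rw [siteAt, siteAt, toSite_add, toSite_triDir, add_assoc]

theorem siteAt_eq_of_abs_lt {u v : ℤ × ℤ} (h : siteAt food u = siteAt food v)
    (h1 : |u.1 - v.1| < L) (h2 : |u.2 - v.2| < L) : u = v :=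
  toSite_eq_of_abs_lt (add_left_cancel h) h1 h2

theorem PlaneConf.spread_lt {N : ℕ} {S : Finset (ℤ × ℤ)} (hS : PlaneConf N S) {u v : ℤ × ℤ}
    (hu : u ∈ S) (hv : v ∈ S) : |u.1 - v.1| < N ∧ |u.2 - v.2| < N := by
  have h1 := lt_add_card_of_connected hS.connected _ (fun _ _ => triLattice_adj_fst) hu hv
  have h2 := lt_add_card_of_connected hS.connected _ (fun _ _ => triLattice_adj_fst) hv hu
  have h3 := lt_add_card_of_connected hS.connected _ (fun _ _ => triLattice_adj_snd) hu hv
  have h4 := lt_add_card_of_connected hS.connected _ (fun _ _ => triLattice_adj_snd) hv hu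
  rw [hS.card_eq] at h1 h2 h3 h4
  simp only [abs_lt]
  omega

theorem PlaneConf.siteAt_injOn {N : ℕ} {S : Finset (ℤ × ℤ)} (hS : PlaneConf N S) (hN : N ≤ L) :
    Set.InjOn (siteAt food) S := fun u hu v hv h => by
  have := hS.spread_lt hu hv
  exact siteAt_eq_of_abs_lt h (by omega) (by omega)

theorem abs_triDir_le (i : Fin 6) : |(triDir ℤ i).1| ≤ 1 ∧ |(triDir ℤ i).2| ≤ 1 := by
  fin_cases i <;> simp [triDir]

/-- Particles are less than `N` apart in each coordinate, so a particle and a neighbour of another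
one differ by less than `L`. -/
theorem PlaneConf.siteAt_mem_iff {N : ℕ} {S : Finset (ℤ × ℤ)} (hS : PlaneConf N S) (hN : N < L)
    {l : ℤ × ℤ} (hl : l ∈ S) (i : Fin 6) :
    siteAt food (l + triDir ℤ i) ∈ S.image (siteAt food) ↔ l + triDir ℤ i ∈ S := by
  refine ⟨fun h => ?_, Finset.mem_image_of_mem _⟩
  obtain ⟨c, hc, h⟩ := Finset.mem_image.1 h
  have h1 := hS.spread_lt hc hl
  have h2 := abs_triDir_le i
  rwa [← siteAt_eq_of_abs_lt h]
  all_goals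
    simp only [Prod.fst_add, Prod.snd_add, abs_lt, abs_le] at *
    omega

theorem image_insert_erase_siteAt {S : Finset (ℤ × ℤ)} (hS : Set.InjOn (siteAt food) S)
    {l l' : ℤ × ℤ} (hl : l ∈ S) : (insert l' (S.erase l)).image (siteAt food) =
      moveParticle (S.image (siteAt food)) (siteAt food l) (siteAt food l') := by
  rw [moveParticle, Finset.image_insert]
  congr 1
  ext u
  simp only [Finset.mem_image, Finset.mem_erase]
  constructor
  · rintro ⟨c, ⟨hcl, hc⟩, rfl⟩
    exact ⟨fun h => hcl (hS hc hl h), c, hc, rfl⟩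
  · rintro ⟨hne, c, hc, rfl⟩
    exact ⟨c, ⟨fun h => hne (by rw [h]), hc⟩, rfl⟩

theorem PlaneStep.compressionStep {N : ℕ} {S S' : Finset (ℤ × ℤ)} (h : PlaneStep S S')
    (hS : PlaneConf N S) (hN : N < L) (hL : 4 ≤ L) :
    CompressionStep food (S.image (siteAt food)) (S'.image (siteAt food)) := by
  have hS' := hS.step h
  obtain ⟨l, i, hl, hl0, hl', hok, rfl⟩ := h
  have hR := noShortLoops_zmod hL
  have hmem := fun k => hS.siteAt_mem_iff (food := food) hN hl k
  -- These sites are two steps from `l`, too far for the spread of `S`. The spread of the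
  -- configuration after the move, which contains `l + triDir ℤ i`, gives the bound for `c ≠ l`.
  have hmem' : ∀ k, siteAt food (l + triDir ℤ i + triDir ℤ k) ∈ S.image (siteAt food) ↔
      l + triDir ℤ i + triDir ℤ k ∈ S := by
    intro k
    refine ⟨fun h => ?_, Finset.mem_image_of_mem _⟩
    obtain ⟨c, hc, h⟩ := Finset.mem_image.1 h
    have hi := abs_triDir_le i
    have hk := abs_triDir_le k
    by_cases hcl : c = l
    · subst hcl
      rwa [← siteAt_eq_of_abs_lt h]
      all_goals
        simp only [Prod.fst_add, Prod.snd_add, abs_lt, abs_le] at *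
        omega
    · have h1 := hS'.spread_lt (u := c) (v := l + triDir ℤ i)
        (Finset.mem_insert_of_mem (Finset.mem_erase.2 ⟨hcl, hc⟩)) (Finset.mem_insert_self _ _)
      rwa [← siteAt_eq_of_abs_lt h]
      all_goals
        simp only [Prod.fst_add, Prod.snd_add, abs_lt, abs_le] at *
        omega
  have hnot : siteAt food l + triDir (ZMod L) i ∉ S.image (siteAt food) := by
    rwa [← siteAt_add_triDir, hmem]
  have hok' : MoveOK (S.image (siteAt food) : Set (Site L)) (siteAt food l) i := by
    unfold MoveOK at hok ⊢
    simp only [Finset.mem_coe, ← siteAt_add_triDir, hmem, hmem'] at hok ⊢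
    exact hok
  refine ⟨siteAt food l, siteAt food l + triDir (ZMod L) i, isValidMove_iff.2
    ⟨Finset.mem_image_of_mem _ hl, fun h => hl0 ?_, hnot, hR.adj_iff.2 ⟨i, rfl⟩,
      hok'.locallyConnectedMove hR hnot, hok'.ncard_lt hR hnot⟩, ?_⟩
  · exact hS.siteAt_injOn (food := food) hN.le hl hS.zero_mem (by rw [h, siteAt_zero])
  · rw [image_insert_erase_siteAt (hS.siteAt_injOn hN.le) hl, siteAt_add_triDir]

theorem PlaneReach.compression {N : ℕ} {S S' : Finset (ℤ × ℤ)} (h : PlaneReach S S')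
    (hS : PlaneConf N S) (hN : N < L) (hL : 4 ≤ L) :
    Relation.ReflTransGen (CompressionStep food) (S.image (siteAt food))
      (S'.image (siteAt food)) := by
  induction h with
  | refl => exact .refl
  | tail h1 h2 ih => exact ih.tail (h2.compressionStep (hS.reach h1) hN hL)

end

/-! ### Lifting configurations from the torus to the plane. -/

theorem exists_adj_boundary {V : Type} {G : SimpleGraph V} {A B : Set V}
    (hA : (G.induce A).Connected) (hBA : B ⊆ A) (hB : B.Nonempty) (hne : B ≠ A) :
    ∃ u ∈ B, ∃ w ∈ A, w ∉ B ∧ G.Adj u w := by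
  by_contra! hcon
  obtain ⟨b, hb⟩ := hB
  refine hne (hBA.antisymm fun a ha => ?_)
  exact ((induce_connected_iff.1 hA).2 b (hBA hb) a ha).induction_tail (P := fun u => u ∈ B) hb
    fun x y hy hxy _ hx => by_contra fun hyB => hcon x hx y hy hyB hxy

theorem induce_insert_connected {V : Type} {G : SimpleGraph V} {A : Set V} {u v : V}
    (hA : (G.induce A).Connected) (hu : u ∈ A) (h : G.Adj u v) :
    (G.induce (insert v A)).Connected := by
  have hsub := Set.subset_insert v A
  refine induce_connected_of_base (hsub hu) ?_
  rintro w (rfl | hw)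
  · exact .of_adj (Set.mem_insert _ _) (hsub hu) h.symm
  · exact ((induce_connected_iff.1 hA).2 w hw u hu).mono hsub

section
variable {L : ℕ} {food : Site L} {n : ℕ}

/-- The lift grows by one site at a time, along an edge leaving the part of `s` already covered. It
need not realise the adjacencies of `s` that wrap around the torus. -/
theorem IsConnectedConfig.exists_planeConf {s : Finset (Site L)} (hs : IsConnectedConfig food n s) :
    ∃ S, PlaneConf (n + 1) S ∧ S.image (siteAt food) = s := by
  have key : ∀ k ≤ n, ∃ S, PlaneConf (k + 1) S ∧ S.image (siteAt food) ⊆ s ∧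
      Set.InjOn (siteAt food) S := by
    intro k hk
    induction k with
    | zero =>
      refine ⟨{0}, ⟨by simp, by simp, ?_⟩, by simpa [siteAt_zero] using hs.food_mem, by simp⟩
      refine induce_connected_of_base (a := 0) (by simp) fun u hu => ?_
      obtain rfl : u = 0 := by simpa using hu
      exact .refl hu
    | succ k ih =>
      obtain ⟨S, hS, hSs, hinj⟩ := ih (by omega)
      obtain ⟨u, hu, w, hw, hwS, huw⟩ := exists_adj_boundary hs.connected
        (B := (S.image (siteAt food) : Finset (Site L))) (Finset.coe_subset.2 hSs)
        ⟨_, Finset.mem_coe.2 (Finset.mem_image_of_mem _ hS.zero_mem)⟩ (fun h => by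
          have h' := hs.card_eq
          rw [← Finset.coe_inj.1 h, Finset.card_image_of_injOn hinj, hS.card_eq] at h'
          omega)
      obtain ⟨c, hc, rfl⟩ := Finset.mem_image.1 (Finset.mem_coe.1 hu)
      obtain ⟨-, i, rfl⟩ := huw
      rw [← siteAt_add_triDir] at hw hwS
      have hcS : c + triDir ℤ i ∉ S := fun h => hwS (Finset.mem_coe.2 (Finset.mem_image_of_mem _ h))
      refine ⟨insert (c + triDir ℤ i) S, ⟨Finset.mem_insert_of_mem hS.zero_mem, ?_, ?_⟩, ?_, ?_⟩
      · rw [Finset.card_insert_of_notMem hcS, hS.card_eq]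
      · rw [Finset.coe_insert]
        exact induce_insert_connected hS.connected hc (noShortLoops_int.adj_iff.2 ⟨i, rfl⟩)
      · rw [Finset.image_insert]
        exact Finset.insert_subset hw hSs
      · rw [Finset.coe_insert, Set.injOn_insert hcS]
        refine ⟨hinj, fun h => hwS ?_⟩
        rwa [Finset.coe_image]
  obtain ⟨S, hS, hSs, hinj⟩ := key n le_rfl
  refine ⟨S, hS, Finset.eq_of_subset_of_card_le hSs ?_⟩
  rw [Finset.card_image_of_injOn hinj, hS.card_eq, hs.card_eq]

theorem LineFits.lt [NeZero L] (h : LineFits L (n + 1)) : n < L := by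
  by_contra hle
  have := (h 0 2 0 L (NeZero.pos L) (by omega)).1
  refine this ?_
  simp [triDir]
  rfl

/-- For `L = n + 1` the two ends of a vertical line would be adjacent, closing it to a ring. -/
theorem LineFits.add_two_le [NeZero L] (h : LineFits L (n + 1)) (hn : 2 ≤ n) : n + 2 ≤ L := by
  have h1 := h.lt
  by_contra hlt
  obtain rfl : L = n + 1 := by omega
  have h2 := h 0 2 0 n (by omega) (by omega)
  have : n = 0 + 1 := h2.2 ⟨h2.1, 5, by
    have : ((n : ZMod (n + 1)) + 1) = 0 := by exact_mod_cast ZMod.natCast_self (n + 1)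
    simpa [triDir] using eq_neg_of_add_eq_zero_left this⟩
  omega

theorem IsConnectedConfig.reach_line (hL : n + 2 ≤ L) (hn : 2 ≤ n) {s : Finset (Site L)}
    (hs : IsConnectedConfig food n s) : Relation.ReflTransGen (CompressionStep food) s
      ((planeLine (n + 1)).image (siteAt food)) := by
  obtain ⟨S, hS, rfl⟩ := hs.exists_planeConf
  exact (hS.reach_planeLine (by omega)).compression hS (by omega) (by omega)

end

/-! ### Finite components of the complement are encircled -/

theorem ConnectedThrough.exists_walk {V : Type} {G : SimpleGraph V} {A : Set V} {u v : V}
    (h : ConnectedThrough G A u v) : ∃ w : G.Walk u v, ∀ x ∈ w.support, x ∈ A := by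
  refine h.induction_head (P := fun u => ∃ w : G.Walk u v, ∀ x ∈ w.support, x ∈ A)
    ⟨.nil, by simpa using h.mem_right⟩ fun a b ha hab _ ⟨w, hw⟩ => ⟨.cons hab w, ?_⟩
  simpa using ⟨ha, hw⟩

theorem ConnectedThrough.component {V : Type} {G : SimpleGraph V} {A : Set V} {u v : V}
    (h : ConnectedThrough G A u v) : ConnectedThrough G {w | ConnectedThrough G A u w} u v := by
  have h0 : ConnectedThrough G A u u := .refl h.mem_left
  refine h.induction_tail (P := fun v => ConnectedThrough G {w | ConnectedThrough G A u w} u v)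
    (.refl h0) fun a b hb hab ha ih => ih.trans (.of_adj ha ?_ hab)
  exact ha.trans (.of_adj ha.mem_right hb hab)

theorem exists_closed_walk {V : Type} {G : SimpleGraph V} {K : Set V} {p : V} (hp : p ∈ K)
    (hK : ∀ u ∈ K, ConnectedThrough G K p u) (hfin : K.Finite) :
    ∃ w : G.Walk p p, ∀ x, x ∈ w.support ↔ x ∈ K := by
  classical
  suffices H : ∀ F : Finset V, (F : Set V) ⊆ K →
      ∃ w : G.Walk p p, (∀ x ∈ w.support, x ∈ K) ∧ ∀ x ∈ F, x ∈ w.support by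
    obtain ⟨w, h1, h2⟩ := H hfin.toFinset (by simp)
    exact ⟨w, fun x => ⟨h1 x, fun h => h2 x (by simpa using h)⟩⟩
  intro F
  induction F using Finset.induction_on with
  | empty => exact fun _ => ⟨.nil, by simpa using hp, by simp⟩
  | insert a F _ ih =>
    intro hF
    rw [Finset.coe_insert, Set.insert_subset_iff] at hF
    obtain ⟨w, h1, h2⟩ := ih hF.2
    obtain ⟨w', h'⟩ := (hK a hF.1).exists_walk
    refine ⟨w.append (w'.append w'.reverse), fun x hx => ?_, fun x hx => ?_⟩
    · simp only [SimpleGraph.Walk.mem_support_append_iff, SimpleGraph.Walk.support_reverse,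
        List.mem_reverse] at hx
      tauto
    · simp only [SimpleGraph.Walk.mem_support_append_iff, SimpleGraph.Walk.support_reverse,
        List.mem_reverse]
      rcases Finset.mem_insert.1 hx with rfl | hx
      · exact Or.inr (Or.inl w'.end_mem_support)
      · exact Or.inl (h2 x hx)

section
variable {C K : Set (ℤ × ℤ)}

open Classical in
/-- The indicator of the edges between `C` and `K`, modulo two. -/
noncomputable def crossing (C K : Set (ℤ × ℤ)) (u v : ℤ × ℤ) : ZMod 2 :=
  if u ∈ C ∧ v ∈ K ∨ u ∈ K ∧ v ∈ C then 1 else 0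

theorem crossing_eq_zero {u v : ℤ × ℤ} (hu : u ∉ K) (hv : v ∉ K) : crossing C K u v = 0 :=
  if_neg (by tauto)

theorem crossing_eq_zero' {u v : ℤ × ℤ} (hu : u ∉ C) (hv : v ∉ C) : crossing C K u v = 0 :=
  if_neg (by tauto)

/-- Modulo two, `crossing` is a cocycle: the third vertex of a triangle on an edge between `C` and
`K` is in `C` or `K`, so exactly two of its edges cross. -/
theorem crossing_triangle (hCK : ∀ u ∈ C, u ∉ K)
    (h : ∀ u ∈ C, ∀ v ∈ K, ∀ w, (triLattice ℤ).Adj u w → (triLattice ℤ).Adj v w → w ∈ C ∨ w ∈ K)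
    {u v w : ℤ × ℤ} (huv : (triLattice ℤ).Adj u v) (hvw : (triLattice ℤ).Adj v w)
    (huw : (triLattice ℤ).Adj u w) :
    crossing C K u w = crossing C K u v + crossing C K v w := by
  have h1 := fun a b => h u a v b w huw hvw
  have h2 := fun a b => h v a u b w hvw huw
  have h3 := fun a b => h u a w b v huv hvw.symm
  have h4 := fun a b => h w a u b v hvw.symm huv
  have h5 := fun a b => h v a w b u huv.symm huw.symm
  have h6 := fun a b => h w a v b u huw.symm huv.symm
  have c1 := hCK u
  have c2 := hCK v
  have c3 := hCK w
  have e : (1 : ZMod 2) + 1 = 0 := by decide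
  clear h hCK huv hvw huw
  unfold crossing
  by_cases u1 : u ∈ C <;> by_cases v1 : v ∈ C <;> by_cases w1 : w ∈ C <;>
  by_cases u2 : u ∈ K <;> by_cases v2 : v ∈ K <;> by_cases w2 : w ∈ K <;>
  simp_all

/-- The parity of the number of edges between `C` and `K` on the ray from `(x, y)` to the right,
up to abscissa `M`. -/
noncomputable def rayParity (C K : Set (ℤ × ℤ)) (M x y : ℤ) : ZMod 2 :=
  ∑ z ∈ Finset.Icc x M, crossing C K (z, y) (z + 1, y)

variable {M : ℤ}

theorem rayParity_eq_zero {x y : ℤ} (h : ∀ z, x ≤ z → (z, y) ∉ C) : rayParity C K M x y = 0 :=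
  Finset.sum_eq_zero fun z hz => by
    rw [Finset.mem_Icc] at hz
    exact crossing_eq_zero' (h z hz.1) (h _ (by omega))

theorem rayParity_succ (hM : ∀ u v, (u, v) ∈ C → u ≤ M) (x y : ℤ) :
    rayParity C K M x y = crossing C K (x, y) (x + 1, y) + rayParity C K M (x + 1) y := by
  by_cases hx : x ≤ M
  · have : Finset.Icc x M = insert x (Finset.Icc (x + 1) M) := by
      ext
      simp only [Finset.mem_insert, Finset.mem_Icc]
      omega
    rw [rayParity, this, Finset.sum_insert (by simp), rayParity]
  · have h : ∀ z v, x ≤ z → (z, v) ∉ C := fun z v hz hC => by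
      have := hM _ _ hC
      omega
    rw [rayParity_eq_zero fun z hz => h z _ hz, rayParity_eq_zero fun z hz => h z _ (by omega),
      crossing_eq_zero' (h _ _ le_rfl) (h _ _ (by omega)), add_zero]

theorem adj_right (x y : ℤ) : (triLattice ℤ).Adj (x, y) (x + 1, y) :=
  noShortLoops_int.adj_iff.2 ⟨0, by simp [triDir]⟩

theorem adj_ru (x y : ℤ) : (triLattice ℤ).Adj (x, y) (x + 1, y + 1) :=
  noShortLoops_int.adj_iff.2 ⟨1, by simp [triDir]⟩

theorem adj_up (x y : ℤ) : (triLattice ℤ).Adj (x, y) (x, y + 1) :=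
  noShortLoops_int.adj_iff.2 ⟨2, by simp [triDir]⟩

/-- The two triangles of each unit square carry the identity from `x + 1` to `x`, starting beyond
`M`, where everything vanishes. -/
theorem rayParity_up (hM : ∀ u v, (u, v) ∈ C → u ≤ M) (hCK : ∀ u ∈ C, u ∉ K)
    (h : ∀ u ∈ C, ∀ v ∈ K, ∀ w, (triLattice ℤ).Adj u w → (triLattice ℤ).Adj v w → w ∈ C ∨ w ∈ K)
    (x y : ℤ) :
    rayParity C K M x y = crossing C K (x, y) (x, y + 1) + rayParity C K M x (y + 1) := by
  have key : ∀ k : ℕ, ∀ x, M < x + k →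
      rayParity C K M x y = crossing C K (x, y) (x, y + 1) + rayParity C K M x (y + 1) := by
    intro k
    induction k with
    | zero =>
      intro x hx
      have h : ∀ z v, x ≤ z → (z, v) ∉ C := fun z v hz hC => by
        have := hM _ _ hC
        omega
      rw [rayParity_eq_zero fun z hz => h z _ hz, rayParity_eq_zero fun z hz => h z _ hz,
        crossing_eq_zero' (h _ _ le_rfl) (h _ _ le_rfl), add_zero]
    | succ k ih =>
      intro x hx
      rw [rayParity_succ hM x y, rayParity_succ hM x (y + 1),
        ih (x + 1) (by push_cast at hx; omega),
        ← add_assoc, ← add_assoc,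
        ← crossing_triangle hCK h (adj_right x y) (adj_up (x + 1) y) (adj_ru x y),
        ← crossing_triangle hCK h (adj_up x y) (adj_right x (y + 1)) (adj_ru x y)]
  exact key (M + 1 - x).toNat x (by omega)

/-- `rayParity` is a potential of the cocycle `crossing`, which vanishes on edges avoiding `K`. -/
theorem rayParity_adj (hM : ∀ u v, (u, v) ∈ C → u ≤ M) (hCK : ∀ u ∈ C, u ∉ K)
    (h : ∀ u ∈ C, ∀ v ∈ K, ∀ w, (triLattice ℤ).Adj u w → (triLattice ℤ).Adj v w → w ∈ C ∨ w ∈ K)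
    {u v : ℤ × ℤ} (huv : (triLattice ℤ).Adj u v) (hu : u ∉ K) (hv : v ∉ K) :
    rayParity C K M u.1 u.2 = rayParity C K M v.1 v.2 := by
  have hr := rayParity_succ (K := K) hM
  have hu' := rayParity_up hM hCK h
  have hd : ∀ x y, rayParity C K M x y =
      crossing C K (x, y) (x + 1, y + 1) + rayParity C K M (x + 1) (y + 1) := fun x y => by
    rw [hr x y, hu' (x + 1) y, ← add_assoc,
      ← crossing_triangle hCK h (adj_right x y) (adj_up (x + 1) y) (adj_ru x y)]
  have main : ∀ (x y x' y' : ℤ), (x, y) ∉ K → (x', y') ∉ K →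
      (x' = x + 1 ∧ y' = y ∨ x' = x + 1 ∧ y' = y + 1 ∨ x' = x ∧ y' = y + 1) →
      rayParity C K M x y = rayParity C K M x' y' := by
    rintro x y x' y' h1 h2 (⟨rfl, rfl⟩ | ⟨rfl, rfl⟩ | ⟨rfl, rfl⟩)
    · rw [hr, crossing_eq_zero h1 h2, zero_add]
    · rw [hd, crossing_eq_zero h1 h2, zero_add]
    · rw [hu', crossing_eq_zero h1 h2, zero_add]
  obtain ⟨x, y⟩ := u
  obtain ⟨x', y'⟩ := v
  obtain ⟨-, i, hi⟩ := huv
  have : (x' = x + 1 ∧ y' = y ∨ x' = x + 1 ∧ y' = y + 1 ∨ x' = x ∧ y' = y + 1) ∨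
      (x = x' + 1 ∧ y = y' ∨ x = x' + 1 ∧ y = y' + 1 ∨ x = x' ∧ y = y' + 1) := by
    fin_cases i <;> simp [triDir] at hi <;> omega
  rcases this with this | this
  · exact main _ _ _ _ hu hv this
  · exact (main _ _ _ _ hv hu this).symm

end

theorem finite_neighborSet (u : ℤ × ℤ) : ((triLattice ℤ).neighborSet u).Finite := by
  refine (Set.finite_range fun i => u + triDir ℤ i).subset ?_
  rintro v ⟨-, i, rfl⟩
  exact ⟨i, rfl⟩

/-- A finite component of the complement of `A` is encircled by a closed path in `A`. -/
theorem exists_encircles {A : Set (ℤ × ℤ)} {v : ℤ × ℤ} (hv : v ∉ A)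
    (hfin : {u | ConnectedThrough (triLattice ℤ) Aᶜ v u}.Finite) :
    ∃ (a : ℤ × ℤ) (c : (triLattice ℤ).Walk a a), (∀ u ∈ c.support, u ∈ A) ∧ Encircles c v := by
  set C := {u | ConnectedThrough (triLattice ℤ) Aᶜ v u} with hC
  have hvC : v ∈ C := ConnectedThrough.refl hv
  have hCA : ∀ u ∈ C, u ∉ A := fun u hu => hu.mem_right
  have hnbr : ∀ u ∈ C, ∀ w, (triLattice ℤ).Adj u w → w ∉ C → w ∈ A := fun u hu w huw hw =>
    by_contra fun hwA => hw (hu.trans (.of_adj hu.mem_right hwA huw))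
  obtain ⟨⟨x₀, y₀⟩, hp, hmax⟩ := Set.exists_max_image C (fun c => c.1) hfin ⟨v, hvC⟩
  obtain ⟨⟨x₁, y₁⟩, hp₁, hmin⟩ := Set.exists_min_image C (fun c => c.1) hfin ⟨v, hvC⟩
  obtain ⟨⟨x₂, y₂⟩, hp₂, hmax₂⟩ := Set.exists_max_image C (fun c => c.2) hfin ⟨v, hvC⟩
  obtain ⟨⟨x₃, y₃⟩, hp₃, hmin₃⟩ := Set.exists_min_image C (fun c => c.2) hfin ⟨v, hvC⟩
  simp only [Prod.forall] at hmax hmin hmax₂ hmin₃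
  -- The outer vertex boundary of `C` may be disconnected. Its component `K` through the site to the
  -- right of a rightmost site of `C` is the one that separates `C` from infinity.
  set B := {w | w ∉ C ∧ ∃ u ∈ C, (triLattice ℤ).Adj u w} with hB
  set q : ℤ × ℤ := (x₀ + 1, y₀)
  have hqB : q ∈ B := ⟨fun h => by have := hmax _ _ h; omega, _, hp, adj_right x₀ y₀⟩
  set K := {w | ConnectedThrough (triLattice ℤ) B q w} with hK
  have hqK : q ∈ K := ConnectedThrough.refl hqB
  have hKB : K ⊆ B := fun w hw => hw.mem_right
  have hBfin : B.Finite := by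
    refine (hfin.biUnion fun u _ => finite_neighborSet u).subset ?_
    rintro w ⟨-, u, hu, huw⟩
    exact Set.mem_biUnion hu huw
  have hCK : ∀ u ∈ C, u ∉ K := fun u hu hK => (hKB hK).1 hu
  have htri : ∀ u ∈ C, ∀ v ∈ K, ∀ w, (triLattice ℤ).Adj u w → (triLattice ℤ).Adj v w →
      w ∈ C ∨ w ∈ K := fun u hu z hz w huw hzw => or_iff_not_imp_left.2 fun hw =>
    ConnectedThrough.trans hz (.of_adj hz.mem_right ⟨hw, u, hu, huw⟩ hzw)
  have hM : ∀ a b, (a, b) ∈ C → a ≤ x₀ := hmax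
  have hconst : ∀ u, ConnectedThrough (triLattice ℤ) Kᶜ v u →
      rayParity C K x₀ u.1 u.2 = rayParity C K x₀ v.1 v.2 := fun u hu =>
    hu.symm.induction_head (P := fun u => rayParity C K x₀ u.1 u.2 = rayParity C K x₀ v.1 v.2) rfl
      fun a b ha hab hb ih => (rayParity_adj hM hCK htri hab ha hb.mem_left).trans ih
  -- From the rightmost site of `C` the ray meets one crossing edge, and the parity is constant on
  -- `C`.
  have hone : rayParity C K x₀ v.1 v.2 = 1 := by
    rw [← hconst (x₀, y₀) (hp.component.mono hCK), rayParity_succ hM,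
      rayParity_eq_zero fun z hz hzC => by have := hmax _ _ hzC; omega, add_zero]
    exact if_pos (Or.inl ⟨hp, hqK⟩)
  -- The parity vanishes outside the bounding box of `C`, so sites reached from `v` without meeting
  -- `K` stay in the box.
  have hbox : {u | ConnectedThrough (triLattice ℤ) Kᶜ v u} ⊆ Set.Icc x₁ x₀ ×ˢ Set.Icc y₃ y₂ := by
    rintro ⟨x, y⟩ hu
    have h1 := (hconst _ hu).trans hone
    have hne : rayParity C K x₀ x y ≠ 0 := by
      rw [h1]
      decide
    have hrow : ∀ x y, (y < y₃ ∨ y₂ < y) → rayParity C K x₀ x y = 0 := fun x y h =>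
      rayParity_eq_zero fun z _ hz => by
        have := hmax₂ _ _ hz
        have := hmin₃ _ _ hz
        omega
    have hcol : ∀ x, x < x₁ → ∀ (k : ℕ) y, y₂ < y + k → rayParity C K x₀ x y = 0 := by
      intro x hx k
      have hxC : ∀ y, (x, y) ∉ C := fun y hC => by
        have := hmin _ _ hC
        omega
      induction k with
      | zero => exact fun y hy => hrow x y (by omega)
      | succ k ih =>
        intro y hy
        rw [rayParity_up hM hCK htri, crossing_eq_zero' (hxC _) (hxC _),
          ih _ (by push_cast at hy; omega), add_zero]
    refine ⟨⟨?_, ?_⟩, ?_, ?_⟩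
    · by_contra hlt
      exact hne (hcol x (not_le.1 hlt) (y₂ + 1 - y).toNat y (by omega))
    · by_contra hlt
      refine hne (rayParity_eq_zero fun z hz hzC => ?_)
      have := hmax _ _ hzC
      simp only [not_le] at hlt
      omega
    · by_contra hlt
      exact hne (hrow _ _ (Or.inl (not_le.1 hlt)))
    · by_contra hlt
      exact hne (hrow _ _ (Or.inr (not_le.1 hlt)))
  obtain ⟨w, hw⟩ := exists_closed_walk hqK (fun u hu => hu.component) (hBfin.subset hKB)
  refine ⟨q, w, fun u hu => ?_, fun h => hCK v hvC ((hw v).1 h), ?_⟩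
  · obtain ⟨h1, z, hz, hzu⟩ := hKB ((hw u).1 hu)
    exact hnbr z hz u hzu h1
  · have : {u | u ∉ w.support} = Kᶜ := by
      ext u
      exact not_congr (hw u)
    rw [this]
    exact ((Set.finite_Icc _ _).prod (Set.finite_Icc _ _)).subset hbox

/-! ### Holes -/

section
variable {L : ℕ} {food : Site L} {s : Finset (Site L)}

/-- The empty sites, lifted to the infinite lattice. -/
def emptyLift (s : Finset (Site L)) : Set (ℤ × ℤ) := {v | toSite L v ∉ s}

/-- One direction is `exists_encircles`. For the other, a closed path over particles can only
enlarge the component of `v` when its sites are the only ones forbidden. -/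
theorem holeFree_iff : HoleFree s ↔ ∀ v ∈ emptyLift s,
    {u | ConnectedThrough (triLattice ℤ) (emptyLift s) v u}.Infinite := by
  constructor
  · intro h v hv hfin
    obtain ⟨a, c, hc, henc⟩ := exists_encircles (A := (emptyLift s)ᶜ) (v := v) (by simpa using hv)
      (by simpa using hfin)
    exact h a c (fun u hu => by simpa [emptyLift] using hc u hu) v hv henc
  · intro h a c hc v hv henc
    refine h v hv (henc.2.subset fun u hu => ConnectedThrough.mono (A := emptyLift s) ?_ hu)
    exact fun w hw hwc => hw (hc w hwc)

theorem HoleFree.exists_nbr (h : HoleFree s) {v : ℤ × ℤ} (hv : toSite L v ∉ s) :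
    ∃ i, toSite L (v + triDir ℤ i) ∉ s := by
  by_contra! hcon
  refine holeFree_iff.1 h v hv ((Set.finite_singleton v).subset fun u hu => ?_)
  refine hu.induction_tail (P := fun u => u ∈ ({v} : Set _)) rfl fun a b hb hab _ ha => ?_
  obtain rfl : a = v := ha
  obtain ⟨-, i, rfl⟩ := hab
  exact (hb (hcon i)).elim

/-- A configuration with a hole has a row with two particles and a third particle in the next row,
both above and below. -/
theorem exists_of_not_holeFree (h : ¬ HoleFree s) : (∃ x y : ZMod L,
    (x, y + 1) ∈ s ∧ (x + 1, y + 1) ∈ s ∧ (x + 1, y) ∈ s) ∧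
    (∃ x y : ZMod L, (x, y - 1) ∈ s ∧ (x - 1, y - 1) ∈ s ∧ (x - 1, y) ∈ s) ∧ (1 : ZMod L) ≠ 0 := by
  rw [holeFree_iff] at h
  push Not at h
  obtain ⟨v, hv, hfin⟩ := h
  set C := {u | ConnectedThrough (triLattice ℤ) (emptyLift s) v u} with hC
  have hvC : v ∈ C := ConnectedThrough.refl hv
  have hnbr : ∀ u ∈ C, ∀ w, (triLattice ℤ).Adj u w → w ∉ C → toSite L w ∈ s :=
    fun u hu w huw hw =>
      by_contra fun hwA => hw (ConnectedThrough.trans hu (.of_adj hu.mem_right hwA huw))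
  have hex : ∀ f : ℤ × ℤ → ℤ ×ₗ ℤ, ∃ c ∈ C, ∀ d ∈ C, f d ≤ f c := fun f =>
    Set.exists_max_image C f hfin ⟨v, hvC⟩
  -- In the lexicographically extreme sites of a hole, three neighbours in a row lie outside the
  -- hole, hence are occupied.
  obtain ⟨⟨x, y⟩, hc, hmax⟩ := hex fun c => toLex (c.2, c.1)
  obtain ⟨⟨x', y'⟩, hc', hmax'⟩ := hex fun c => toLex (-c.2, -c.1)
  have hnot : ∀ a b, (y < b ∨ y = b ∧ x < a) → (a, b) ∉ C := fun a b hab hC =>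
    (hmax _ hC).not_gt (Prod.Lex.toLex_lt_toLex.2 hab)
  have hnot' : ∀ a b, (b < y' ∨ b = y' ∧ a < x') → (a, b) ∉ C := fun a b hab hC =>
    (hmax' _ hC).not_gt (Prod.Lex.toLex_lt_toLex.2 (by
      simp only [neg_lt_neg_iff, neg_inj]
      exact hab.imp_right fun h => ⟨h.1.symm, h.2⟩))
  have h1 := hnbr _ hc _ (adj_up x y) (hnot _ _ (by omega))
  have h2 := hnbr _ hc _ (adj_ru x y) (hnot _ _ (by omega))
  have h3 := hnbr _ hc _ (adj_right x y) (hnot _ _ (by omega))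
  have h4 := hnbr _ hc' (x', y' - 1) (by simpa using (adj_up x' (y' - 1)).symm)
    (hnot' _ _ (by omega))
  have h5 := hnbr _ hc' (x' - 1, y' - 1) (by simpa using (adj_ru (x' - 1) (y' - 1)).symm)
    (hnot' _ _ (by omega))
  have h6 := hnbr _ hc' (x' - 1, y') (by simpa using (adj_right (x' - 1) y').symm)
    (hnot' _ _ (by omega))
  refine ⟨⟨x, y, ?_, ?_, ?_⟩, ⟨x', y', ?_, ?_, ?_⟩, fun h0 => hc.mem_right ?_⟩
  · simpa [toSite] using h1
  · simpa [toSite] using h2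
  · simpa [toSite] using h3
  · simpa [toSite] using h4
  · simpa [toSite] using h5
  · simpa [toSite] using h6
  · have : toSite L (x, y) = toSite L (x, y + 1) := by simp [toSite, h0]
    rwa [this]

theorem holeFree_of_card_le_two (hs : s.card ≤ 2) : HoleFree s := by
  by_contra h
  obtain ⟨⟨x, y, h1, h2, h3⟩, -, h0⟩ := exists_of_not_holeFree h
  have : ({(x, y + 1), (x + 1, y + 1), (x + 1, y)} : Finset (Site L)) ⊆ s := by
    simp [Finset.insert_subset_iff, h1, h2, h3]
  have hcard := Finset.card_le_card this
  rw [Finset.card_eq_three.2 ⟨_, _, _, by simp [h0], by simp [h0], by simp [h0], rfl⟩] at hcard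
  omega

/-- The triples above and below the hole would be the same three particles; comparing their rows
gives `2 = 0`. -/
theorem holeFree_of_card_le_three (hs : s.card ≤ 3) (hL : (2 : ZMod L) ≠ 0) : HoleFree s := by
  by_contra h
  obtain ⟨⟨x, y, h1, h2, h3⟩, ⟨x', y', h4, h5, h6⟩, h0⟩ := exists_of_not_holeFree h
  have hsub : ({(x, y + 1), (x + 1, y + 1), (x + 1, y)} : Finset (Site L)) ⊆ s := by
    simp [Finset.insert_subset_iff, h1, h2, h3]
  have heq := Finset.eq_of_subset_of_card_le hsub (by
    rw [Finset.card_eq_three.2 ⟨_, _, _, by simp [h0], by simp [h0], by simp [h0], rfl⟩]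
    exact hs)
  rw [← heq] at h4 h5 h6
  simp only [Finset.mem_insert, Finset.mem_singleton, Prod.mk.injEq] at h4 h5 h6
  have e1 : x' ≠ x' - 1 := fun h => h0 (by linear_combination h)
  have key : y' - 1 = y + 1 := by
    by_contra hne
    have h4' : x' = x + 1 := by tauto
    have h5' : x' - 1 = x + 1 := by tauto
    exact e1 (h4'.trans h5'.symm)
  have key' : y' = y := by
    rcases h6 with h | h | h
    · exact absurd (h.2.trans key.symm) fun h => h0 (by linear_combination h)
    · exact absurd (h.2.trans key.symm) fun h => h0 (by linear_combination h)
    · exact h.2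
  exact hL (by linear_combination key' - key)

end

/-! ### Moves preserve the absence of holes -/

/-- Applied below to empty sites, with `l` the site being filled and `l'` the site being vacated:
paths through `l` can be rerouted around it. -/
theorem LocallyConnectedMove.nbrs_connected {V : Type} {G : SimpleGraph V} {A : Set V}
    {l l' x y : V}
    (h : LocallyConnectedMove G A l l') (hx : x ∈ (G.neighborSet l \ {l'}) ∩ A)
    (hy : y ∈ (G.neighborSet l \ {l'}) ∩ A) :
    ConnectedThrough G (insert l' (((G.neighborSet l ∪ G.neighborSet l') \ {l, l'}) ∩ A)) x y := by
  have hne : ∀ {z}, G.Adj l z → z ≠ l := fun hz h => G.loopless.irrefl l (by subst h; exact hz)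
  rcases h with ⟨-, h⟩ | ⟨-, -, -, h, -⟩
  · have key : ∀ z ∈ (G.neighborSet l \ {l'}) ∩ A, ConnectedThrough G
        (insert l' (((G.neighborSet l ∪ G.neighborSet l') \ {l, l'}) ∩ A)) z l' := by
      rintro z ⟨⟨hlz, hzl'⟩, hz⟩
      obtain ⟨w, ⟨⟨_, hl'w⟩, _⟩, hzw⟩ := h z ⟨⟨Or.inl hlz, by simp [hne hlz, hzl']⟩, hz⟩
      exact (hzw.mono (Set.subset_insert _ _)).trans
        (.of_adj (Set.mem_insert_of_mem _ hzw.mem_right) (Set.mem_insert _ _) hl'w.symm)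
    exact (key x hx).trans (key y hy).symm
  · refine (h x hx y hy).mono ?_
    rintro z ⟨⟨hlz, hzl'⟩, hz⟩
    exact Set.mem_insert_of_mem _ ⟨⟨Or.inl hlz, by simp [hne hlz, hzl']⟩, hz⟩

/-! ### The ring condition recovered from the graph condition, and its dualities. -/

/-- The offsets of the eight sites around the pair `l`, `l + d_i`, in cyclic order. -/
def ringOffset (i : Fin 6) : Fin 8 → ℤ × ℤ :=
  ![triDir ℤ (i + 1), triDir ℤ i + triDir ℤ (i + 1), triDir ℤ i + triDir ℤ i,
    triDir ℤ i + triDir ℤ (i + 5), triDir ℤ (i + 5), triDir ℤ (i + 4), triDir ℤ (i + 3),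
    triDir ℤ (i + 2)]

theorem ringOffset_adj : ∀ (i : Fin 6) (k k' : Fin 8) (j : Fin 6),
    ringOffset i k' = ringOffset i k + triDir ℤ j → k' = k + 1 ∨ k' = k - 1 := by
  decide

theorem ringOffset_injective : ∀ (i : Fin 6) (k k' : Fin 8),
    ringOffset i k' = ringOffset i k → k' = k := by
  decide

theorem abs_ringOffset_sub_le : ∀ (i : Fin 6) (k k' : Fin 8),
    |(ringOffset i k').1 - (ringOffset i k).1| ≤ 3 ∧
      |(ringOffset i k').2 - (ringOffset i k).2| ≤ 3 := by
  decide

section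
variable {R : Type} [Ring R] {A : Set (R × R)} {l : R × R} {i : Fin 6}

/-- The eight sites around the pair `l`, `l + d_i`. -/
def ringSite (l : R × R) (i : Fin 6) (k : Fin 8) : R × R :=
  l + (((ringOffset i k).1 : R), ((ringOffset i k).2 : R))

theorem ringSite_injective (hR : NoShortLoops R) : Function.Injective (ringSite l i) := by
  intro k k' h
  have h := add_left_cancel h
  rw [← sub_eq_zero] at h
  have h3 := abs_ringOffset_sub_le i k' k
  have := hR.eq_zero (z := ringOffset i k - ringOffset i k') h3.1 h3.2 (by simpa using h)
  exact ringOffset_injective i k' k (sub_eq_zero.1 this)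

/-- Ring offsets differ by at most three and a step adds one; hence the bound four, met by `ZMod L`
for `L ≥ 5`. -/
theorem ringSite_adj (hR : ∀ z : ℤ, |z| ≤ 4 → (z : R) = 0 → z = 0) {k k' : Fin 8}
    (h : (triLattice R).Adj (ringSite l i k) (ringSite l i k')) : k' = k + 1 ∨ k' = k - 1 := by
  obtain ⟨-, j, hj⟩ := h
  have h3 := abs_ringOffset_sub_le i k k'
  have h1 := abs_triDir_le j
  rw [ringSite, ringSite, add_assoc, triDir_cast] at hj
  have hj := add_left_cancel hj
  rw [Prod.ext_iff] at hj
  refine ringOffset_adj i k k' j (Prod.ext ?_ ?_)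
  · have := hR ((ringOffset i k').1 - (ringOffset i k).1 - (triDir ℤ j).1)
      (by simp only [abs_le] at *; omega) (by
        have := hj.1
        simp only [Prod.fst_add] at this
        push_cast
        rw [this]
        abel)
    simp only [Prod.fst_add]
    omega
  · have := hR ((ringOffset i k').2 - (ringOffset i k).2 - (triDir ℤ j).2)
      (by simp only [abs_le] at *; omega) (by
        have := hj.2
        simp only [Prod.snd_add] at this
        push_cast
        rw [this]
        abel)
    simp only [Prod.snd_add]
    omega

/-- Whatever contains one of the ring sites in `A` and is closed under steps along the ring
contains every site of `A` connected with it through the ring. -/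
theorem ringSite_closed (hR : ∀ z : ℤ, |z| ≤ 4 → (z : R) = 0 → z = 0) {B : Set (R × R)}
    (hB : ∀ u ∈ B, u ∈ A ∧ ∃ k, u = ringSite l i k) {j e : Fin 8}
    (h : ConnectedThrough (triLattice R) B (ringSite l i j) (ringSite l i e)) (Q : Fin 8 → Prop)
    (hj : Q j) (hQ : ∀ k, Q k → (ringSite l i (k + 1) ∈ A → Q (k + 1)) ∧
      (ringSite l i (k - 1) ∈ A → Q (k - 1))) : Q e := by
  have hinj : Function.Injective (ringSite l i) :=
    ringSite_injective (l := l) (i := i) fun z hz => hR z (by omega)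
  refine h.induction_tail (P := fun u => ∀ k, u = ringSite l i k → Q k)
    (fun k hk => hinj hk ▸ hj) (fun a b hb hab ha ih k' hk' => ?_) e rfl
  obtain ⟨k, rfl⟩ := (hB a ha.mem_right).2
  subst hk'
  rcases ringSite_adj hR hab with rfl | rfl
  · exact (hQ k (ih k rfl)).1 (hB _ hb).1
  · exact (hQ k (ih k rfl)).2 (hB _ hb).1

/-- Reachability of a common neighbour (index `0` or `4`) from `j` is phrased by closed predicates
`Q`. If a clause fails, the part of the arc of `j` reachable from `j` is such a predicate avoiding
both indices. -/
theorem ring_arcs {o : Fin 8 → Prop} {j : Fin 8} (hj : o j) (h : ∃ e, (e = 0 ∨ e = 4) ∧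
      ∀ Q : Fin 8 → Prop, Q j → (∀ k, Q k → (o (k + 1) → Q (k + 1)) ∧ (o (k - 1) → Q (k - 1))) →
        Q e) :
    (j = 7 → o 0 ∨ o 6 ∧ o 5 ∧ o 4) ∧ (j = 6 → o 7 ∧ o 0 ∨ o 5 ∧ o 4) ∧
    (j = 5 → o 4 ∨ o 6 ∧ o 7 ∧ o 0) ∧ (j = 1 → o 0 ∨ o 2 ∧ o 3 ∧ o 4) ∧
    (j = 2 → o 1 ∧ o 0 ∨ o 3 ∧ o 4) ∧ (j = 3 → o 4 ∨ o 2 ∧ o 1 ∧ o 0) := by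
  obtain ⟨e, he, h⟩ := h
  refine ⟨?_, ?_, ?_, ?_, ?_, ?_⟩ <;> rintro rfl <;> by_contra hcon
  · have := h (fun k => k = 7 ∨ k = 6 ∧ o 6 ∨ k = 5 ∧ o 6 ∧ o 5) (by simp) (by
      rintro k (rfl | ⟨rfl, h1⟩ | ⟨rfl, h1⟩) <;> simp <;> tauto)
    rcases he with rfl | rfl <;> simp at this
  · have := h (fun k => k = 6 ∨ k = 7 ∧ o 7 ∨ k = 5 ∧ o 5) (by simp) (by
      rintro k (rfl | ⟨rfl, h1⟩ | ⟨rfl, h1⟩) <;> simp <;> tauto)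
    rcases he with rfl | rfl <;> simp at this
  · have := h (fun k => k = 5 ∨ k = 6 ∧ o 6 ∨ k = 7 ∧ o 6 ∧ o 7) (by simp) (by
      rintro k (rfl | ⟨rfl, h1⟩ | ⟨rfl, h1⟩) <;> simp <;> tauto)
    rcases he with rfl | rfl <;> simp at this
  · have := h (fun k => k = 1 ∨ k = 2 ∧ o 2 ∨ k = 3 ∧ o 2 ∧ o 3) (by simp) (by
      rintro k (rfl | ⟨rfl, h1⟩ | ⟨rfl, h1⟩) <;> simp <;> tauto)
    rcases he with rfl | rfl <;> simp at this
  · have := h (fun k => k = 2 ∨ k = 1 ∧ o 1 ∨ k = 3 ∧ o 3) (by simp) (by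
      rintro k (rfl | ⟨rfl, h1⟩ | ⟨rfl, h1⟩) <;> simp <;> tauto)
    rcases he with rfl | rfl <;> simp at this
  · have := h (fun k => k = 3 ∨ k = 2 ∧ o 2 ∨ k = 1 ∧ o 2 ∧ o 1) (by simp) (by
      rintro k (rfl | ⟨rfl, h1⟩ | ⟨rfl, h1⟩) <;> simp <;> tauto)
    rcases he with rfl | rfl <;> simp at this

end

section
variable {R : Type} [Ring R] {A : Set (R × R)} {l : R × R} {i : Fin 6}

theorem ringSite_zero : ringSite l i 0 = l + triDir R (i + 1) := by
  simp [ringSite, ringOffset, triDir_cast (R := R)]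

theorem ringSite_one : ringSite l i 1 = l + triDir R i + triDir R (i + 1) := by
  simp [ringSite, ringOffset, triDir_cast (R := R), add_assoc]

theorem ringSite_two : ringSite l i 2 = l + triDir R i + triDir R i := by
  simp [ringSite, ringOffset, triDir_cast (R := R), add_assoc]

theorem ringSite_three : ringSite l i 3 = l + triDir R i + triDir R (i + 5) := by
  simp [ringSite, ringOffset, triDir_cast (R := R), add_assoc]

theorem ringSite_four : ringSite l i 4 = l + triDir R (i + 5) := by
  simp [ringSite, ringOffset, triDir_cast (R := R)]

theorem ringSite_five : ringSite l i 5 = l + triDir R (i + 4) := by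
  simp [ringSite, ringOffset, triDir_cast (R := R)]

theorem ringSite_six : ringSite l i 6 = l + triDir R (i + 3) := by
  simp [ringSite, ringOffset, triDir_cast (R := R)]

theorem ringSite_seven : ringSite l i 7 = l + triDir R (i + 2) := by
  simp [ringSite, ringOffset, triDir_cast (R := R)]

theorem moveOK_iff : MoveOK A l i ↔ RingOK (ringSite l i 0 ∈ A) (ringSite l i 4 ∈ A)
    (ringSite l i 7 ∈ A) (ringSite l i 6 ∈ A) (ringSite l i 5 ∈ A) (ringSite l i 1 ∈ A)
    (ringSite l i 2 ∈ A) (ringSite l i 3 ∈ A) := by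
  rw [ringSite_zero, ringSite_one, ringSite_two, ringSite_three, ringSite_four, ringSite_five,
    ringSite_six, ringSite_seven, MoveOK]

theorem triDir_add_four (i : Fin 6) : triDir R i + triDir R (i + 4) = triDir R (i + 5) := by
  fin_cases i <;> simp [triDir]

theorem exists_ringSite_of_adj {u : R × R} (h : (triLattice R).Adj l u) (hu : u ≠ l + triDir R i) :
    ∃ k : Fin 8, (k = 0 ∨ k = 4 ∨ k = 5 ∨ k = 6 ∨ k = 7) ∧ u = ringSite l i k := by
  obtain ⟨-, j, rfl⟩ := h
  obtain ⟨m, rfl⟩ : ∃ m, j = i + m := ⟨j - i, by simp⟩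
  obtain rfl | rfl | rfl | rfl | rfl | rfl :
    m = 0 ∨ m = 1 ∨ m = 2 ∨ m = 3 ∨ m = 4 ∨ m = 5 := by fin_cases m <;> simp
  · simp at hu
  · exact ⟨0, by simp, ringSite_zero.symm⟩
  · exact ⟨7, by simp, ringSite_seven.symm⟩
  · exact ⟨6, by simp, ringSite_six.symm⟩
  · exact ⟨5, by simp, ringSite_five.symm⟩
  · exact ⟨4, by simp, ringSite_four.symm⟩

theorem exists_ringSite_of_adj' {u : R × R} (h : (triLattice R).Adj (l + triDir R i) u)
    (hu : u ≠ l) :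
    ∃ k : Fin 8, (k = 0 ∨ k = 1 ∨ k = 2 ∨ k = 3 ∨ k = 4) ∧ u = ringSite l i k := by
  obtain ⟨-, j, rfl⟩ := h
  obtain ⟨m, rfl⟩ : ∃ m, j = i + m := ⟨j - i, by simp⟩
  obtain rfl | rfl | rfl | rfl | rfl | rfl :
    m = 0 ∨ m = 1 ∨ m = 2 ∨ m = 3 ∨ m = 4 ∨ m = 5 := by fin_cases m <;> simp
  · exact ⟨2, by simp, by rw [ringSite_two, add_zero]⟩
  · exact ⟨1, by simp, ringSite_one.symm⟩
  · exact ⟨0, by simp, by rw [ringSite_zero, add_assoc, triDir_add_succ]⟩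
  · rw [add_assoc, triDir_add_opp, add_zero] at hu
    exact (hu rfl).elim
  · exact ⟨4, by simp, by rw [ringSite_four, add_assoc, triDir_add_four]⟩
  · exact ⟨3, by simp, ringSite_three.symm⟩

theorem ringSite_mem_neighborSet (hR : NoShortLoops R) {k : Fin 8}
    (hk : k = 0 ∨ k = 4 ∨ k = 5 ∨ k = 6 ∨ k = 7) :
    ringSite l i k ∈ (triLattice R).neighborSet l \ {l + triDir R i} := by
  have key : ∀ m : Fin 6, m ≠ 0 →
      l + triDir R (i + m) ∈ (triLattice R).neighborSet l \ {l + triDir R i} := by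
    refine fun m hm => ⟨hR.adj_iff.2 ⟨_, rfl⟩, fun h => hm ?_⟩
    have h := add_left_cancel (Set.mem_singleton_iff.1 h)
    have : triDir R i + triDir R (i + m + 3) = 0 := by rw [← h, triDir_add_opp]
    have := hR.eq_opp this
    simpa using this
  rcases hk with rfl | rfl | rfl | rfl | rfl
  · rw [ringSite_zero]; exact key 1 (by decide)
  · rw [ringSite_four]; exact key 5 (by decide)
  · rw [ringSite_five]; exact key 4 (by decide)
  · rw [ringSite_six]; exact key 3 (by decide)
  · rw [ringSite_seven]; exact key 2 (by decide)

theorem ringSite_mem_neighborSet' (hR : NoShortLoops R) {k : Fin 8}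
    (hk : k = 0 ∨ k = 1 ∨ k = 2 ∨ k = 3 ∨ k = 4) :
    ringSite l i k ∈ (triLattice R).neighborSet (l + triDir R i) \ {l} := by
  have key : ∀ m : Fin 6, m ≠ 3 →
      l + triDir R i + triDir R (i + m) ∈ (triLattice R).neighborSet (l + triDir R i) \ {l} := by
    refine fun m hm => ⟨hR.adj_iff.2 ⟨_, rfl⟩, fun h => hm ?_⟩
    have h := Set.mem_singleton_iff.1 h
    rw [add_assoc, add_eq_left] at h
    simpa using hR.eq_opp h
  rcases hk with rfl | rfl | rfl | rfl | rfl
  · rw [ringSite_zero, ← triDir_add_succ, ← add_assoc]; exact key 2 (by decide)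
  · rw [ringSite_one]; exact key 1 (by decide)
  · have := key 0 (by decide)
    rwa [add_zero, ← ringSite_two] at this
  · rw [ringSite_three]; exact key 5 (by decide)
  · rw [ringSite_four, ← triDir_add_four, ← add_assoc]; exact key 4 (by decide)

theorem LocallyConnectedMove.moveOK (hR4 : ∀ z : ℤ, |z| ≤ 4 → (z : R) = 0 → z = 0)
    (h : LocallyConnectedMove (triLattice R) A l (l + triDir R i))
    (hdeg : ((triLattice R).neighborSet l ∩ A).ncard < 5) : MoveOK A l i := by
  have hR : NoShortLoops R := fun z hz => hR4 z (by omega)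
  have hinj : Function.Injective (ringSite l i) := ringSite_injective hR
  have hirr : ∀ u : R × R, ¬ (triLattice R).Adj u u := (triLattice R).loopless.irrefl
  have hm := fun {k} => ringSite_mem_neighborSet (l := l) (i := i) (k := k) hR
  have hm' := fun {k} => ringSite_mem_neighborSet' (l := l) (i := i) (k := k) hR
  rw [moveOK_iff]
  refine ⟨?_, fun ⟨h0, h4, h7, h6, h5⟩ => hdeg.not_ge ?_⟩
  · rcases h with ⟨⟨w, ⟨hw1, hw2⟩, hwA⟩, h⟩ | ⟨h0, h1, h2, h3, h4⟩
    · have hcommon : ∀ w, (triLattice R).Adj l w → (triLattice R).Adj (l + triDir R i) w →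
          w = ringSite l i 0 ∨ w = ringSite l i 4 := by
        intro w hw1 hw2
        obtain ⟨k, hk, rfl⟩ := exists_ringSite_of_adj (i := i) hw1
          (fun h => hirr w (by rwa [← h] at hw2))
        obtain ⟨k', hk', he⟩ := exists_ringSite_of_adj' hw2
          (fun h => hirr l (by rwa [h] at hw1))
        obtain rfl := hinj he
        rcases hk with rfl | rfl | rfl | rfl | rfl <;> simp at hk' ⊢
      have key : ∀ j, ringSite l i j ∈ A → _ := fun j hj =>
        ring_arcs (o := fun k => ringSite l i k ∈ A) (j := j) hj (by
          obtain ⟨w, ⟨⟨hw1, hw2⟩, -⟩, hjw⟩ := h (ringSite l i j) ⟨by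
            have hj' : (j = 0 ∨ j = 4 ∨ j = 5 ∨ j = 6 ∨ j = 7) ∨
              (j = 0 ∨ j = 1 ∨ j = 2 ∨ j = 3 ∨ j = 4) := by clear * -; revert j; decide
            rcases hj' with hj' | hj'
            · have := hm hj'
              refine ⟨Or.inl this.1, ?_⟩
              rintro (h | h)
              exacts [hirr l (by have := this.1; rwa [h] at this), this.2 h]
            · have := hm' hj'
              refine ⟨Or.inr this.1, ?_⟩
              rintro (h | h)
              exacts [this.2 h, hirr (l + triDir R i) (by have := this.1; rwa [h] at this)], hj⟩
          have hB : ∀ u ∈ (((triLattice R).neighborSet l ∪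
              (triLattice R).neighborSet (l + triDir R i)) \ {l, l + triDir R i}) ∩ A,
              u ∈ A ∧ ∃ k, u = ringSite l i k := by
            rintro u ⟨⟨hu, hne⟩, huA⟩
            simp only [Set.mem_insert_iff, Set.mem_singleton_iff, not_or] at hne
            refine ⟨huA, ?_⟩
            rcases hu with hu | hu
            · obtain ⟨k, -, hk⟩ := exists_ringSite_of_adj hu hne.2
              exact ⟨k, hk⟩
            · obtain ⟨k, -, hk⟩ := exists_ringSite_of_adj' hu hne.1
              exact ⟨k, hk⟩
          rcases hcommon w hw1 hw2 with rfl | rfl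
          · exact ⟨0, by simp, fun Q => ringSite_closed hR4 hB hjw Q⟩
          · exact ⟨4, by simp, fun Q => ringSite_closed hR4 hB hjw Q⟩)
      refine Or.inl ⟨?_, fun h => (key 7 h).1 rfl, fun h => ?_, fun h => (key 5 h).2.2.1 rfl,
        fun h => (key 1 h).2.2.2.1 rfl, fun h => (key 2 h).2.2.2.2.1 rfl,
        fun h => (key 3 h).2.2.2.2.2 rfl⟩
      · rcases hcommon w hw1 hw2 with rfl | rfl
        exacts [Or.inl hwA, Or.inr hwA]
      · exact (key 6 h).2.1 rfl
    · have e0 : ringSite l i 0 ∉ A := fun h =>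
        Set.eq_empty_iff_forall_notMem.1 h0 _ ⟨⟨(hm (by simp)).1, (hm' (by simp)).1⟩, h⟩
      have e4 : ringSite l i 4 ∉ A := fun h =>
        Set.eq_empty_iff_forall_notMem.1 h0 _ ⟨⟨(hm (by simp)).1, (hm' (by simp)).1⟩, h⟩
      refine Or.inr ⟨e0, e4, ?_, ?_, fun ⟨h7, h5⟩ => ?_, fun ⟨h1, h3⟩ => ?_⟩
      · obtain ⟨u, ⟨hu, hne⟩, huA⟩ := h1
        obtain ⟨k, rfl | rfl | rfl | rfl | rfl, rfl⟩ := exists_ringSite_of_adj hu hne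
        all_goals tauto
      · obtain ⟨u, ⟨hu, hne⟩, huA⟩ := h2
        obtain ⟨k, rfl | rfl | rfl | rfl | rfl, rfl⟩ := exists_ringSite_of_adj' hu hne
        all_goals tauto
      · by_contra h6
        have := ringSite_closed (A := A) hR4 (fun u hu => ⟨hu.2, by
            obtain ⟨k, -, hk⟩ := exists_ringSite_of_adj hu.1.1 hu.1.2
            exact ⟨k, hk⟩⟩)
          (h3 _ ⟨hm (k := 7) (by simp), h7⟩ _ ⟨hm (k := 5) (by simp), h5⟩) (fun k => k = 7) rfl
          (by
            rintro k rfl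
            exact ⟨fun h => (e0 h).elim, fun h => (h6 h).elim⟩)
        simp at this
      · by_contra h2
        have := ringSite_closed (A := A) hR4 (fun u hu => ⟨hu.2, by
            obtain ⟨k, -, hk⟩ := exists_ringSite_of_adj' hu.1.1 hu.1.2
            exact ⟨k, hk⟩⟩)
          (h4 _ ⟨hm' (k := 1) (by simp), h1⟩ _ ⟨hm' (k := 3) (by simp), h3⟩) (fun k => k = 1) rfl
          (by
            rintro k rfl
            exact ⟨fun h => (h2 h).elim, fun h => (e0 h).elim⟩)
        simp at this
  · have hsub : ((({0, 4, 5, 6, 7} : Finset (Fin 8)) : Set (Fin 8)).image (ringSite l i)) ⊆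
        (triLattice R).neighborSet l ∩ A := by
      rintro _ ⟨k, hk, rfl⟩
      simp only [Finset.coe_insert, Finset.coe_singleton, Set.mem_insert_iff,
        Set.mem_singleton_iff] at hk
      refine ⟨(hm hk).1, ?_⟩
      rcases hk with rfl | rfl | rfl | rfl | rfl <;> assumption
    have hfin : ((triLattice R).neighborSet l ∩ A).Finite := by
      refine (Set.finite_range fun j => l + triDir R j).subset ?_
      rintro u ⟨⟨-, j, rfl⟩, -⟩
      exact ⟨j, rfl⟩
    have := Set.ncard_le_ncard hsub hfin
    rwa [Set.ncard_image_of_injective _ hinj, Set.ncard_coe_finset] at this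

/-- The move back, in a configuration `A'` with the same ring. -/
theorem moveOK_reverse {A' : Set (R × R)} : MoveOK A' (l + triDir R i) (i + 3) ↔
    RingOK (ringSite l i 4 ∈ A') (ringSite l i 0 ∈ A') (ringSite l i 3 ∈ A') (ringSite l i 2 ∈ A')
      (ringSite l i 1 ∈ A') (ringSite l i 5 ∈ A') (ringSite l i 6 ∈ A') (ringSite l i 7 ∈ A') := by
  rw [ringSite_zero, ringSite_one, ringSite_two, ringSite_three, ringSite_four, ringSite_five,
    ringSite_six, ringSite_seven, MoveOK]
  have e0 : l + triDir R i + triDir R (i + 3) = l := by rw [add_assoc, triDir_add_opp, add_zero]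
  have e1 : l + triDir R i + triDir R (i + 3 + 1) = l + triDir R (i + 5) := by
    rw [add_assoc, ← triDir_add_four, show i + 3 + 1 = i + 4 by rw [add_assoc]; rfl]
  have e2 : l + triDir R i + triDir R (i + 3 + 5) = l + triDir R (i + 1) := by
    rw [add_assoc, ← triDir_add_succ, show i + 3 + 5 = i + 2 by rw [add_assoc]; rfl]
  rw [e0, e1, e2, show i + 3 + 1 = i + 4 by rw [add_assoc]; rfl,
    show i + 3 + 2 = i + 5 by rw [add_assoc]; rfl,
    show i + 3 + 3 = i by rw [add_assoc]; exact add_zero i,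
    show i + 3 + 4 = i + 1 by rw [add_assoc]; rfl, show i + 3 + 5 = i + 2 by rw [add_assoc]; rfl]

/-- The connectivity clauses treat both arcs alike; only the degree bound changes sides, and it is
supplied by `h'`. -/
theorem RingOK.reverse {c₁ c₂ a₁ a₂ a₃ b₁ b₂ b₃ : Prop} (h : RingOK c₁ c₂ a₁ a₂ a₃ b₁ b₂ b₃)
    (h' : ¬ (c₁ ∧ c₂ ∧ b₁ ∧ b₂ ∧ b₃)) : RingOK c₂ c₁ b₃ b₂ b₁ a₃ a₂ a₁ := by
  revert h h'
  rcases Classical.propComplete c₁ with rfl | rfl <;>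
  rcases Classical.propComplete c₂ with rfl | rfl <;>
  rcases Classical.propComplete a₁ with rfl | rfl <;>
  rcases Classical.propComplete a₂ with rfl | rfl <;>
  rcases Classical.propComplete a₃ with rfl | rfl <;>
  simp only [RingOK, true_and, and_true, false_and, and_false, true_or, or_true, false_or, or_false,
    not_true, not_false_iff, true_imp_iff, false_imp_iff, imp_true_iff] <;> tauto

/-- If both common neighbours are occupied, each side has exactly one arc of empty sites, nonempty
by the degree bound and `h'`. If one is occupied, particles and empty sites form complementary arcs.
If none is, every empty site is linked to a common neighbour. So the alternatives are exchanged or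
preserved. -/
theorem RingOK.compl {c₁ c₂ a₁ a₂ a₃ b₁ b₂ b₃ : Prop} (h : RingOK c₁ c₂ a₁ a₂ a₃ b₁ b₂ b₃)
    (h' : ¬ (c₁ ∧ c₂ ∧ b₁ ∧ b₂ ∧ b₃)) :
    RingOK (¬ c₂) (¬ c₁) (¬ b₃) (¬ b₂) (¬ b₁) (¬ a₃) (¬ a₂) (¬ a₁) := by
  revert h h'
  rcases Classical.propComplete c₁ with rfl | rfl <;>
  rcases Classical.propComplete c₂ with rfl | rfl <;>
  rcases Classical.propComplete a₁ with rfl | rfl <;>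
  rcases Classical.propComplete a₂ with rfl | rfl <;>
  rcases Classical.propComplete a₃ with rfl | rfl <;>
  simp only [RingOK, true_and, and_true, false_and, and_false, true_or, or_true, false_or, or_false,
    not_true, not_false_iff, true_imp_iff, false_imp_iff, imp_true_iff] <;> tauto

end

/-! ### Invariance of the state space and reversibility of moves. -/

section
variable {L : ℕ} {food : Site L} {s : Finset (Site L)} {n : ℕ}

theorem mem_moveParticle {l l' u : Site L} :
    u ∈ moveParticle s l l' ↔ u = l' ∨ u ≠ l ∧ u ∈ s := by
  rw [moveParticle, Finset.mem_insert, Finset.mem_erase]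

theorem toSite_ringSite (v : ℤ × ℤ) (i : Fin 6) (k : Fin 8) :
    toSite L (ringSite v i k) = ringSite (toSite L v) i k := by
  simp [ringSite, toSite]

/-- By `RingOK.compl` the empty sites around `l'` remain linked after the move, so infinite empty
components stay infinite. The vacated site joins one of them. -/
theorem IsValidMove.holeFree {l l' : Site L} (h : IsValidMove food s l l') (hs : HoleFree s)
    (hL : 5 ≤ L) : HoleFree (moveParticle s l l') := by
  obtain ⟨hl, -, hl', ⟨-, i, rfl⟩, hloc, hdeg⟩ := isValidMove_iff.1 h
  have hR : NoShortLoops (ZMod L) := noShortLoops_zmod (by omega)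
  have hok : MoveOK (s : Set (Site L)) l i := hloc.moveOK (fun z hz h =>
    intCast_eq_of_abs_lt (L := L) (by simpa using h) (by rw [sub_zero]; omega)) hdeg
  set s' := moveParticle s l (l + triDir (ZMod L) i) with hs'
  have hne : l ≠ l + triDir (ZMod L) i := fun h => hR.triDir_ne_zero i (by simpa using h)
  -- around each lift of the pair, the empty sites are linked in the new configuration
  have hlink : ∀ v, toSite L v = l → ∀ x y, (triLattice ℤ).Adj (v + triDir ℤ i) x →
      (triLattice ℤ).Adj (v + triDir ℤ i) y → x ∈ emptyLift s → y ∈ emptyLift s →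
      ConnectedThrough (triLattice ℤ) (emptyLift s') x y := by
    intro v hv x y hx hy hxs hys
    have hv' : toSite L (v + triDir ℤ i) = l + triDir (ZMod L) i := by
      rw [toSite_add, toSite_triDir, hv]
    have hring := moveOK_iff.1 hok
    have hmem : ∀ k, (ringSite l i k ∈ (s : Set (Site L)) ↔ ¬ ringSite v i k ∈ emptyLift s) := by
      intro k
      rw [emptyLift, Set.mem_ofPred_eq, not_not, toSite_ringSite, hv]
      rfl
    -- Otherwise `l'` would have only occupied neighbours and would itself be a hole.
    have hnot : ¬ (ringSite l i 0 ∈ (s : Set (Site L)) ∧ ringSite l i 4 ∈ (s : Set (Site L)) ∧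
        ringSite l i 1 ∈ (s : Set (Site L)) ∧ ringSite l i 2 ∈ (s : Set (Site L)) ∧
        ringSite l i 3 ∈ (s : Set (Site L))) := by
      rintro ⟨h0, h4, h1, h2, h3⟩
      obtain ⟨j, hj⟩ := hs.exists_nbr (v := v + triDir ℤ i) (by rwa [hv'])
      by_cases hjv : v + triDir ℤ i + triDir ℤ j = v
      · rw [hjv, hv] at hj
        exact hj hl
      obtain ⟨k, hk, hkj⟩ := exists_ringSite_of_adj' (noShortLoops_int.adj_iff.2 ⟨j, rfl⟩) hjv
      rw [hkj, toSite_ringSite, hv] at hj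
      rcases hk with rfl | rfl | rfl | rfl | rfl
      exacts [hj h0, hj h1, hj h2, hj h3, hj h4]
    have hcompl := hring.compl hnot
    simp only [hmem, not_not] at hcompl
    have hvE : v ∉ emptyLift s := fun h => h (hv ▸ hl)
    have hmove : LocallyConnectedMove (triLattice ℤ) (emptyLift s) (v + triDir ℤ i) v := by
      have := (moveOK_reverse.2 hcompl).locallyConnectedMove noShortLoops_int
      rw [add_assoc, triDir_add_opp, add_zero] at this
      exact this hvE
    refine (hmove.nbrs_connected (x := x) (y := y) ⟨⟨hx, fun h => ?_⟩, hxs⟩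
      ⟨⟨hy, fun h => ?_⟩, hys⟩).mono ?_
    · exact hvE (Set.mem_singleton_iff.1 h ▸ hxs)
    · exact hvE (Set.mem_singleton_iff.1 h ▸ hys)
    · rintro u (rfl | ⟨⟨hu, hune⟩, huE⟩)
      · show toSite L u ∉ s'
        rw [hs', mem_moveParticle, hv]
        simp [hne]
      · show toSite L u ∉ s'
        rw [hs', mem_moveParticle]
        rintro (h | ⟨-, h⟩)
        · rw [← hv'] at h
          have hi := abs_triDir_le i
          refine hune (Or.inl (toSite_eq_of_abs_lt h ?_ ?_))
          all_goals
            obtain ⟨-, j, rfl⟩ | ⟨-, j, rfl⟩ := hu <;>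
            · have hj := abs_triDir_le j
              simp only [Prod.fst_add, Prod.snd_add, abs_lt, abs_le] at *
              omega
        · exact huE h
  have hEE : ∀ {u}, u ∈ emptyLift s → toSite L u ≠ l + triDir (ZMod L) i → u ∈ emptyLift s' := by
    intro u hu hne' hus
    rcases mem_moveParticle.1 hus with h | ⟨-, h⟩
    exacts [hne' h, hu h]
  have hstuck : ∀ {u}, u ∈ emptyLift s' → toSite L u ≠ l + triDir (ZMod L) i := fun hu h =>
    hu (h ▸ Finset.mem_insert_self _ _)
  have hlift : ∀ u, toSite L u = l + triDir (ZMod L) i → ∃ v, toSite L v = l ∧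
      u = v + triDir ℤ i := fun u hu => ⟨u + triDir ℤ (i + 3), by
    rw [toSite_add, toSite_triDir, hu, add_assoc, triDir_add_opp, add_zero], by
    rw [add_assoc, add_comm (triDir ℤ (i + 3)), triDir_add_opp, add_zero]⟩
  -- old paths through empty sites can be rerouted
  have hreroute : ∀ {v}, v ∈ emptyLift s → v ∈ emptyLift s' → ∀ {u},
      ConnectedThrough (triLattice ℤ) (emptyLift s) v u →
      (u ∈ emptyLift s' → ConnectedThrough (triLattice ℤ) (emptyLift s') v u) ∧
      (u ∉ emptyLift s' → ∃ w ∈ emptyLift s, (triLattice ℤ).Adj u w ∧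
        ConnectedThrough (triLattice ℤ) (emptyLift s') v w) := by
    intro v hv hv' u hu
    refine hu.induction_tail (P := fun u =>
      (u ∈ emptyLift s' → ConnectedThrough (triLattice ℤ) (emptyLift s') v u) ∧
      (u ∉ emptyLift s' → ∃ w ∈ emptyLift s, (triLattice ℤ).Adj u w ∧
        ConnectedThrough (triLattice ℤ) (emptyLift s') v w))
      ⟨fun h => .refl h, fun h => (h hv').elim⟩ fun a b hb hab ha ih => ?_
    by_cases ha' : a ∈ emptyLift s'
    · exact ⟨fun hb' => (ih.1 ha').trans (.of_adj ha' hb' hab),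
        fun _ => ⟨a, ha.mem_right, hab.symm, ih.1 ha'⟩⟩
    · obtain ⟨w, hw, haw, hvw⟩ := ih.2 ha'
      obtain ⟨c, hc, rfl⟩ := hlift a (by_contra fun h => ha' (hEE ha.mem_right h))
      refine ⟨fun hb' => hvw.trans (hlink c hc w b haw hab hw hb), fun hb' => ?_⟩
      have hb1 := by_contra fun h => hb' (hEE hb h)
      obtain ⟨-, j, rfl⟩ := hab
      rw [toSite_add, toSite_add, toSite_triDir, toSite_triDir, hc, add_eq_left] at hb1
      exact (hR.triDir_ne_zero j hb1).elim
  rw [holeFree_iff] at hs ⊢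
  -- The old component is contained in the new one together with neighbours of its sites, so
  -- finiteness would carry over.
  have hold : ∀ v ∈ emptyLift s, v ∈ emptyLift s' →
      {u | ConnectedThrough (triLattice ℤ) (emptyLift s') v u}.Infinite := by
    intro v hv hv' hfin
    refine hs v hv
      ((hfin.union (hfin.biUnion fun u _ => finite_neighborSet u)).subset fun u hu => ?_)
    by_cases hu' : u ∈ emptyLift s'
    · exact Or.inl ((hreroute hv hv' hu).1 hu')
    · obtain ⟨w, -, huw, hvw⟩ := (hreroute hv hv' hu).2 hu'
      exact Or.inr (Set.mem_biUnion hvw huw.symm)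
  intro v hv'
  by_cases hv : v ∈ emptyLift s
  · exact hold v hv hv'
  have hvl : toSite L v = l := by
    by_contra hne'
    exact hv' (mem_moveParticle.2 (Or.inr ⟨hne', not_not.1 hv⟩))
  -- By the degree bound the vacated site has an empty neighbour besides `l'`.
  obtain ⟨k, hk, hkE⟩ : ∃ k : Fin 8, (k = 0 ∨ k = 4 ∨ k = 5 ∨ k = 6 ∨ k = 7) ∧
      ringSite l i k ∉ (s : Set (Site L)) := by
    by_contra! hcon
    exact (moveOK_iff.1 hok).2 ⟨hcon 0 (by simp), hcon 4 (by simp), hcon 7 (by simp),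
      hcon 6 (by simp), hcon 5 (by simp)⟩
  have hw : ringSite v i k ∈ emptyLift s := by
    rw [emptyLift, Set.mem_ofPred_eq, toSite_ringSite, hvl]
    exact hkE
  have hw' : ringSite v i k ∈ emptyLift s' := hEE hw (by
    rw [toSite_ringSite, hvl]
    exact (ringSite_mem_neighborSet hR hk).2)
  refine (hold _ hw hw').mono fun u hu => ?_
  exact (ConnectedThrough.of_adj hv' hw' (ringSite_mem_neighborSet noShortLoops_int hk).1).trans hu

theorem IsConnectedConfig.moveParticle {l l' : Site L} (hs : IsConnectedConfig food n s)
    (h : IsValidMove food s l l') : IsConnectedConfig food n (moveParticle s l l') := by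
  obtain ⟨hl, hlf, hl', -, hloc, -⟩ := isValidMove_iff.1 h
  refine ⟨mem_moveParticle.2 (Or.inr ⟨hlf.symm, hs.food_mem⟩), ?_, ?_⟩
  · rw [_root_.moveParticle, Finset.card_insert_of_notMem fun h => hl' (Finset.mem_of_mem_erase h),
      Finset.card_erase_add_one hl, hs.card_eq]
  · have := hloc.connected hl hl' hs.connected
    rwa [_root_.moveParticle, Finset.coe_insert, Finset.coe_erase]

/-- The ring argument needs `L ≥ 5`, which holds for `n ≥ 3`. Smaller `n` give too few particles to
enclose a site. -/
theorem CompressionStep.state [NeZero L] {t : Finset (Site L)} (hroom : LineFits L (n + 1))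
    (h : CompressionStep food s t) (hs : IsConnectedConfig food n s) (hfree : HoleFree s) :
    IsConnectedConfig food n t ∧ HoleFree t := by
  obtain ⟨l, l', h, rfl⟩ := h
  have hc := hs.moveParticle h
  refine ⟨hc, ?_⟩
  rcases Nat.lt_or_ge n 2 with hn | hn
  · exact holeFree_of_card_le_two (by rw [hc.card_eq]; omega)
  have hL := hroom.add_two_le hn
  obtain rfl | hn := hn.eq_or_lt
  · refine holeFree_of_card_le_three hc.card_eq.le fun h => ?_
    have := noShortLoops_zmod hL 2 (by norm_num) (by exact_mod_cast h)
    omega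
  · exact h.holeFree hfree (by omega)

/-- Only the degree bound could forbid the way back, and it fails only if the target was a hole
before the move. -/
theorem PlaneStep.reverse {N : ℕ} {S S' : Finset (ℤ × ℤ)} (h : PlaneStep S S')
    (hS : PlaneConf N S) (hN : N < L) (hfree : HoleFree (S.image (siteAt food))) :
    PlaneStep S' S := by
  obtain ⟨l, i, hl, hl0, hl', hok, rfl⟩ := h
  set l' := l + triDir ℤ i with hl'def
  have hll' : l ≠ l' := fun h => hl' (h ▸ hl)
  have hback : l' + triDir ℤ (i + 3) = l := by
    rw [hl'def, add_assoc, triDir_add_opp, add_zero]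
  have hring := moveOK_iff.1 hok
  have hnot : ¬ (ringSite l i 0 ∈ (S : Set (ℤ × ℤ)) ∧ ringSite l i 4 ∈ (S : Set (ℤ × ℤ)) ∧
      ringSite l i 1 ∈ (S : Set (ℤ × ℤ)) ∧ ringSite l i 2 ∈ (S : Set (ℤ × ℤ)) ∧
      ringSite l i 3 ∈ (S : Set (ℤ × ℤ))) := by
    rintro ⟨h0, h4, h1, h2, h3⟩
    obtain ⟨f, hf⟩ := toSite_surjective food
    have hf' : ∀ v, toSite L (f + v) = siteAt food v := fun v => by rw [toSite_add, hf, siteAt]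
    obtain ⟨j, hj⟩ := hfree.exists_nbr (v := f + l') (by
      rw [hf', hl'def, hS.siteAt_mem_iff hN hl]
      exact hl')
    rw [add_assoc, hf'] at hj
    refine hj (Finset.mem_image_of_mem _ ?_)
    by_cases hjl : l' + triDir ℤ j = l
    · rwa [hjl]
    obtain ⟨k, hk, hkj⟩ := exists_ringSite_of_adj' (noShortLoops_int.adj_iff.2 ⟨j, rfl⟩) hjl
    rw [hkj]
    rcases hk with rfl | rfl | rfl | rfl | rfl
    exacts [h0, h1, h2, h3, h4]
  have hmem : ∀ k, ringSite l i k ∈ (S : Set (ℤ × ℤ)) ↔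
      ringSite l i k ∈ ((insert l' (S.erase l) : Finset (ℤ × ℤ)) : Set (ℤ × ℤ)) := by
    have hk2 : ∀ k : Fin 8, (k = 0 ∨ k = 4 ∨ k = 5 ∨ k = 6 ∨ k = 7) ∨
        (k = 0 ∨ k = 1 ∨ k = 2 ∨ k = 3 ∨ k = 4) := by decide
    have hne : ∀ k, ringSite l i k ≠ l ∧ ringSite l i k ≠ l' := by
      intro k
      rcases hk2 k with hk | hk
      · have := ringSite_mem_neighborSet (l := l) (i := i) noShortLoops_int hk
        exact ⟨fun h => SimpleGraph.Adj.ne (G := triLattice ℤ) this.1 h.symm, this.2⟩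
      · have := ringSite_mem_neighborSet' (l := l) (i := i) noShortLoops_int hk
        exact ⟨this.2, fun h => SimpleGraph.Adj.ne (G := triLattice ℤ) this.1 h.symm⟩
    intro k
    simp [hne k]
  have hrev := hring.reverse hnot
  simp only [hmem] at hrev
  refine ⟨l', i + 3, Finset.mem_insert_self _ _, fun h => hl' (h ▸ hS.zero_mem), ?_,
    moveOK_reverse.2 hrev, ?_⟩
  · rw [hback]
    simp [hll']
  · rw [hback, Finset.erase_insert fun h => hl' (Finset.mem_of_mem_erase h), Finset.insert_erase hl]

theorem PlaneReach.reverse [NeZero L] {S S' : Finset (ℤ × ℤ)} (hroom : LineFits L (n + 1))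
    (hn : 2 ≤ n) (h : PlaneReach S S') (hS : PlaneConf (n + 1) S)
    (hs : IsConnectedConfig food n (S.image (siteAt food)))
    (hfree : HoleFree (S.image (siteAt food))) : PlaneReach S' S := by
  have hL := hroom.add_two_le hn
  suffices H : PlaneReach S' S ∧ IsConnectedConfig food n (S'.image (siteAt food)) ∧
      HoleFree (S'.image (siteAt food)) from H.1
  induction h with
  | refl => exact ⟨.refl, hs, hfree⟩
  | tail h1 h2 ih =>
    have hT := hS.reach h1
    exact ⟨.head (h2.reverse hT (by omega) ih.2.2) ih.1,
      (h2.compressionStep hT (by omega) (by omega)).state hroom ih.2.1 ih.2.2⟩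

end

/-! ### Reachability -/

section
variable {L : ℕ} {food : Site L} {n : ℕ}

/-- The food particle with a single particle next to it. -/
def dimer (food : Site L) (i : Fin 6) : Finset (Site L) := {food, food + triDir (ZMod L) i}

theorem triDir_ne_zero_of_two_le (hL : 2 ≤ L) (i : Fin 6) : triDir (ZMod L) i ≠ 0 := by
  have : Fact (1 < L) := ⟨hL⟩
  fin_cases i <;> simp [triDir]

/-- The food is a common neighbour of both positions and the only other particle. No ring of eight
distinct sites is needed, so small `L` are covered. -/
theorem dimer_step (hL : 2 ≤ L) (i : Fin 6) :
    CompressionStep food (dimer food i) (dimer food (i + 1)) := by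
  have h0 := triDir_ne_zero_of_two_le hL
  have hadj : ∀ (u : Site L) j, (triLattice (ZMod L)).Adj u (u + triDir (ZMod L) j) :=
    fun u j => ⟨fun h => h0 j (by simpa using h), j, rfl⟩
  have hll' : (triLattice (ZMod L)).Adj (food + triDir (ZMod L) i)
      (food + triDir (ZMod L) (i + 1)) := by
    rw [← triDir_add_succ, ← add_assoc]
    exact hadj _ _
  have hl' : food + triDir (ZMod L) (i + 1) ∉ dimer food i := by
    simp only [dimer, Finset.mem_insert, Finset.mem_singleton, add_eq_left, not_or]
    exact ⟨h0 _, fun h => hll'.ne h.symm⟩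
  have hfood : food ∈ commonNbrs (dimer food i) (food + triDir (ZMod L) i)
      (food + triDir (ZMod L) (i + 1)) :=
    ⟨⟨(hadj food i).symm, (hadj food (i + 1)).symm⟩, by simp [dimer]⟩
  refine ⟨food + triDir (ZMod L) i, food + triDir (ZMod L) (i + 1), ⟨by simp [dimer],
    fun h => h0 i (by simpa using h), hl', hll', Or.inl ⟨⟨food, hfood⟩, ?_⟩, ?_⟩, ?_⟩
  · rintro u ⟨hu, hus⟩
    simp only [dimer, Finset.coe_insert, Finset.coe_singleton, Set.mem_insert_iff,
      Set.mem_singleton_iff] at hus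
    rcases hus with rfl | rfl
    · exact ⟨_, hfood, .refl ⟨hu, by simp [dimer]⟩⟩
    · exact (hu.2 (by simp)).elim
  · refine (Set.ncard_le_ncard Set.inter_subset_right (Finset.finite_toSet _)).trans_lt ?_
    rw [Set.ncard_coe_finset]
    exact Finset.card_le_two.trans_lt (by norm_num)
  · ext u
    rw [mem_moveParticle]
    simp only [dimer, Finset.mem_insert, Finset.mem_singleton]
    have := (hadj food i).ne
    constructor
    · rintro (rfl | rfl)
      exacts [Or.inr ⟨this, Or.inl rfl⟩, Or.inl rfl]
    · tauto

theorem dimer_reach (hL : 2 ≤ L) (i j : Fin 6) :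
    Relation.ReflTransGen (CompressionStep food) (dimer food i) (dimer food j) := by
  have key : ∀ k : ℕ, Relation.ReflTransGen (CompressionStep food) (dimer food i)
      (dimer food (i + k • (1 : Fin 6))) := by
    intro k
    induction k with
    | zero => rw [zero_nsmul, add_zero]
    | succ k ih =>
      refine ih.tail ?_
      rw [succ_nsmul, ← add_assoc]
      exact dimer_step hL _
  have hj : i + (j - i).val • (1 : Fin 6) = j := by
    clear key
    revert i j
    decide
  exact hj ▸ key (j - i).val

theorem IsConnectedConfig.exists_dimer {s : Finset (Site L)} (hs : IsConnectedConfig food 1 s) :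
    ∃ i, s = dimer food i := by
  obtain ⟨u, hu, w, hw, hwu, huw⟩ := exists_adj_boundary hs.connected (B := {food})
    (by simpa using hs.food_mem) (Set.singleton_nonempty _) (fun h => by
      have h' := hs.card_eq
      rw [Finset.card_eq_one.2 ⟨food, by rw [← Finset.coe_inj, ← h, Finset.coe_singleton]⟩] at h'
      omega)
  obtain rfl : u = food := hu
  obtain ⟨hne, i, rfl⟩ := huw
  refine ⟨i, (Finset.eq_of_subset_of_card_le ?_ ?_).symm⟩
  · rw [dimer, Finset.insert_subset_iff, Finset.singleton_subset_iff]
    exact ⟨hs.food_mem, hw⟩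
  · rw [dimer, Finset.card_pair hne, hs.card_eq]

theorem IsConnectedConfig.reach [NeZero L] {s t : Finset (Site L)} (hroom : LineFits L (n + 1))
    (hs : IsConnectedConfig food n s) (ht : IsConnectedConfig food n t) (hfree : HoleFree t) :
    Relation.ReflTransGen (CompressionStep food) s t := by
  obtain rfl | rfl | hn : n = 0 ∨ n = 1 ∨ 2 ≤ n := by omega
  · obtain ⟨a, rfl⟩ := Finset.card_eq_one.1 hs.card_eq
    obtain ⟨b, rfl⟩ := Finset.card_eq_one.1 ht.card_eq
    rw [← Finset.mem_singleton.1 hs.food_mem, ← Finset.mem_singleton.1 ht.food_mem]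
  · obtain ⟨i, rfl⟩ := hs.exists_dimer
    obtain ⟨j, rfl⟩ := ht.exists_dimer
    exact dimer_reach hroom.lt i j
  · have hL := hroom.add_two_le hn
    obtain ⟨T, hT, rfl⟩ := ht.exists_planeConf
    have hline := hT.reach_planeLine (by omega)
    exact (hs.reach_line hL hn).trans ((hline.reverse hroom hn hT ht hfree).compression
      (hT.reach hline) (by omega) (by omega))

end

/-! ### The Markov chain -/

section
variable {L : ℕ} {food : Site L} {n : ℕ} {lam : ℝ} {s t : Finset (Site L)}

theorem CompressionStep.ne (h : CompressionStep food s t) : t ≠ s := by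
  obtain ⟨l, l', hv, rfl⟩ := h
  exact fun h => hv.2.2.1 (h ▸ Finset.mem_insert_self _ _)

theorem moveProb_nonneg (hlam : 0 < lam) (s t : Finset (Site L)) : 0 ≤ moveProb food lam s t := by
  refine Finset.sum_nonneg fun l _ => Finset.sum_nonneg fun i _ => ?_
  split_ifs
  · positivity
  · exact le_rfl

theorem moveProb_eq_zero (h : ¬ CompressionStep food s t) : moveProb food lam s t = 0 :=
  Finset.sum_eq_zero fun l _ => Finset.sum_eq_zero fun _ _ =>
    if_neg fun hv => h ⟨l, _, hv⟩

theorem moveProb_pos (hlam : 0 < lam) (h : CompressionStep food s t) :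
    0 < moveProb food lam s t := by
  obtain ⟨l, l', hv, rfl⟩ := h
  obtain ⟨-, i, rfl⟩ := hv.2.2.2.1
  have hl : l ∈ s.erase food := Finset.mem_erase.2 ⟨hv.2.1, hv.1⟩
  have hcard : 0 < (s.erase food).card := Finset.card_pos.2 ⟨l, hl⟩
  have hnn : ∀ (l : Site L) (i : Fin 6), (0 : ℝ) ≤ 1 / ((s.erase food).card * 6) * min 1 (lam ^
      ((edgeCount (moveParticle s l (l + triDir (ZMod L) i)) : ℤ) - (edgeCount s : ℤ))) :=
    fun _ _ => by positivity
  refine Finset.sum_pos' (fun k _ => Finset.sum_nonneg fun j _ => ?_) ⟨l, hl,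
    Finset.sum_pos' (fun j _ => ?_) ⟨i, Finset.mem_univ _, ?_⟩⟩
  · split_ifs
    · positivity
    · exact le_rfl
  · split_ifs
    · positivity
    · exact le_rfl
  · rw [if_pos ⟨hv, rfl⟩]
    positivity

/-- Dropping validity and the acceptance factor leaves the uniform choice of particle and direction,
of total mass one, or zero if the food is alone. -/
theorem sum_moveProb_le_one [NeZero L] (s : Finset (Site L)) :
    ∑ t, moveProb food lam s t ≤ 1 := by
  classical
  have hterm : ∀ (l : Site L) (i : Fin 6) (t : Finset (Site L)),
      (if IsValidMove food s l (l + triDir (ZMod L) i) ∧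
          t = moveParticle s l (l + triDir (ZMod L) i) then
        1 / ((s.erase food).card * 6) * min 1 (lam ^ ((edgeCount t : ℤ) - (edgeCount s : ℤ)))
      else 0) ≤ if t = moveParticle s l (l + triDir (ZMod L) i) then
        1 / (((s.erase food).card : ℝ) * 6) else 0 := by
    intro l i t
    split_ifs with h1 h2 h2
    · exact mul_le_of_le_one_right (by positivity) (min_le_left _ _)
    · exact (h2 h1.2).elim
    · positivity
    · exact le_rfl
  calc ∑ t, moveProb food lam s t
      ≤ ∑ t, ∑ l ∈ s.erase food, ∑ i : Fin 6,
          if t = moveParticle s l (l + triDir (ZMod L) i) then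
            1 / (((s.erase food).card : ℝ) * 6) else 0 :=
        Finset.sum_le_sum fun t _ => Finset.sum_le_sum fun l _ => Finset.sum_le_sum fun i _ => by
          convert hterm l i t
    _ = ∑ l ∈ s.erase food, ∑ i : Fin 6, 1 / (((s.erase food).card : ℝ) * 6) := by
        rw [Finset.sum_comm]
        refine Finset.sum_congr rfl fun l _ => ?_
        rw [Finset.sum_comm]
        simp
    _ ≤ 1 := by
        rw [Finset.sum_const, Finset.sum_const, Finset.card_univ, Fintype.card_fin, nsmul_eq_mul,
          nsmul_eq_mul]
        rcases Nat.eq_zero_or_pos (s.erase food).card with h | h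
        · rw [h]
          simp
        · have : (0 : ℝ) < (s.erase food).card := by exact_mod_cast h
          refine le_of_eq ?_
          push_cast
          field_simp

variable [NeZero L]

theorem transitionProb_nonneg (hlam : 0 < lam) (s t : Finset (Site L)) :
    0 ≤ transitionProb food lam s t := by
  unfold transitionProb
  split_ifs
  · rw [sub_nonneg]
    refine (Finset.sum_le_sum_of_subset_of_nonneg (Finset.subset_univ _)
      fun u _ _ => moveProb_nonneg hlam s u).trans (sum_moveProb_le_one s)
  · exact moveProb_nonneg hlam s t

theorem sum_transitionProb (s : Finset (Site L)) : ∑ t, transitionProb food lam s t = 1 := by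
  rw [← Finset.add_sum_erase _ _ (Finset.mem_univ s)]
  have : ∑ t ∈ Finset.univ.erase s, transitionProb food lam s t =
      ∑ t ∈ Finset.univ.erase s, moveProb food lam s t :=
    Finset.sum_congr rfl fun t ht => if_neg (Finset.ne_of_mem_erase ht)
  rw [this, transitionProb, if_pos rfl, sub_add_cancel]

theorem transitionProb_pos (hlam : 0 < lam) (h : CompressionStep food s t) :
    0 < transitionProb food lam s t := by
  rw [transitionProb, if_neg h.ne]
  exact moveProb_pos hlam h

theorem compressionMatrix_mem_rowStochastic (hroom : LineFits L (n + 1)) (hlam : 0 < lam) :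
    compressionMatrix food n lam ∈ Matrix.rowStochastic ℝ (ChainState food n) := by
  classical
  rw [Matrix.mem_rowStochastic_iff_sum]
  refine ⟨fun s t => transitionProb_nonneg hlam _ _, fun s => ?_⟩
  have h := Finset.sum_subtype (p := fun t => IsConnectedConfig food n t ∧ HoleFree t)
    (F := inferInstanceAs (Fintype (ChainState food n)))
    (Finset.univ.filter fun t : Finset (Site L) =>
    IsConnectedConfig food n t ∧ HoleFree t) (by simp) (transitionProb food lam s.1)
  refine (Eq.trans ?_ h.symm).trans ((Finset.sum_subset (Finset.filter_subset _ _) ?_).trans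
    (sum_transitionProb s.1))
  · rfl
  · intro t _ ht
    have ht' : ¬ (IsConnectedConfig food n t ∧ HoleFree t) := by simpa using ht
    -- No valid move leaves the state space, so restricting the sum loses nothing.
    rw [transitionProb, if_neg (fun h : t = s.1 => ht' (h.symm ▸ s.2))]
    exact moveProb_eq_zero fun h => ht' (h.state hroom s.2.1 s.2.2)

theorem Matrix.IsIrreducible.of_transGen {ι : Type*} {A : Matrix ι ι ℝ} (h0 : ∀ i j, 0 ≤ A i j)
    (h : ∀ i j, Relation.TransGen (fun i j => 0 < A i j) i j) : A.IsIrreducible := by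
  refine ⟨h0, fun i j => ?_⟩
  let := A.toQuiver
  induction h i j with
  | single hij => exact ⟨Quiver.Hom.toPath (PLift.up hij), by simp⟩
  | tail _ hjk ih =>
    obtain ⟨p, -⟩ := ih
    exact ⟨p.cons (PLift.up hjk), by simp⟩

theorem compressionMatrix_isIrreducible (hroom : LineFits L (n + 1)) (hlam : 0 < lam) :
    (compressionMatrix food n lam).IsIrreducible := by
  have hsto := compressionMatrix_mem_rowStochastic (food := food) hroom hlam
  rw [Matrix.mem_rowStochastic_iff_sum] at hsto
  have hreach : ∀ s t : ChainState food n, Relation.ReflTransGen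
      (fun s t => 0 < compressionMatrix food n lam s t) s t := by
    intro s t
    have h := s.2.1.reach hroom t.2.1 t.2.2
    have key : ∀ u, Relation.ReflTransGen (CompressionStep food) s.1 u →
        ∃ hu : IsConnectedConfig food n u ∧ HoleFree u, Relation.ReflTransGen
          (fun s t => 0 < compressionMatrix food n lam s t) s ⟨u, hu⟩ := by
      intro u hu
      induction hu with
      | refl => exact ⟨s.2, .refl⟩
      | tail _ h2 ih =>
        obtain ⟨hu, ih⟩ := ih
        exact ⟨h2.state hroom hu.1 hu.2, ih.tail (transitionProb_pos hlam h2)⟩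
    exact (key t.1 h).2
  have hne : ∀ s t : ChainState food n, s ≠ t → Relation.TransGen
      (fun s t => 0 < compressionMatrix food n lam s t) s t := fun s t hst =>
    ((Relation.reflTransGen_iff_eq_or_transGen).1 (hreach s t)).resolve_left hst.symm
  refine .of_transGen hsto.1 fun s t => ?_
  by_cases hst : s = t
  -- Irreducibility asks for a path of positive length from a state to itself: out and back, or, for
  -- a single state, the loop of probability one.
  · subst hst
    by_cases hex : ∃ u, s ≠ u
    · obtain ⟨u, hu⟩ := hex
      exact (hne s u hu).trans (hne u s hu.symm)
    · push Not at hex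
      have := hsto.2 s
      rw [Fintype.sum_eq_single s fun u hu => (hu (hex u).symm).elim] at this
      exact .single (by rw [this]; exact one_pos)
  · exact hne s t hst

end

theorem mainTheorem3 (L : ℕ) [NeZero L] (food : Site L) (n : ℕ) (hroom : LineFits L (n + 1)) :
    (∀ s t : Finset (Site L), IsConnectedConfig food n s → IsConnectedConfig food n t →
      HoleFree t → Relation.ReflTransGen (CompressionStep food) s t) ∧
    (∀ lam : ℝ, 0 < lam →
      compressionMatrix food n lam ∈ Matrix.rowStochastic ℝ (ChainState food n) ∧
      (compressionMatrix food n lam).IsIrreducible) :=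
  ⟨fun _ _ hs ht hfree => hs.reach hroom ht hfree, fun _ hlam =>
    ⟨compressionMatrix_mem_rowStochastic hroom hlam, compressionMatrix_isIrreducible hroom hlam⟩⟩
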